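/- For a Schwartz function $f$ on $\mathbb C$ let $$Tf(z)=-\frac1\pi\lim_{\varepsilon\to0^+}\int_{|\zeta-z|>\varepsilon}\frac{f(\zeta)}{(\zeta-z)^2}\,dm(\zeta),\qquad z\in\mathbb C,$$ be its Ahlfors–Beurling transform, where $m$ is Lebesgue measure; the limit exists for every $z$. For $p>1$ and a positive, locally integrable function $w$ on $\mathbb C$ put $$[w]_{A_p}=\sup_Q\Big(\frac1{|Q|}\int_Q w\,dm\Big)\Big(\frac1{|Q|}\int_Q w^{-1/(p-1)}\,dm\Big)^{p-1},$$ the supremum being over all squares $Q\subset\mathbb C$ of arbitrary orientation, and write $w\in A_p$ if $[w]_{A_p}<\infty$. Let $L^p(w)$ be the space of complex functions $f$ with $\|f\|_{L^p(w)}^p=\int_{\mathbb C}|f|^p\,w\,dm<\infty$, and let $p^*=\max\{p,\,p/(p-1)\}$. **Theorem.** For every $p>1$ there is a constant $C_p>0$, depending only on $p$, such that for every $w\in A_p$ the Schwartz class is contained in $L^p(w)$, the operator $T$ extends uniquely from the Schwartz class to a bounded linear operator on $L^p(w)$, and this extension, again denoted by $T$, satisfies $$\|T\|_{\mathcal B(L^p(w))}\le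 C_p\,[w]_{A_p}^{p^*/p}.$$ -/

import Mathlib

open MeasureTheory Filter Topology
open scoped ENNReal SchwartzMap

/-- The closed square in `ℂ` with centre `c` and side length `2 * r`, rotated by the angle `θ`. -/
def rotatedSquare (c : ℂ) (θ r : ℝ) : Set ℂ :=
  (fun s : ℂ => c + Complex.exp (θ * Complex.I) * s) '' {s : ℂ | |s.re| ≤ r ∧ |s.im| ≤ r}

/-- The Muckenhoupt characteristic
`[w]_p = sup_Q ⟨w⟩_Q * ⟨w ^ (-1 / (p - 1))⟩_Q ^ (p - 1)`,
the supremum running over all squares `Q` of `ℂ`, of arbitrary orientation. It is a supremum in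
`[0, ∞]`, and the averages `⟨·⟩_Q` are averages of nonnegative functions with values in
`[0, ∞]`. -/
noncomputable def apCharacteristic (p : ℝ) (w : ℂ → ℝ) : ℝ≥0∞ :=
  ⨆ (c : ℂ) (θ : ℝ) (r : ℝ) (_ : 0 < r),
    (laverage (volume.restrict (rotatedSquare c θ r)) fun z => ENNReal.ofReal (w z)) *
      (laverage (volume.restrict (rotatedSquare c θ r)) fun z => ENNReal.ofReal (w z ^ (-1 / (p - 1)))) ^ (p - 1)

/-- The class `A_p` of (almost everywhere) positive, locally integrable functions `w` on `ℂ` with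
`[w]_p < ∞`. -/
structure IsApWeight (p : ℝ) (w : ℂ → ℝ) : Prop where
  pos : ∀ᵐ z : ℂ, 0 < w z
  locallyIntegrable : LocallyIntegrable w volume
  characteristic_lt_top : apCharacteristic p w < ∞

/-- The measure `w(z) dm(z)` on `ℂ`. -/
noncomputable def weightMeasure (w : ℂ → ℝ) : Measure ℂ :=
  volume.withDensity fun z => ENNReal.ofReal (w z)

/-- An exponent `p > 1` is in particular at least one, so that `L^p` is a Banach space. -/
instance factOneLeOfRealOfOneLt (p : ℝ) [hp : Fact (1 < p)] : Fact (1 ≤ ENNReal.ofReal p) :=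
  ⟨ENNReal.one_le_ofReal.2 hp.out.le⟩

/-- The weighted space `L^p(w)` of complex functions with `∫ |f| ^ p * w < ∞`, normed by
`(∫ |f| ^ p * w) ^ (1 / p)`. -/
noncomputable abbrev WeightedLp (p : ℝ) (w : ℂ → ℝ) :=
  Lp ℂ (ENNReal.ofReal p) (weightMeasure w)

/-- The truncated integral `-(1 / π) ∫_{|ζ - z| > ε} f(ζ) / (ζ - z) ^ 2 dm(ζ)`. -/
noncomputable def truncatedBeurling (f : ℂ → ℂ) (z : ℂ) (ε : ℝ) : ℂ :=
  -(1 / (Real.pi : ℂ)) * ∫ ζ in {ζ : ℂ | ε < ‖ζ - z‖}, f ζ / (ζ - z) ^ 2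

/-- The Ahlfors–Beurling transform
`T f (z) = -(1 / π) p.v. ∫ f(ζ) / (ζ - z) ^ 2 dm(ζ)` of a Schwartz function. -/
noncomputable def beurling (f : 𝓢(ℂ, ℂ)) (z : ℂ) : ℂ :=
  limUnder (𝓝[>] 0) (truncatedBeurling f z)

/-- `A` is a bounded operator on `L^p(w)` that extends the Ahlfors–Beurling transform from the
Schwartz class: every Schwartz function `f` lies in `L^p(w)`, and `A f = T f`. -/
def IsBeurlingExtension (p : ℝ) [Fact (1 < p)] (w : ℂ → ℝ)
    (A : WeightedLp p w →L[ℂ] WeightedLp p w) : Prop :=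
  ∀ f : 𝓢(ℂ, ℂ), ∃ hf : MemLp f (ENNReal.ofReal p) (weightMeasure w),
    ∀ᵐ z : ℂ, A (hf.toLp f) z = beurling f z

/-! The kernel of `T` is, up to a nonzero factor, an average of dyadic Haar forms over all
positions, sizes and orientations of a square; each such form satisfies the sharp weighted bound,
and averaging preserves it.

Representation. For complex `v ≠ 0` the set `a + v * baseSquare` is a square of arbitrary centre,
size and orientation. Multiply the Haar coefficients of `f` and `g` on it and integrate against `v⁻²
dv da`, with `v` in an annulus. For two points `s`, `t` of the base square, the substitution `u = v
(s - t)` produces a difference of truncated Beurling integrals of `f`, times the squared direction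
of `s - t`. As the annulus exhausts the plane, the limit is `-π * haarConstant * ∫ g * T f`
(`tendsto_setIntegral_annulus`), and `haarConstant` is not zero (`haarConstant_re_neg`). Since `v⁻²
dv` is invariant under dilations, the annulus folds onto a single octave, and the scales `v / 2 ^ j`
become the generations of a tree of squares (`setIntegral_annulus_eq_sum`, `integral_treeSum`). It
remains to bound the tree sums of products of Haar coefficients, uniformly in `v` and in the depth.

Tree bound. Write `σ` for the dual weight and let `p ≥ 2`. Descend from a square until the mean of
`|f|` or of `|g|` exceeds four times its initial value. Up to that time orthogonality bounds the sum
by a multiple of the product of the two initial means (`treeSum_coeffProd_le`). At least half of the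
square is never stopped, and there the `A_p` condition pays for this product with one factor `[w]`
(`mul_le_haltSum`). Restarting at the stopped squares and applying Hölder's inequality bounds
everything by `[w]` times the norms of the martingale maximal functions of `f / σ` in `L^p(σ)` and
of `g / w` in `L^q(w)` (`treeSum_le_maxMoment`). These maximal operators have bounds that do not
depend on the weight (`maxMoment_le`). For `p < 2` the two functions exchange roles, and the
characteristic of `σ` is `[w] ^ (q - 1)`; this is the exponent `max p q / p`.

Conclusion. Testing against truncated extremal functions turns the bilinear bound into a norm bound
for Schwartz `f`. Weights in `A_p` grow polynomially, so Schwartz functions lie in `L^p(w)`, and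
density gives the unique extension. -/

namespace FourTree

/-! ### Stopped sums on a tree with four branches -/

variable {N : Type*} (ch : Fin 4 → N → N)

/-- A function on the nodes whose value at each node is the mean of its values at the children. -/
def IsMean {E : Type*} [AddCommGroup E] [Module ℝ E] (φ : N → E) : Prop :=
  ∀ y, φ y = (4 : ℝ)⁻¹ • ∑ i, φ (ch i y)

/-- The sum of `b` over the first `n` generations below a node, each generation being averaged. -/
noncomputable def treeSum {E : Type*} [AddCommGroup E] [Module ℝ E] (b : N → E) : ℕ → N → E
  | 0, _ => 0
  | n + 1, y => b y + (4 : ℝ)⁻¹ • ∑ i, treeSum b n (ch i y)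

open scoped Classical in
/-- Descend from a node for at most `n` generations; collect `φ k` where the descent is stopped
with `k` generations left, and `ψ` where it is never stopped. -/
noncomputable def haltSum (halt : N → Prop) (φ : ℕ → N → ℝ) (ψ : N → ℝ) : ℕ → N → ℝ
  | 0, y => if halt y then φ 0 y else ψ y
  | n + 1, y => if halt y then φ (n + 1) y else (4 : ℝ)⁻¹ * ∑ i, haltSum halt φ ψ n (ch i y)

/-- The `p`-th moment with respect to `S` of the maximum of `m` and of the values of `r` met in
`n` generations. -/
noncomputable def maxMoment (p : ℝ) (S r : N → ℝ) : ℕ → N → ℝ → ℝ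
  | 0, y, m => m ^ p * S y
  | n + 1, y, m => (4 : ℝ)⁻¹ * ∑ i, maxMoment p S r n (ch i y) (max m (r (ch i y)))

variable {ch}

theorem haltSum_of_halt {halt : N → Prop} {φ : ℕ → N → ℝ} {ψ : N → ℝ} {y : N} (h : halt y) (n : ℕ) :
    haltSum ch halt φ ψ n y = φ n y := by
  cases n <;> simp [haltSum, h]

theorem haltSum_zero_of_not {halt : N → Prop} {φ : ℕ → N → ℝ} {ψ : N → ℝ} {y : N} (h : ¬ halt y) :
    haltSum ch halt φ ψ 0 y = ψ y := by
  simp [haltSum, h]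

theorem haltSum_succ_of_not {halt : N → Prop} {φ : ℕ → N → ℝ} {ψ : N → ℝ} {y : N} (h : ¬ halt y)
    (n : ℕ) :
    haltSum ch halt φ ψ (n + 1) y = (4 : ℝ)⁻¹ * ∑ i, haltSum ch halt φ ψ n (ch i y) := by
  simp [haltSum, h]

theorem haltSum_mono {halt : N → Prop} {φ φ' : ℕ → N → ℝ} {ψ ψ' : N → ℝ} (n : ℕ)
    (hφ : ∀ k ≤ n, ∀ y, φ k y ≤ φ' k y) (hψ : ∀ y, ψ y ≤ ψ' y) (y : N) :
    haltSum ch halt φ ψ n y ≤ haltSum ch halt φ' ψ' n y := by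
  induction n generalizing y with
  | zero =>
    by_cases h : halt y
    · simpa [haltSum, h] using hφ 0 le_rfl y
    · simpa [haltSum, h] using hψ y
  | succ n ih =>
    by_cases h : halt y
    · simpa [haltSum, h] using hφ (n + 1) le_rfl y
    · rw [haltSum_succ_of_not h, haltSum_succ_of_not h]
      gcongr with i
      exact ih (fun k hk => hφ k (hk.trans n.le_succ)) _

theorem haltSum_add {halt : N → Prop} {φ φ' : ℕ → N → ℝ} {ψ ψ' : N → ℝ} (n : ℕ) (y : N) :
    haltSum ch halt φ ψ n y + haltSum ch halt φ' ψ' n y =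
      haltSum ch halt (fun k y => φ k y + φ' k y) (fun y => ψ y + ψ' y) n y := by
  induction n generalizing y with
  | zero => by_cases h : halt y <;> simp [haltSum, h]
  | succ n ih =>
    by_cases h : halt y
    · simp [haltSum, h]
    · simp only [haltSum_succ_of_not h, ← ih, Finset.sum_add_distrib]
      ring

theorem haltSum_const_mul {halt : N → Prop} {φ : ℕ → N → ℝ} {ψ : N → ℝ} (c : ℝ) (n : ℕ) (y : N) :
    c * haltSum ch halt φ ψ n y =
      haltSum ch halt (fun k y => c * φ k y) (fun y => c * ψ y) n y := by
  induction n generalizing y with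
  | zero => by_cases h : halt y <;> simp [haltSum, h]
  | succ n ih =>
    by_cases h : halt y
    · simp [haltSum, h]
    · simp only [haltSum_succ_of_not h, ← ih, ← Finset.mul_sum]
      ring

/-- Optional stopping: a martingale keeps its mean when it is sampled at a bounded stopping time. -/
theorem haltSum_isMean {halt : N → Prop} {μ : N → ℝ} (hμ : IsMean ch μ) (n : ℕ) (y : N) :
    haltSum ch halt (fun _ => μ) μ n y = μ y := by
  induction n generalizing y with
  | zero => by_cases h : halt y <;> simp [haltSum, h]
  | succ n ih =>
    by_cases h : halt y
    · simp [haltSum, h]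
    · simp only [haltSum_succ_of_not h, ih, hμ y, smul_eq_mul]

theorem haltSum_nonneg {halt : N → Prop} {φ : ℕ → N → ℝ} {ψ : N → ℝ}
    (hφ : ∀ k y, 0 ≤ φ k y) (hψ : ∀ y, 0 ≤ ψ y) (n : ℕ) (y : N) :
    0 ≤ haltSum ch halt φ ψ n y := by
  induction n generalizing y with
  | zero => by_cases h : halt y <;> simp [haltSum, h, hφ, hψ]
  | succ n ih =>
    by_cases h : halt y
    · simp [haltSum, h, hφ]
    · rw [haltSum_succ_of_not h]
      exact mul_nonneg (by norm_num) (Finset.sum_nonneg fun i _ => ih _)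

theorem mean_rpow_mul_rpow_le {p q : ℝ} (hpq : p.HolderConjugate q) {a b : Fin 4 → ℝ}
    (ha : ∀ i, 0 ≤ a i) (hb : ∀ i, 0 ≤ b i) :
    (4 : ℝ)⁻¹ * ∑ i, a i ^ (1 / p) * b i ^ (1 / q) ≤
      ((4 : ℝ)⁻¹ * ∑ i, a i) ^ (1 / p) * ((4 : ℝ)⁻¹ * ∑ i, b i) ^ (1 / q) := by
  have h := Real.inner_le_Lp_mul_Lq_of_nonneg Finset.univ hpq
    (f := fun i => a i ^ (1 / p)) (g := fun i => b i ^ (1 / q))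
    (fun i _ => Real.rpow_nonneg (ha i) _) (fun i _ => Real.rpow_nonneg (hb i) _)
  have e1 : ∀ i, (a i ^ (1 / p)) ^ p = a i := fun i => by
    rw [← Real.rpow_mul (ha i), one_div_mul_cancel hpq.ne_zero, Real.rpow_one]
  have e2 : ∀ i, (b i ^ (1 / q)) ^ q = b i := fun i => by
    rw [← Real.rpow_mul (hb i), one_div_mul_cancel hpq.symm.ne_zero, Real.rpow_one]
  simp only [e1, e2] at h
  rw [Real.mul_rpow (by norm_num) (Finset.sum_nonneg fun i _ => ha i),
    Real.mul_rpow (by norm_num) (Finset.sum_nonneg fun i _ => hb i)]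
  have e3 : (4 : ℝ)⁻¹ = (4 : ℝ)⁻¹ ^ (1 / p) * (4 : ℝ)⁻¹ ^ (1 / q) := by
    rw [← Real.rpow_add (by norm_num), one_div, one_div, hpq.inv_add_inv_eq_one, Real.rpow_one]
  calc _ ≤ (4 : ℝ)⁻¹ * ((∑ i, a i) ^ (1 / p) * (∑ i, b i) ^ (1 / q)) := by gcongr
    _ = _ := by conv_lhs => rw [e3]
                ring

/-- A halted sum is an iterated mean, so Hölder's inequality for four numbers can be applied
generation by generation. -/
theorem haltSum_rpow_mul_rpow_le {p q : ℝ} (hpq : p.HolderConjugate q) {halt : N → Prop}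
    {φ φ' : ℕ → N → ℝ} {ψ ψ' : N → ℝ} (hφ : ∀ k y, 0 ≤ φ k y) (hφ' : ∀ k y, 0 ≤ φ' k y)
    (hψ : ∀ y, 0 ≤ ψ y) (hψ' : ∀ y, 0 ≤ ψ' y) (n : ℕ) (y : N) :
    haltSum ch halt (fun k y => φ k y ^ (1 / p) * φ' k y ^ (1 / q))
        (fun y => ψ y ^ (1 / p) * ψ' y ^ (1 / q)) n y ≤
      haltSum ch halt φ ψ n y ^ (1 / p) * haltSum ch halt φ' ψ' n y ^ (1 / q) := by
  induction n generalizing y with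
  | zero => by_cases h : halt y <;> simp [haltSum, h]
  | succ n ih =>
    by_cases h : halt y
    · simp [haltSum, h]
    · simp only [haltSum_succ_of_not h]
      refine le_trans ?_ (mean_rpow_mul_rpow_le hpq (fun i => haltSum_nonneg hφ hψ n _)
        (fun i => haltSum_nonneg hφ' hψ' n _))
      gcongr with i
      exact ih _

/-! ### Orthogonality up to a stopping time -/

theorem IsMean.le_four_mul {μ : N → ℝ} (hμ : IsMean ch μ) (h0 : ∀ y, 0 ≤ μ y) (i : Fin 4) (y : N) :
    μ (ch i y) ≤ 4 * μ y := by
  rw [hμ y, smul_eq_mul, ← mul_assoc]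
  norm_num
  exact Finset.single_le_sum (f := fun i => μ (ch i y)) (fun j _ => h0 _) (Finset.mem_univ i)

/-- The weak-type bound: at a halted node `X / a + Y / b` exceeds one, and optional stopping
preserves the mean of this martingale. -/
theorem haltSum_one_zero_le {X Y : N → ℝ} (hX : IsMean ch X) (hY : IsMean ch Y)
    (hX0 : ∀ y, 0 ≤ X y) (hY0 : ∀ y, 0 ≤ Y y) {a b : ℝ} (ha : 0 < a) (hb : 0 < b) (n : ℕ) (y : N) :
    haltSum ch (fun y => a < X y ∨ b < Y y) (fun _ _ => 1) (fun _ => 0) n y ≤ X y / a + Y y / b := by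
  set st : N → Prop := fun y => a < X y ∨ b < Y y with hstdef
  have key : ∀ k y, haltSum ch st (fun _ _ => 1) (fun _ => 0) k y ≤
      haltSum ch st (fun _ y => X y / a + Y y / b)
        (fun y => X y / a + Y y / b) k y := by
    intro k y
    have hnn : ∀ y, 0 ≤ X y / a + Y y / b := fun y =>
      add_nonneg (div_nonneg (hX0 y) ha.le) (div_nonneg (hY0 y) hb.le)
    have hst : ∀ y, st y → 1 ≤ X y / a + Y y / b := by
      rintro y (h | h)
      · have := (one_lt_div ha).2 h
        have := div_nonneg (hY0 y) hb.le
        linarith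
      · have := (one_lt_div hb).2 h
        have := div_nonneg (hX0 y) ha.le
        linarith
    induction k generalizing y with
    | zero =>
      by_cases h : st y
      · rw [haltSum_of_halt h, haltSum_of_halt h]; exact hst y h
      · rw [haltSum_zero_of_not h, haltSum_zero_of_not h]; exact hnn y
    | succ k ih =>
      by_cases h : st y
      · rw [haltSum_of_halt h, haltSum_of_halt h]; exact hst y h
      · rw [haltSum_succ_of_not h, haltSum_succ_of_not h]
        gcongr with i
        exact ih _
  refine (key n y).trans (le_of_eq (haltSum_isMean (μ := fun y => X y / a + Y y / b) ?_ n y))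
  intro y
  simp only [smul_eq_mul, Finset.sum_add_distrib, ← Finset.sum_div]
  rw [hX y, hY y, smul_eq_mul, smul_eq_mul]
  ring

/-- The right side is eight times the variance of the four child values, which controls each
difference of two of them. Summed over generations, these variances telescope. -/
theorem sq_norm_sub_le {F : N → ℂ} (hF : IsMean ch F) (y : N) :
    ‖F (ch 0 y) - F (ch 1 y)‖ ^ 2 ≤ 8 * ((4 : ℝ)⁻¹ * ∑ i, ‖F (ch i y)‖ ^ 2 - ‖F y‖ ^ 2) := by
  have key : ∀ a b c d : ℝ, (a - b) ^ 2 ≤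
      8 * (4⁻¹ * (a ^ 2 + b ^ 2 + c ^ 2 + d ^ 2) - (4⁻¹ * (a + b + c + d)) ^ 2) := by
    intro a b c d
    nlinarith [sq_nonneg (a + b - c - d), sq_nonneg (c - d)]
  have h1 := key (F (ch 0 y)).re (F (ch 1 y)).re (F (ch 2 y)).re (F (ch 3 y)).re
  have h2 := key (F (ch 0 y)).im (F (ch 1 y)).im (F (ch 2 y)).im (F (ch 3 y)).im
  have e1 : (F y).re = 4⁻¹ * ((F (ch 0 y)).re + (F (ch 1 y)).re + (F (ch 2 y)).re + (F (ch 3 y)).re) := by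
    rw [hF y, Complex.real_smul, Complex.re_ofReal_mul]
    simp [Fin.sum_univ_four]
  have e2 : (F y).im = 4⁻¹ * ((F (ch 0 y)).im + (F (ch 1 y)).im + (F (ch 2 y)).im + (F (ch 3 y)).im) := by
    rw [hF y, Complex.real_smul, Complex.im_ofReal_mul]
    simp [Fin.sum_univ_four]
  rw [← e1] at h1
  rw [← e2] at h2
  simp only [Fin.sum_univ_four, Complex.sq_norm, Complex.normSq_apply, Complex.sub_re,
    Complex.sub_im]
  nlinarith

/-- The product of the two differences taken at a node. -/
noncomputable def coeffProd (ch : Fin 4 → N → N) (F G : N → ℂ) (y : N) : ℝ :=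
  ‖F (ch 0 y) - F (ch 1 y)‖ * ‖G (ch 0 y) - G (ch 1 y)‖

/-- The last term is a potential: the remaining room for the energies of `F` and `G`. Each step
before halting consumes at least its own product of differences. Children of a node that is not
halted exceed the thresholds by a factor of at most four, so the potential stays nonnegative. -/
theorem treeSum_coeffProd_le {F G : N → ℂ} {X Y : N → ℝ} (hF : IsMean ch F) (hG : IsMean ch G)
    (hX : IsMean ch X) (hY : IsMean ch Y) (hFX : ∀ y, ‖F y‖ ≤ X y) (hGY : ∀ y, ‖G y‖ ≤ Y y)
    {a b : ℝ} (ha : 0 < a) (hb : 0 < b) (n : ℕ) (y : N) (hya : ‖F y‖ ≤ 4 * a)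
    (hyb : ‖G y‖ ≤ 4 * b) :
    treeSum ch (coeffProd ch F G) n y ≤
      haltSum ch (fun y => a < X y ∨ b < Y y) (treeSum ch (coeffProd ch F G)) (fun _ => 0) n y +
        4 * (b / a * (16 * a ^ 2 - ‖F y‖ ^ 2) + a / b * (16 * b ^ 2 - ‖G y‖ ^ 2)) := by
  set st : N → Prop := fun y => a < X y ∨ b < Y y with hstdef
  have hnn : ∀ y, ‖F y‖ ≤ 4 * a → ‖G y‖ ≤ 4 * b →
      0 ≤ 4 * (b / a * (16 * a ^ 2 - ‖F y‖ ^ 2) + a / b * (16 * b ^ 2 - ‖G y‖ ^ 2)) := by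
    intro y h1 h2
    have h1' : 0 ≤ 16 * a ^ 2 - ‖F y‖ ^ 2 := by nlinarith [norm_nonneg (F y)]
    have h2' : 0 ≤ 16 * b ^ 2 - ‖G y‖ ^ 2 := by nlinarith [norm_nonneg (G y)]
    positivity
  induction n generalizing y with
  | zero =>
    have := hnn y hya hyb
    by_cases h : st y
    · rw [haltSum_of_halt h]; linarith
    · rw [haltSum_zero_of_not h]; simpa [treeSum] using this
  | succ n ih =>
    by_cases h : st y
    · rw [haltSum_of_halt h]
      have := hnn y hya hyb
      linarith
    · rw [haltSum_succ_of_not h]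
      replace h : ¬ (a < X y ∨ b < Y y) := h
      push Not at h
      have hX0 : ∀ y, 0 ≤ X y := fun y => (norm_nonneg _).trans (hFX y)
      have hY0 : ∀ y, 0 ≤ Y y := fun y => (norm_nonneg _).trans (hGY y)
      have hi : ∀ i, _ := fun i => ih (ch i y)
        ((hFX _).trans ((hX.le_four_mul hX0 i y).trans (by linarith [h.1])))
        ((hGY _).trans ((hY.le_four_mul hY0 i y).trans (by linarith [h.2])))
      have hs := Finset.sum_le_sum fun i (_ : i ∈ Finset.univ) => hi i
      have e1 := sq_norm_sub_le hF y
      have e2 := sq_norm_sub_le hG y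
      -- The arithmetic-geometric mean inequality, weighted so that both energies scale like `a *
      -- b`. With the factor `8` from the variance bound this gives the constant `4` of the
      -- potential.
      have e3 : coeffProd ch F G y ≤ 2⁻¹ * (b / a * ‖F (ch 0 y) - F (ch 1 y)‖ ^ 2 +
          a / b * ‖G (ch 0 y) - G (ch 1 y)‖ ^ 2) := by
        have : 0 ≤ 2⁻¹ * (a / b) * (b / a * ‖F (ch 0 y) - F (ch 1 y)‖ -
          ‖G (ch 0 y) - G (ch 1 y)‖) ^ 2 := by positivity
        have hab : a / b * (b / a) = 1 := by field_simp
        unfold coeffProd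
        set u := ‖F (ch 0 y) - F (ch 1 y)‖
        set v := ‖G (ch 0 y) - G (ch 1 y)‖
        have : 2⁻¹ * (a / b) * (b / a * u - v) ^ 2 =
          2⁻¹ * (b / a * u ^ 2 + a / b * v ^ 2) - u * v := by field_simp; ring
        linarith
      have e1' := mul_le_mul_of_nonneg_left e1 (div_pos hb ha).le
      have e2' := mul_le_mul_of_nonneg_left e2 (div_pos ha hb).le
      simp only [treeSum, smul_eq_mul]
      simp only [Fin.sum_univ_four] at hs e1' e2' ⊢
      linarith

/-! ### The weighted martingale maximal function -/

theorem maxMoment_mono {p : ℝ} (hp : 0 ≤ p) {S r : N → ℝ} (hS : ∀ y, 0 ≤ S y) (n : ℕ) (y : N)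
    {m m' : ℝ} (hm : 0 ≤ m) (h : m ≤ m') : maxMoment ch p S r n y m ≤ maxMoment ch p S r n y m' := by
  induction n generalizing y m m' with
  | zero =>
    simp only [maxMoment]
    have := hS y
    gcongr
  | succ n ih =>
    simp only [maxMoment]
    gcongr with i
    exact ih _ (le_max_of_le_left hm) (max_le_max h le_rfl)

theorem maxMoment_nonneg {p : ℝ} {S r : N → ℝ} (hS : ∀ y, 0 ≤ S y) (n : ℕ) (y : N)
    {m : ℝ} (hm : 0 ≤ m) : 0 ≤ maxMoment ch p S r n y m := by
  induction n generalizing y m with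
  | zero => exact mul_nonneg (Real.rpow_nonneg hm _) (hS y)
  | succ n ih =>
    exact mul_nonneg (by norm_num) (Finset.sum_nonneg fun i _ => ih _ (le_max_of_le_left hm))

/-- Restarting the running maximum at a halted node only loses earlier values, and on paths that are
never halted the maximum is at least `r₀`. Hence the restarted pieces fit into one maximal function
without an additional constant. -/
theorem haltSum_maxMoment_le {p : ℝ} (hp : 0 ≤ p) {S r : N → ℝ} (hS : ∀ y, 0 ≤ S y)
    (hr : ∀ y, 0 ≤ r y) (halt : N → Prop) {r₀ : ℝ} (hr₀ : 0 ≤ r₀) (n : ℕ) (y : N) {m : ℝ}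
    (hm : r₀ ≤ m) :
    haltSum ch halt (fun k y => maxMoment ch p S r k y (r y)) (fun y => r₀ ^ p * S y) n y ≤
      maxMoment ch p S r n y (max m (r y)) := by
  induction n generalizing y m with
  | zero =>
    by_cases h : halt y
    · rw [haltSum_of_halt h]
      exact maxMoment_mono hp hS _ _ (hr y) (le_max_right _ _)
    · rw [haltSum_zero_of_not h, maxMoment]
      have := hS y
      gcongr
      exact le_max_of_le_left hm
  | succ n ih =>
    by_cases h : halt y
    · rw [haltSum_of_halt h]
      exact maxMoment_mono hp hS _ _ (hr y) (le_max_right _ _)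
    · rw [haltSum_succ_of_not h, maxMoment]
      gcongr with i
      exact ih _ (le_max_of_le_left hm)

/-- Doob's maximal inequality by a Bellman function. For fixed `m` the right side is linear in `S`,
`X`, `P`, hence a martingale. As a function of `m` it decreases up to `X / S`, so raising the
maximum to the current ratio does not increase it. -/
theorem maxMoment_le {p q : ℝ} (hpq : p.HolderConjugate q) {S X P : N → ℝ} (hS : ∀ y, 0 < S y)
    (hX : ∀ y, 0 ≤ X y) (hP : ∀ y, 0 ≤ P y) (hSm : IsMean ch S) (hXm : IsMean ch X)
    (hPm : IsMean ch P) (hXP : ∀ y, X y ≤ P y ^ (1 / p) * S y ^ (1 / q)) (n : ℕ) (y : N) {m : ℝ}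
    (hm : X y / S y ≤ m) :
    maxMoment ch p S (fun y => X y / S y) n y m ≤
      2 * (S y * m ^ p - q * m ^ (p - 1) * X y) + (2 * q) ^ p * P y := by
  have hp := hpq.pos
  have hq := hpq.symm.pos
  induction n generalizing y m with
  | zero =>
    simp only [maxMoment]
    have hm0 : 0 ≤ m := (div_nonneg (hX y) (hS y).le).trans hm
    have hmS : 0 ≤ m ^ p * S y := mul_nonneg (Real.rpow_nonneg hm0 _) (hS y).le
    -- At the last generation the term `2 * q * m ^ (p - 1) * X` must be absorbed. Hölder's bound
    -- for `X` and Young's inequality split it into `m ^ p * S` and `(2 * q) ^ p * P`.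
    have young := Real.young_inequality_of_nonneg (a := 2 * q * P y ^ (1 / p))
      (b := (m ^ p * S y) ^ (1 / q)) (p := p) (q := q)
      (mul_nonneg (by positivity) (Real.rpow_nonneg (hP y) _)) (Real.rpow_nonneg hmS _) hpq
    rw [Real.mul_rpow (by positivity) (Real.rpow_nonneg (hP y) _), ← Real.rpow_mul (hP y),
      ← Real.rpow_mul hmS, one_div_mul_cancel hpq.ne_zero, one_div_mul_cancel hpq.symm.ne_zero,
      Real.rpow_one, Real.rpow_one, Real.mul_rpow (Real.rpow_nonneg hm0 _) (hS y).le,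
      ← Real.rpow_mul hm0] at young
    have e : p * (1 / q) = p - 1 := by
      rw [mul_one_div, div_eq_iff hpq.symm.ne_zero, hpq.sub_one_mul_conj]
    rw [e] at young
    have h1 : 2 * q * m ^ (p - 1) * X y ≤
        2 * q * m ^ (p - 1) * (P y ^ (1 / p) * S y ^ (1 / q)) := by
      have := Real.rpow_nonneg hm0 (p - 1)
      exact mul_le_mul_of_nonneg_left (hXP y) (by positivity)
    have h2 : (2 * q) ^ p * P y / p ≤ (2 * q) ^ p * P y :=
      div_le_self (mul_nonneg (by positivity) (hP y)) hpq.lt.le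
    have h3 : m ^ p * S y / q ≤ m ^ p * S y := div_le_self hmS hpq.symm.lt.le
    linarith
  | succ n ih =>
    simp only [maxMoment]
    have hm0 : 0 ≤ m := (div_nonneg (hX y) (hS y).le).trans hm
    have key : ∀ i, maxMoment ch p S (fun y => X y / S y) n (ch i y)
        (max m (X (ch i y) / S (ch i y))) ≤
        2 * (S (ch i y) * m ^ p - q * m ^ (p - 1) * X (ch i y)) + (2 * q) ^ p * P (ch i y) := by
      intro i
      refine (ih (ch i y) (le_max_right _ _)).trans ?_
      rcases le_total (X (ch i y) / S (ch i y)) m with h | h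
      · rw [max_eq_left h]
      -- The maximum jumps from `m` to the ratio `r`. The claim is then `q * r * m ^ (p - 1) ≤ (q -
      -- 1) * r ^ p + m ^ p`, which is Young's inequality.
      · rw [max_eq_right h]
        set r := X (ch i y) / S (ch i y) with hr
        have hX' : X (ch i y) = r * S (ch i y) := by
          rw [hr, div_mul_cancel₀ _ (hS _).ne']
        have hr0 : 0 ≤ r := hm0.trans h
        rw [hX']
        have e1 : r ^ (p - 1) * r = r ^ p := by
          rcases hr0.eq_or_lt with h0 | h0
          · rw [← h0, Real.zero_rpow hpq.ne_zero, mul_zero]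
          · rw [← Real.rpow_add_one h0.ne', sub_add_cancel]
        have young := Real.young_inequality_of_nonneg (a := r) (b := m ^ (p - 1)) hr0
          (Real.rpow_nonneg hm0 _) hpq
        rw [← Real.rpow_mul hm0, hpq.sub_one_mul_conj] at young
        have e2 : q / p = q - 1 := by
          rw [div_eq_iff hpq.ne_zero, hpq.symm.sub_one_mul_conj]
        have h4 : q * (r * m ^ (p - 1)) ≤ (q - 1) * r ^ p + m ^ p := by
          calc _ ≤ q * (r ^ p / p + m ^ p / q) := by gcongr
            _ = q / p * r ^ p + m ^ p := by field_simp
            _ = _ := by rw [e2]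
        have h5 := mul_le_mul_of_nonneg_left h4 (hS (ch i y)).le
        have e3 : q * r ^ (p - 1) * (r * S (ch i y)) = q * r ^ p * S (ch i y) := by
          rw [← e1]; ring
        rw [e3]
        linarith
    have hs := Finset.sum_le_sum fun i (_ : i ∈ Finset.univ) => key i
    have a1 := hSm y
    have a2 := hXm y
    have a3 := hPm y
    simp only [smul_eq_mul] at a1 a2 a3
    rw [a1, a2, a3]
    simp only [Fin.sum_univ_four] at hs ⊢
    linarith

/-! ### The sharp weighted bound on the tree -/

theorem IsMean.child_eq_zero {X : N → ℝ} (hX : IsMean ch X) (h0 : ∀ y, 0 ≤ X y) {y : N}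
    (h : X y = 0) (i : Fin 4) : X (ch i y) = 0 :=
  le_antisymm (by simpa [h] using hX.le_four_mul h0 i y) (h0 _)

theorem treeSum_coeffProd_eq_zero {F G : N → ℂ} {X : N → ℝ}
    (hX : IsMean ch X) (hFX : ∀ y, ‖F y‖ ≤ X y) (n : ℕ) (y : N) (hy : X y = 0) :
    treeSum ch (coeffProd ch F G) n y = 0 := by
  have hX0 : ∀ y, 0 ≤ X y := fun y => (norm_nonneg _).trans (hFX y)
  induction n generalizing y with
  | zero => rfl
  | succ n ih =>
    have hF : ∀ i, F (ch i y) = 0 := fun i =>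
      norm_le_zero_iff.1 ((hFX _).trans (hX.child_eq_zero hX0 hy i).le)
    simp [treeSum, ih _ (hX.child_eq_zero hX0 hy _), coeffProd, hF]

theorem coeffProd_comm (F G : N → ℂ) : coeffProd ch F G = coeffProd ch G F := by
  ext y; exact mul_comm _ _

/-- This is where the characteristic enters, linearly because `p ≥ 2`. The lower bound `W ≥ S ^ (1 -
p)` reduces the integrand to the convex decreasing power `S ^ (2 - p)`. On the unhalted part, of
mass at least one half, the mean of `S` cannot exceed `S x`, so this power has a large mean there.
-/
theorem mul_le_haltSum {p q A : ℝ} (hpq : p.HolderConjugate q) (hp2 : 2 ≤ p) {S W X Y : N → ℝ}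
    (hS : ∀ y, 0 < S y) (hW : ∀ y, 0 < W y) (hSm : IsMean ch S) (hX : IsMean ch X)
    (hY : IsMean ch Y) (hX0 : ∀ y, 0 ≤ X y) (hY0 : ∀ y, 0 ≤ Y y)
    (h1 : ∀ y, 1 ≤ W y * S y ^ (p - 1)) (h2 : ∀ y, W y * S y ^ (p - 1) ≤ A) (n : ℕ) (x : N)
    (hXx : 0 < X x) (hYx : 0 < Y x) :
    S x * W x ≤ 4 ^ (p - 1) * A * haltSum ch (fun y => 4 * X x < X y ∨ 4 * Y x < Y y)
      (fun _ _ => 0) (fun y => S y ^ (1 / p) * W y ^ (1 / q)) n x := by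
  set st : N → Prop := fun y => 4 * X x < X y ∨ 4 * Y x < Y y with hst
  set c : ℝ := 4 ^ (2 - p) * S x ^ (2 - p) with hc
  have hc0 : 0 < c := mul_pos (by positivity) (Real.rpow_pos_of_pos (hS x) _)
  have hSW : ∀ y, S y ^ (2 - p) ≤ S y ^ (1 / p) * W y ^ (1 / q) := by
    intro y
    have hpow : (1 : ℝ) ≤ (W y * S y ^ (p - 1)) ^ (1 / q) :=
      Real.one_le_rpow (h1 y) (one_div_nonneg.2 hpq.symm.nonneg)
    rw [Real.mul_rpow (hW y).le (Real.rpow_nonneg (hS y).le _), ← Real.rpow_mul (hS y).le] at hpow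
    have e : 1 / p = (2 - p) + (p - 1) * (1 / q) := by
      have : 1 / q = 1 - 1 / p := by
        have := hpq.inv_add_inv_eq_one; rw [one_div, one_div]; linarith
      rw [this]
      have := hpq.ne_zero
      field_simp
      ring
    rw [e, Real.rpow_add (hS y), mul_assoc, mul_comm (S y ^ ((p - 1) * (1 / q)))]
    exact le_mul_of_one_le_right (Real.rpow_nonneg (hS y).le _) hpow
  -- An affine minorant of the power `2 - p`, vanishing at `S y = 4 * S x`. Over the unhalted part
  -- it has mean at least `c * (1 / 2 - 1 / 4)`, which is the `c / 4` below.
  have hpt : ∀ y, c * 1 + (-(c / (4 * S x))) * S y ≤ S y ^ (1 / p) * W y ^ (1 / q) := by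
    intro y
    refine le_trans ?_ (hSW y)
    have e : c * 1 + (-(c / (4 * S x))) * S y = c * (1 - S y / (4 * S x)) := by ring
    rw [e]
    have hSx := hS x
    rcases le_total (S y) (4 * S x) with h | h
    · have : (4 * S x) ^ (2 - p) ≤ S y ^ (2 - p) :=
        Real.rpow_le_rpow_of_nonpos (hS y) h (by linarith)
      rw [Real.mul_rpow (by norm_num) hSx.le] at this
      refine le_trans ?_ this
      refine mul_le_of_le_one_right hc0.le ?_
      have := div_nonneg (hS y).le (mul_pos four_pos hSx).le
      linarith
    · have : 1 ≤ S y / (4 * S x) := (one_le_div (by positivity)).2 h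
      have h5 : c * (1 - S y / (4 * S x)) ≤ 0 :=
        mul_nonpos_of_nonneg_of_nonpos hc0.le (by linarith)
      exact h5.trans (Real.rpow_nonneg (hS y).le _)
  have hL : haltSum ch st (fun _ _ => 0) (fun y => c * 1 + (-(c / (4 * S x))) * S y) n x ≤
      haltSum ch st (fun _ _ => 0) (fun y => S y ^ (1 / p) * W y ^ (1 / q)) n x :=
    haltSum_mono n (fun _ _ _ => le_rfl) hpt x
  have e1 : haltSum ch st (fun _ _ => 0) (fun y => c * 1 + (-(c / (4 * S x))) * S y) n x =
      c * haltSum ch st (fun _ _ => 0) (fun _ => 1) n x +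
        (-(c / (4 * S x))) * haltSum ch st (fun _ _ => 0) S n x := by
    rw [haltSum_const_mul, haltSum_const_mul, haltSum_add]
    simp
  have e2 : haltSum ch st (fun _ _ => 1) (fun _ => 0) n x +
      haltSum ch st (fun _ _ => 0) (fun _ => 1) n x = 1 := by
    rw [haltSum_add]
    simp only [add_zero, zero_add]
    exact haltSum_isMean (μ := fun _ => 1) (fun y => by simp) n x
  have e3 := haltSum_one_zero_le hX hY hX0 hY0 (mul_pos four_pos hXx) (mul_pos four_pos hYx) n x
  have e4 : X x / (4 * X x) + Y x / (4 * Y x) = 1 / 2 := by field_simp; norm_num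
  rw [e4] at e3
  have e5 : haltSum ch st (fun _ _ => 0) S n x ≤ S x := by
    rw [← haltSum_isMean (halt := st) hSm n x]
    exact haltSum_mono n (fun _ _ _ => (hS _).le) (fun _ => le_rfl) x
  have hlow : c / 4 ≤ haltSum ch st (fun _ _ => 0) (fun y => S y ^ (1 / p) * W y ^ (1 / q)) n x := by
    refine le_trans ?_ hL
    rw [e1]
    have f1 : c * (1 / 2) ≤ c * haltSum ch st (fun _ _ => 0) (fun _ => 1) n x := by
      gcongr; linarith
    have f2 : c / (4 * S x) * haltSum ch st (fun _ _ => 0) S n x ≤ c / (4 * S x) * S x := by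
      have := hS x
      gcongr
    have f3 : c / (4 * S x) * S x = c / 4 := by
      have := (hS x).ne'
      field_simp
    linarith
  have hA : 0 ≤ A := zero_le_one.trans ((h1 x).trans (h2 x))
  calc S x * W x = (W x * S x ^ (p - 1)) * S x ^ (2 - p) := by
        rw [mul_assoc, ← Real.rpow_add (hS x), show p - 1 + (2 - p) = 1 by ring, Real.rpow_one,
          mul_comm]
    _ ≤ A * S x ^ (2 - p) := by
        gcongr
        · exact Real.rpow_nonneg (hS x).le _
        · exact h2 x
    _ = 4 ^ (p - 1) * A * (c / 4) := by
        have : (4 : ℝ) ^ (p - 1) * (4 ^ (2 - p)) = 4 := by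
          rw [← Real.rpow_add four_pos, show p - 1 + (2 - p) = 1 by ring, Real.rpow_one]
        calc A * S x ^ (2 - p) = A * S x ^ (2 - p) * (4 ^ (p - 1) * (4 ^ (2 - p)) / 4) := by
              rw [this]; ring
          _ = _ := by rw [hc]; ring
    _ ≤ _ := by gcongr

/-- Induction on the depth, restarting at the halted nodes. The energy before halting is charged to
the unhalted leaves, the rest to the halted nodes by induction. Both parts have the form `u ^ (1 /
p) * v ^ (1 / q)` with the same constant, so one use of Hölder's inequality reassembles the bound
and constants do not accumulate. -/
theorem treeSum_le_maxMoment {p q A : ℝ} (hpq : p.HolderConjugate q) (hp2 : 2 ≤ p)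
    {F G : N → ℂ} {S W X Y : N → ℝ} (hF : IsMean ch F) (hG : IsMean ch G)
    (hS : ∀ y, 0 < S y) (hW : ∀ y, 0 < W y) (hSm : IsMean ch S) (hX : IsMean ch X)
    (hY : IsMean ch Y) (hFX : ∀ y, ‖F y‖ ≤ X y) (hGY : ∀ y, ‖G y‖ ≤ Y y)
    (h1 : ∀ y, 1 ≤ W y * S y ^ (p - 1)) (h2 : ∀ y, W y * S y ^ (p - 1) ≤ A) (n : ℕ) (x : N) :
    treeSum ch (coeffProd ch F G) n x ≤ 2048 * 4 ^ (p - 1) * A *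
      (maxMoment ch p S (fun y => X y / S y) n x (X x / S x) ^ (1 / p) *
        maxMoment ch q W (fun y => Y y / W y) n x (Y x / W x) ^ (1 / q)) := by
  have hX0 : ∀ y, 0 ≤ X y := fun y => (norm_nonneg _).trans (hFX y)
  have hY0 : ∀ y, 0 ≤ Y y := fun y => (norm_nonneg _).trans (hGY y)
  have hr : ∀ y, 0 ≤ X y / S y := fun y => div_nonneg (hX0 y) (hS y).le
  have hs : ∀ y, 0 ≤ Y y / W y := fun y => div_nonneg (hY0 y) (hW y).le
  have hA : 0 ≤ A := zero_le_one.trans ((h1 x).trans (h2 x))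
  induction n using Nat.strong_induction_on generalizing x with
  | _ n ih =>
  have hU0 : ∀ k y, 0 ≤ maxMoment ch p S (fun y => X y / S y) k y (X y / S y) := fun k y =>
    maxMoment_nonneg (fun y => (hS y).le) _ _ (hr y)
  have hV0 : ∀ k y, 0 ≤ maxMoment ch q W (fun y => Y y / W y) k y (Y y / W y) := fun k y =>
    maxMoment_nonneg (fun y => (hW y).le) _ _ (hs y)
  have hrhs : 0 ≤ 2048 * 4 ^ (p - 1) * A *
      (maxMoment ch p S (fun y => X y / S y) n x (X x / S x) ^ (1 / p) *
        maxMoment ch q W (fun y => Y y / W y) n x (Y x / W x) ^ (1 / q)) := by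
    have := hU0 n x
    have := hV0 n x
    positivity
  -- If either mean vanishes, a threshold would be zero; the sum is then zero as well.
  rcases (hX0 x).eq_or_lt with hXx | hXx
  · rwa [treeSum_coeffProd_eq_zero hX hFX n x hXx.symm]
  rcases (hY0 x).eq_or_lt with hYx | hYx
  · rwa [coeffProd_comm, treeSum_coeffProd_eq_zero hY hGY n x hYx.symm]
  cases n with
  | zero => exact hrhs
  | succ n =>
  set st : N → Prop := fun y => 4 * X x < X y ∨ 4 * Y x < Y y with hst
  have h_halt : ¬ st x := by
    rintro (h | h) <;> linarith
  set K : ℝ := 2048 * 4 ^ (p - 1) * A with hK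
  have hK0 : 0 ≤ K := by positivity
  set U : ℕ → N → ℝ := fun k y => maxMoment ch p S (fun y => X y / S y) k y (X y / S y) with hU
  set V : ℕ → N → ℝ := fun k y => maxMoment ch q W (fun y => Y y / W y) k y (Y y / W y) with hV
  set r₀ := X x / S x with hr₀
  set s₀ := Y x / W x with hs₀
  have hr₀0 : 0 ≤ r₀ := hr x
  have hs₀0 : 0 ≤ s₀ := hs x
  have htested := treeSum_coeffProd_le hF hG hX hY hFX hGY (mul_pos four_pos hXx)
    (mul_pos four_pos hYx) (n + 1) x ((hFX x).trans (by linarith)) ((hGY x).trans (by linarith))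
  -- With thresholds `4 * X x` and `4 * Y x` each of the two terms is `4 * 256 * X x * Y x`, whence
  -- `2048`.
  have henergy : 4 * (4 * Y x / (4 * X x) * (16 * (4 * X x) ^ 2 - ‖F x‖ ^ 2) +
      4 * X x / (4 * Y x) * (16 * (4 * Y x) ^ 2 - ‖G x‖ ^ 2)) ≤ 2048 * (X x * Y x) := by
    calc _ ≤ 4 * (4 * Y x / (4 * X x) * (16 * (4 * X x) ^ 2) +
      4 * X x / (4 * Y x) * (16 * (4 * Y x) ^ 2)) := by
          gcongr
          · linarith [sq_nonneg ‖F x‖]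
          · linarith [sq_nonneg ‖G x‖]
      _ = _ := by field_simp; ring
  -- The node `x` is not halted, so halting leaves at most `n` generations and the induction
  -- hypothesis applies.
  have hinduct : haltSum ch st (treeSum ch (coeffProd ch F G)) (fun _ => 0) (n + 1) x ≤
      haltSum ch st (fun k y => K * (U k y ^ (1 / p) * V k y ^ (1 / q))) (fun _ => 0) (n + 1) x := by
    rw [haltSum_succ_of_not h_halt, haltSum_succ_of_not h_halt]
    gcongr with i
    exact haltSum_mono n (fun k hk y => ih k (by omega) y) (fun _ => le_rfl) _
  have hsurvive : 2048 * (X x * Y x) ≤ haltSum ch st (fun _ _ => 0)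
      (fun y => K * ((r₀ ^ p * S y) ^ (1 / p) * (s₀ ^ q * W y) ^ (1 / q))) (n + 1) x := by
    have h := mul_le_haltSum hpq hp2 hS hW hSm hX hY hX0 hY0 h1 h2 (n + 1) x hXx hYx
    have e1 : X x = r₀ * S x := by rw [hr₀, div_mul_cancel₀ _ (hS x).ne']
    have e2 : Y x = s₀ * W x := by rw [hs₀, div_mul_cancel₀ _ (hW x).ne']
    have e3 : (fun y => K * ((r₀ ^ p * S y) ^ (1 / p) * (s₀ ^ q * W y) ^ (1 / q))) =
        fun y => (K * (r₀ * s₀)) * (S y ^ (1 / p) * W y ^ (1 / q)) := by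
      ext y
      rw [Real.mul_rpow (by positivity) (hS y).le, Real.mul_rpow (by positivity) (hW y).le,
        ← Real.rpow_mul hr₀0, ← Real.rpow_mul hs₀0, mul_one_div_cancel hpq.ne_zero,
        mul_one_div_cancel hpq.symm.ne_zero, Real.rpow_one, Real.rpow_one]
      ring
    have e4 : haltSum ch st (fun _ _ => 0)
        (fun y => (K * (r₀ * s₀)) * (S y ^ (1 / p) * W y ^ (1 / q))) (n + 1) x =
        (K * (r₀ * s₀)) * haltSum ch st (fun _ _ => 0)
          (fun y => S y ^ (1 / p) * W y ^ (1 / q)) (n + 1) x := by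
      rw [haltSum_const_mul]; simp
    rw [e3, e4]
    calc 2048 * (X x * Y x) = 2048 * (r₀ * s₀) * (S x * W x) := by
          conv_lhs => rw [e1, e2]
          ring
      _ ≤ 2048 * (r₀ * s₀) * _ := mul_le_mul_of_nonneg_left h (by positivity)
      _ = _ := by rw [hK]; ring
  have hsplit : haltSum ch st (fun k y => K * (U k y ^ (1 / p) * V k y ^ (1 / q))) (fun _ => 0)
      (n + 1) x + haltSum ch st (fun _ _ => 0)
      (fun y => K * ((r₀ ^ p * S y) ^ (1 / p) * (s₀ ^ q * W y) ^ (1 / q))) (n + 1) x =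
      K * haltSum ch st (fun k y => U k y ^ (1 / p) * V k y ^ (1 / q))
        (fun y => (r₀ ^ p * S y) ^ (1 / p) * (s₀ ^ q * W y) ^ (1 / q)) (n + 1) x := by
    rw [haltSum_const_mul, haltSum_add]
    simp
  have hholder := haltSum_rpow_mul_rpow_le (ch := ch) hpq (halt := st) hU0 hV0
    (fun y => mul_nonneg (Real.rpow_nonneg hr₀0 p) (hS y).le)
    (fun y => mul_nonneg (Real.rpow_nonneg hs₀0 q) (hW y).le) (n + 1) x
  have hmomentU := haltSum_maxMoment_le (ch := ch) hpq.nonneg (fun y => (hS y).le) hr st hr₀0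
    (n + 1) x le_rfl
  have hmomentV := haltSum_maxMoment_le (ch := ch) hpq.symm.nonneg (fun y => (hW y).le) hs st hs₀0
    (n + 1) x le_rfl
  rw [max_self] at hmomentU hmomentV
  calc treeSum ch (coeffProd ch F G) (n + 1) x ≤ K * (_ ^ (1 / p) * _ ^ (1 / q)) := by
        refine le_trans ?_ (mul_le_mul_of_nonneg_left hholder hK0)
        linarith
    _ ≤ _ := by
        have ha := haltSum_nonneg (ch := ch) (halt := st) hU0
          (fun y => mul_nonneg (Real.rpow_nonneg hr₀0 p) (hS y).le) (n + 1) x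
        have hb := haltSum_nonneg (ch := ch) (halt := st) hV0
          (fun y => mul_nonneg (Real.rpow_nonneg hs₀0 q) (hW y).le) (n + 1) x
        have := one_div_nonneg.2 hpq.nonneg
        have := one_div_nonneg.2 hpq.symm.nonneg
        have := hU0 (n + 1) x
        gcongr

theorem treeSum_le_of_two_le {p q A : ℝ} (hpq : p.HolderConjugate q) (hp2 : 2 ≤ p)
    {F G : N → ℂ} {S W X Y P Q : N → ℝ} (hF : IsMean ch F) (hG : IsMean ch G)
    (hS : ∀ y, 0 < S y) (hW : ∀ y, 0 < W y) (hSm : IsMean ch S) (hWm : IsMean ch W)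
    (hX : IsMean ch X) (hY : IsMean ch Y) (hP : IsMean ch P) (hQ : IsMean ch Q)
    (hP0 : ∀ y, 0 ≤ P y) (hQ0 : ∀ y, 0 ≤ Q y)
    (hFX : ∀ y, ‖F y‖ ≤ X y) (hGY : ∀ y, ‖G y‖ ≤ Y y)
    (hXP : ∀ y, X y ≤ P y ^ (1 / p) * S y ^ (1 / q))
    (hYQ : ∀ y, Y y ≤ Q y ^ (1 / q) * W y ^ (1 / p))
    (h1 : ∀ y, 1 ≤ W y * S y ^ (p - 1)) (h2 : ∀ y, W y * S y ^ (p - 1) ≤ A) (n : ℕ) (x : N) :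
    treeSum ch (coeffProd ch F G) n x ≤
      2048 * 4 ^ (p - 1) * (2 * q) * (2 * p) * A * (P x ^ (1 / p) * Q x ^ (1 / q)) := by
  have hX0 : ∀ y, 0 ≤ X y := fun y => (norm_nonneg _).trans (hFX y)
  have hY0 : ∀ y, 0 ≤ Y y := fun y => (norm_nonneg _).trans (hGY y)
  have hA : 0 ≤ A := zero_le_one.trans ((h1 x).trans (h2 x))
  have main := treeSum_le_maxMoment hpq hp2 hF hG hS hW hSm hX hY hFX hGY h1 h2 n x
  -- With the maximum initialised at `X / S` the bracket equals `(1 - b) * S * (X / S) ^ a`, and `b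
  -- > 1`.
  have tail : ∀ {a b : ℝ} (_ : a.HolderConjugate b) {S X : ℝ}, 0 < S → 0 ≤ X →
      2 * (S * (X / S) ^ a - b * (X / S) ^ (a - 1) * X) ≤ 0 := by
    intro a b hab S X hS hX
    rcases hX.eq_or_lt with h | h
    · simp [← h, Real.zero_rpow hab.ne_zero]
    · have hr : 0 < X / S := div_pos h hS
      have e : (X / S) ^ (a - 1) * X = S * (X / S) ^ a := by
        rw [Real.rpow_sub_one hr.ne']
        field_simp
      rw [mul_assoc b, e]
      have : 0 ≤ S * (X / S) ^ a := by positivity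
      nlinarith [hab.symm.lt]
  have hU := maxMoment_le hpq hS hX0 hP0 hSm hX hP hXP n x le_rfl
  have hV := maxMoment_le hpq.symm hW hY0 hQ0 hWm hY hQ hYQ n x le_rfl
  have hU' := hU.trans (add_le_of_nonpos_left (tail hpq (hS x) (hX0 x)))
  have hV' := hV.trans (add_le_of_nonpos_left (tail hpq.symm (hW x) (hY0 x)))
  have hp := hpq.pos
  have hq := hpq.symm.pos
  have hr : 0 ≤ X x / S x := div_nonneg (hX0 x) (hS x).le
  have hs : 0 ≤ Y x / W x := div_nonneg (hY0 x) (hW x).le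
  have cU := Real.rpow_le_rpow (maxMoment_nonneg (fun y => (hS y).le) _ _ hr) hU'
    (one_div_nonneg.2 hp.le)
  have cV := Real.rpow_le_rpow (maxMoment_nonneg (fun y => (hW y).le) _ _ hs) hV'
    (one_div_nonneg.2 hq.le)
  rw [Real.mul_rpow (by positivity) (hP0 x), ← Real.rpow_mul (by positivity),
    mul_one_div_cancel hp.ne', Real.rpow_one] at cU
  rw [Real.mul_rpow (by positivity) (hQ0 x), ← Real.rpow_mul (by positivity),
    mul_one_div_cancel hq.ne', Real.rpow_one] at cV
  have hPx := Real.rpow_nonneg (hP0 x) (1 / p)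
  have hQx := Real.rpow_nonneg (hQ0 x) (1 / q)
  calc _ ≤ 2048 * 4 ^ (p - 1) * A * ((2 * q * P x ^ (1 / p)) * (2 * p * Q x ^ (1 / q))) := by
        refine main.trans ?_
        gcongr
        exact Real.rpow_nonneg (maxMoment_nonneg (fun y => (hW y).le) _ _ hs) _
    _ = _ := by ring

/-- The bound for the sum of products of differences, for every exponent. -/
theorem exists_treeSum_le {p q : ℝ} (hpq : p.HolderConjugate q) : ∃ C : ℝ, 0 < C ∧
    ∀ {N : Type} {ch : Fin 4 → N → N} {A : ℝ}
    {F G : N → ℂ} {S W X Y P Q : N → ℝ} (_ : IsMean ch F) (_ : IsMean ch G)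
    (_ : ∀ y, 0 < S y) (_ : ∀ y, 0 < W y) (_ : IsMean ch S) (_ : IsMean ch W)
    (_ : IsMean ch X) (_ : IsMean ch Y) (_ : IsMean ch P) (_ : IsMean ch Q)
    (_ : ∀ y, 0 ≤ P y) (_ : ∀ y, 0 ≤ Q y)
    (_ : ∀ y, ‖F y‖ ≤ X y) (_ : ∀ y, ‖G y‖ ≤ Y y)
    (_ : ∀ y, X y ≤ P y ^ (1 / p) * S y ^ (1 / q))
    (_ : ∀ y, Y y ≤ Q y ^ (1 / q) * W y ^ (1 / p))
    (_ : ∀ y, 1 ≤ W y * S y ^ (p - 1)) (_ : ∀ y, W y * S y ^ (p - 1) ≤ A) (n : ℕ) (x : N),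
    treeSum ch (coeffProd ch F G) n x ≤
      C * A ^ (max p q / p) * (P x ^ (1 / p) * Q x ^ (1 / q)) := by
  have hp := hpq.pos
  have hq := hpq.symm.pos
  rcases le_total 2 p with h | h
  · refine ⟨2048 * 4 ^ (p - 1) * (2 * q) * (2 * p), by positivity, ?_⟩
    intro N ch A F G S W X Y P Q hF hG hS hW hSm hWm hX hY hP hQ hP0 hQ0 hFX hGY hXP hYQ h1 h2 n x
    have hqp : q ≤ p := by
      have := hpq.sub_one_mul_conj
      nlinarith
    rw [max_eq_left hqp, div_self hp.ne', Real.rpow_one]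
    exact treeSum_le_of_two_le hpq h hF hG hS hW hSm hWm hX hY hP hQ hP0 hQ0 hFX hGY hXP hYQ h1 h2 n x
  · refine ⟨2048 * 4 ^ (q - 1) * (2 * p) * (2 * q), by positivity, ?_⟩
    intro N ch A F G S W X Y P Q hF hG hS hW hSm hWm hX hY hP hQ hP0 hQ0 hFX hGY hXP hYQ h1 h2 n x
    have hmul := hpq.sub_one_mul_conj
    have hp1 := hpq.sub_one_pos
    have hq2 : 2 ≤ q := by
      have := hpq.lt
      nlinarith
    have e : q / p = q - 1 := by
      rw [div_eq_iff hpq.ne_zero, hpq.symm.sub_one_mul_conj]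
    have e' : (p - 1) * (q - 1) = 1 := by nlinarith [hpq.mul_eq_add]
    rw [max_eq_right (h.trans hq2), e]
    -- The condition on the pair `(W, S)` with exponent `p` is that on `(S, W)` with exponent `q`,
    -- raised to the power `q - 1 = q / p`.
    have conv : ∀ y, S y * W y ^ (q - 1) = (W y * S y ^ (p - 1)) ^ (q - 1) := fun y => by
      rw [Real.mul_rpow (hW y).le (Real.rpow_nonneg (hS y).le _), ← Real.rpow_mul (hS y).le, e',
        Real.rpow_one, mul_comm]
    have hq1 := hpq.symm.sub_one_pos.le
    rw [coeffProd_comm, mul_comm (P x ^ (1 / p))]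
    refine treeSum_le_of_two_le hpq.symm hq2 hG hF hW hS hWm hSm hY hX hQ hP hQ0 hP0 hGY hFX hYQ hXP
      (fun y => ?_) (fun y => ?_) n x
    · rw [conv]; exact Real.one_le_rpow (h1 y) hq1
    · rw [conv]
      exact Real.rpow_le_rpow (zero_le_one.trans (h1 y)) (h2 y) hq1

end FourTree

/-! ### Complex multiplications and Lebesgue measure -/

theorem map_complex_mul_left_volume {v : ℂ} (hv : v ≠ 0) :
    Measure.map (fun s : ℂ => v * s) volume = ENNReal.ofReal (‖v‖ ^ 2)⁻¹ • volume := by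
  have hdet : LinearMap.det (LinearMap.mul ℝ ℂ v) = ‖v‖ ^ 2 := by
    have := Algebra.norm_apply ℝ v
    rw [Algebra.norm_complex_apply, Complex.normSq_eq_norm_sq] at this
    exact this.symm
  have h0 : LinearMap.det (LinearMap.mul ℝ ℂ v) ≠ 0 := by
    rw [hdet]; exact pow_ne_zero 2 (norm_ne_zero_iff.2 hv)
  have h := Measure.map_linearMap_addHaar_eq_smul_addHaar (volume : Measure ℂ) h0
  rw [hdet, abs_of_nonneg (by positivity)] at h
  exact h

theorem measurableEmbedding_complex_mul_left {v : ℂ} (hv : v ≠ 0) :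
    MeasurableEmbedding fun s : ℂ => v * s :=
  (Homeomorph.mulLeft₀ v hv).measurableEmbedding

theorem integral_complex_mul_left {E : Type*} [NormedAddCommGroup E] [NormedSpace ℝ E]
    {v : ℂ} (hv : v ≠ 0) (φ : ℂ → E) : ∫ s, φ (v * s) = (‖v‖ ^ 2)⁻¹ • ∫ u, φ u := by
  rw [← (measurableEmbedding_complex_mul_left hv).integral_map, map_complex_mul_left_volume hv,
    integral_smul_measure, ENNReal.toReal_ofReal (by positivity)]

theorem lintegral_complex_mul_left {v : ℂ} (hv : v ≠ 0) (φ : ℂ → ℝ≥0∞) :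
    ∫⁻ s, φ (v * s) = ENNReal.ofReal (‖v‖ ^ 2)⁻¹ * ∫⁻ u, φ u := by
  rw [← (measurableEmbedding_complex_mul_left hv).lintegral_map, map_complex_mul_left_volume hv,
    lintegral_smul_measure, smul_eq_mul]

theorem integrable_complex_mul_left {E : Type*} [NormedAddCommGroup E]
    {v : ℂ} (hv : v ≠ 0) {φ : ℂ → E} :
    Integrable (fun s => φ (v * s)) ↔ Integrable φ := by
  have h := (measurableEmbedding_complex_mul_left hv).integrable_map_iff (μ := volume) (g := φ)
  rw [map_complex_mul_left_volume hv, integrable_smul_measure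
    (ENNReal.ofReal_pos.2 (by have := norm_pos_iff.2 hv; positivity)).ne' ENNReal.ofReal_ne_top] at h
  exact h.symm

theorem measurePreserving_I_mul : MeasurePreserving (fun u : ℂ => Complex.I * u) := by
  refine ⟨measurable_const_mul _, ?_⟩
  rw [map_complex_mul_left_volume Complex.I_ne_zero]
  simp

/-! ### The principal value as an absolutely convergent integral -/

/-- The kernel of the Beurling transform applied to a function, antisymmetrised under the quarter
turn `u ↦ i u`. -/
noncomputable def quarterTurnKernel (f : ℂ → ℂ) (z u : ℂ) : ℂ :=
  (f (z + u) - f (z + Complex.I * u)) / u ^ 2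

theorem exists_norm_sub_le_mul (f : 𝓢(ℂ, ℂ)) : ∃ L : ℝ, 0 ≤ L ∧ ∀ x y, ‖f x - f y‖ ≤ L * ‖x - y‖ := by
  obtain ⟨C, hC, h⟩ := f.decay 0 1
  refine ⟨C, hC.le, fun x y => ?_⟩
  have := Convex.norm_image_sub_le_of_norm_fderiv_le (𝕜 := ℝ) (f := f) (s := Set.univ) (C := C)
    (x := y) (y := x) (fun z _ => f.differentiableAt) (fun z _ => ?_) convex_univ trivial trivial
  · exact this
  · have := h z
    rw [pow_zero, one_mul, ← norm_iteratedFDeriv_fderiv, norm_iteratedFDeriv_zero] at this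
    exact this

/-- Near the origin the difference in the numerator is Lipschitz, which leaves a singularity `1 /
‖u‖`, integrable in the plane. For `‖u‖ ≥ 1` the denominator can be dropped. -/
theorem exists_norm_quarterTurnKernel_le (f : 𝓢(ℂ, ℂ)) : ∃ L : ℝ, ∀ z u : ℂ,
    ‖quarterTurnKernel f z u‖ ≤ (Metric.ball (0 : ℂ) 1).indicator (fun u => L * ‖u‖ ^ (-1 : ℝ)) u +
      (‖f (z + u)‖ + ‖f (z + Complex.I * u)‖) := by
  obtain ⟨L, hL0, hL⟩ := exists_norm_sub_le_mul f
  refine ⟨2 * L, fun z u => ?_⟩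
  rw [quarterTurnKernel, norm_div, norm_pow]
  by_cases hu : u ∈ Metric.ball (0 : ℂ) 1
  · rw [Set.indicator_of_mem hu, Real.rpow_neg_one]
    refine le_add_of_le_of_nonneg ?_ (by positivity)
    rcases eq_or_ne u 0 with rfl | h0
    · simp
    · have hu0 := norm_pos_iff.2 h0
      have h1 : ‖f (z + u) - f (z + Complex.I * u)‖ ≤ 2 * L * ‖u‖ := by
        refine (hL _ _).trans ?_
        have : ‖z + u - (z + Complex.I * u)‖ ≤ 2 * ‖u‖ := by
          calc _ = ‖u - Complex.I * u‖ := by ring_nf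
            _ ≤ ‖u‖ + ‖Complex.I * u‖ := norm_sub_le _ _
            _ = _ := by rw [norm_mul, Complex.norm_I]; ring
        calc _ ≤ L * (2 * ‖u‖) := by gcongr
          _ = _ := by ring
      calc _ ≤ 2 * L * ‖u‖ / ‖u‖ ^ 2 := by gcongr
        _ = _ := by field_simp
  · rw [Set.indicator_of_notMem hu, zero_add]
    have hu1 : 1 ≤ ‖u‖ := by simpa using hu
    calc _ ≤ ‖f (z + u) - f (z + Complex.I * u)‖ := div_le_self (norm_nonneg _) (one_le_pow₀ hu1)
      _ ≤ _ := norm_sub_le _ _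

theorem integrable_indicator_ball_inv (L : ℝ) :
    Integrable ((Metric.ball (0 : ℂ) 1).indicator (fun u : ℂ => L * ‖u‖ ^ (-1 : ℝ))) := by
  rw [integrable_indicator_iff measurableSet_ball]
  refine integrableOn_ball_of_norm_le_rpow (C := |L|) (α := 1) ?_ ?_ ?_ ?_
  · simp [Complex.finrank_real_complex]
  · simp [Complex.finrank_real_complex]
  · refine Eventually.of_forall fun u => ?_
    rw [norm_mul, Real.norm_eq_abs, Real.norm_of_nonneg (by positivity)]
  · exact (Measurable.aestronglyMeasurable (by fun_prop))

theorem integrable_comp_add_I_mul {f : ℂ → ℂ} (hf : Integrable f) (z : ℂ) :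
    Integrable fun u => f (z + Complex.I * u) :=
  (integrable_complex_mul_left Complex.I_ne_zero (φ := fun u => f (z + u))).2 (hf.comp_add_left z)

theorem measurable_quarterTurnKernel (f : 𝓢(ℂ, ℂ)) :
    Measurable fun x : ℂ × ℂ => quarterTurnKernel f x.1 x.2 := by
  have := f.continuous.measurable
  unfold quarterTurnKernel
  fun_prop

theorem exists_integral_norm_quarterTurnKernel_le (f : 𝓢(ℂ, ℂ)) : ∃ C : ℝ, ∀ z : ℂ,
    Integrable (quarterTurnKernel f z) ∧ ∫ u, ‖quarterTurnKernel f z u‖ ≤ C := by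
  obtain ⟨L, hL⟩ := exists_norm_quarterTurnKernel_le f
  refine ⟨(∫ u, (Metric.ball (0 : ℂ) 1).indicator (fun u : ℂ => L * ‖u‖ ^ (-1 : ℝ)) u) +
    ((∫ u, ‖f u‖) + ∫ u, ‖f u‖), fun z => ?_⟩
  have i1 := integrable_indicator_ball_inv L
  have i2 : Integrable fun u => ‖f (z + u)‖ := (f.integrable.comp_add_left z).norm
  have i3 : Integrable fun u => ‖f (z + Complex.I * u)‖ :=
    (integrable_comp_add_I_mul f.integrable z).norm
  have hint : Integrable (quarterTurnKernel f z) :=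
    (i1.add (i2.add i3)).mono'
      ((measurable_quarterTurnKernel f).comp measurable_prodMk_left).aestronglyMeasurable
      (Eventually.of_forall fun u => hL z u)
  refine ⟨hint, (integral_mono hint.norm (i1.add (i2.add i3)) (hL z)).trans ?_⟩
  rw [integral_add' i1 (i2.add i3), integral_add' i2 i3, integral_add_left_eq_self (fun u => ‖f u‖) z,
    integral_complex_mul_left Complex.I_ne_zero (fun u => ‖f (z + u)‖),
    integral_add_left_eq_self (fun u => ‖f u‖) z]
  simp

theorem integrable_quarterTurnKernel (f : 𝓢(ℂ, ℂ)) (z : ℂ) :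
    Integrable (quarterTurnKernel f z) :=
  let ⟨_, hC⟩ := exists_integral_norm_quarterTurnKernel_le f
  (hC z).1

theorem measurableSet_lt_norm (δ : ℝ) : MeasurableSet {u : ℂ | δ < ‖u‖} :=
  measurableSet_lt measurable_const measurable_norm

theorem integrableOn_div_sq {f : ℂ → ℂ} (hf : Integrable f) {δ : ℝ} (hδ : 0 < δ) :
    IntegrableOn (fun u => f u / u ^ 2) {u : ℂ | δ < ‖u‖} := by
  refine Integrable.mono' (g := fun u => ‖f u‖ * (δ ^ 2)⁻¹) (hf.norm.mul_const _).integrableOn ?_ ?_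
  · exact (hf.aestronglyMeasurable.div₀ (by fun_prop)).restrict
  · refine (ae_restrict_iff' (measurableSet_lt_norm δ)).2 (Eventually.of_forall fun u hu => ?_)
    have : δ < ‖u‖ := hu
    rw [norm_div, norm_pow, div_eq_mul_inv]
    gcongr

theorem truncatedBeurling_eq_setIntegral_add (f : ℂ → ℂ) (z : ℂ) (δ : ℝ) :
    truncatedBeurling f z δ =
      -(1 / (Real.pi : ℂ)) * ∫ u in {u : ℂ | δ < ‖u‖}, f (z + u) / u ^ 2 := by
  rw [truncatedBeurling]
  congr 1
  rw [← integral_indicator (measurableSet_lt_norm δ), ← integral_indicator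
    (measurableSet_lt (f := fun _ : ℂ => δ) (g := fun ζ : ℂ => ‖ζ - z‖) measurable_const
      (measurable_id.sub_const z).norm),
    ← integral_add_left_eq_self _ z]
  congr 1
  ext u
  simp only [Set.indicator, Set.mem_ofPred_eq, add_sub_cancel_left]

/-- The truncation region is invariant under `u ↦ i u` while `u⁻²` changes sign. The integral is
therefore half of its antisymmetrisation, whose integrand remains integrable without truncation. -/
theorem truncatedBeurling_eq (f : 𝓢(ℂ, ℂ)) (z : ℂ) {δ : ℝ} (hδ : 0 < δ) :
    truncatedBeurling f z δ =
      -(1 / (2 * Real.pi : ℂ)) * ∫ u in {u : ℂ | δ < ‖u‖}, quarterTurnKernel f z u := by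
  have i1 := integrableOn_div_sq (f.integrable.comp_add_left z) hδ
  have i2 := integrableOn_div_sq (integrable_comp_add_I_mul f.integrable z) hδ
  have e : ∫ u in {u : ℂ | δ < ‖u‖}, f (z + Complex.I * u) / u ^ 2 =
      -∫ u in {u : ℂ | δ < ‖u‖}, f (z + u) / u ^ 2 := by
    have h := measurePreserving_I_mul.integral_comp
      (measurableEmbedding_complex_mul_left Complex.I_ne_zero)
      ({u : ℂ | δ < ‖u‖}.indicator fun u => f (z + u) / u ^ 2)
    rw [← integral_indicator (measurableSet_lt_norm δ), ← integral_indicator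
      (measurableSet_lt_norm δ), ← h, ← integral_neg]
    congr 1
    ext u
    simp only [Set.indicator, Set.mem_ofPred_eq, norm_mul, Complex.norm_I, one_mul, mul_pow,
      Complex.I_sq]
    split_ifs
    · rw [neg_one_mul, div_neg, neg_neg]
    · simp
  rw [truncatedBeurling_eq_setIntegral_add]
  simp only [quarterTurnKernel, sub_div]
  rw [integral_sub i1 i2, e]
  have : (Real.pi : ℂ) ≠ 0 := by exact_mod_cast Real.pi_ne_zero
  field_simp
  ring

theorem tendsto_truncatedBeurling_integral (f : 𝓢(ℂ, ℂ)) (z : ℂ) :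
    Tendsto (truncatedBeurling f z) (𝓝[>] 0)
      (𝓝 (-(1 / (2 * Real.pi : ℂ)) * ∫ u, quarterTurnKernel f z u)) := by
  have h : Tendsto (fun δ : ℝ => -(1 / (2 * Real.pi : ℂ)) *
      ∫ u, {u : ℂ | δ < ‖u‖}.indicator (quarterTurnKernel f z) u) (𝓝[>] 0)
      (𝓝 (-(1 / (2 * Real.pi : ℂ)) * ∫ u, quarterTurnKernel f z u)) := by
    refine Tendsto.const_mul _ ?_
    refine tendsto_integral_filter_of_dominated_convergence (fun u => ‖quarterTurnKernel f z u‖)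
      (Eventually.of_forall fun δ =>
        ((integrable_quarterTurnKernel f z).indicator (measurableSet_lt_norm δ)).aestronglyMeasurable)
      (Eventually.of_forall fun δ => Eventually.of_forall fun u => norm_indicator_le_norm_self _ _)
      (integrable_quarterTurnKernel f z).norm ?_
    refine Eventually.of_forall fun u => ?_
    rcases eq_or_ne u 0 with rfl | hu
    -- Division by zero gives the value zero at the origin, which is never in the truncation region.
    · have : quarterTurnKernel f z 0 = 0 := by simp [quarterTurnKernel]
      simp [Set.indicator, this]
    · refine tendsto_const_nhds.congr' ?_
      filter_upwards [Ioo_mem_nhdsGT (norm_pos_iff.2 hu)] with δ hδ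
      rw [Set.indicator_of_mem]
      exact hδ.2
  refine h.congr' ?_
  filter_upwards [self_mem_nhdsWithin] with δ hδ
  rw [truncatedBeurling_eq f z hδ, integral_indicator (measurableSet_lt_norm δ)]

theorem beurling_eq (f : 𝓢(ℂ, ℂ)) (z : ℂ) :
    beurling f z = -(1 / (2 * Real.pi : ℂ)) * ∫ u, quarterTurnKernel f z u :=
  (tendsto_truncatedBeurling_integral f z).limUnder_eq

theorem tendsto_truncatedBeurling (f : 𝓢(ℂ, ℂ)) (z : ℂ) :
    Tendsto (truncatedBeurling f z) (𝓝[>] 0) (𝓝 (beurling f z)) := by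
  rw [beurling_eq]
  exact tendsto_truncatedBeurling_integral f z

theorem tendsto_truncatedBeurling_atTop (f : 𝓢(ℂ, ℂ)) (z : ℂ) :
    Tendsto (truncatedBeurling f z) atTop (𝓝 0) := by
  have h : Tendsto (fun δ : ℝ => -(1 / (2 * Real.pi : ℂ)) *
      ∫ u, {u : ℂ | δ < ‖u‖}.indicator (quarterTurnKernel f z) u) atTop
      (𝓝 (-(1 / (2 * Real.pi : ℂ)) * ∫ _ : ℂ, (0 : ℂ))) := by
    refine Tendsto.const_mul _ ?_
    refine tendsto_integral_filter_of_dominated_convergence (fun u => ‖quarterTurnKernel f z u‖)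
      (Eventually.of_forall fun δ =>
        ((integrable_quarterTurnKernel f z).indicator (measurableSet_lt_norm δ)).aestronglyMeasurable)
      (Eventually.of_forall fun δ => Eventually.of_forall fun u => norm_indicator_le_norm_self _ _)
      (integrable_quarterTurnKernel f z).norm ?_
    refine Eventually.of_forall fun u => ?_
    refine tendsto_const_nhds.congr' ?_
    filter_upwards [eventually_ge_atTop ‖u‖] with δ hδ
    rw [Set.indicator_of_notMem]
    exact not_lt.2 hδ
  simp only [integral_zero, mul_zero] at h
  refine h.congr' ?_
  filter_upwards [eventually_gt_atTop 0] with δ hδ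
  rw [truncatedBeurling_eq f z hδ, integral_indicator (measurableSet_lt_norm δ)]

theorem exists_norm_truncatedBeurling_le (f : 𝓢(ℂ, ℂ)) :
    ∃ C : ℝ, 0 ≤ C ∧ ∀ (z : ℂ) (δ : ℝ), 0 < δ → ‖truncatedBeurling f z δ‖ ≤ C := by
  obtain ⟨C, hC⟩ := exists_integral_norm_quarterTurnKernel_le f
  have hC0 : 0 ≤ C := (integral_nonneg fun _ => norm_nonneg _).trans (hC 0).2
  refine ⟨‖-(1 / (2 * Real.pi : ℂ))‖ * C, by positivity, fun z δ hδ => ?_⟩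
  rw [truncatedBeurling_eq f z hδ, norm_mul]
  gcongr
  calc _ ≤ ∫ u in {u : ℂ | δ < ‖u‖}, ‖quarterTurnKernel f z u‖ := norm_integral_le_integral_norm _
    _ ≤ ∫ u, ‖quarterTurnKernel f z u‖ :=
      setIntegral_le_integral (hC z).1.norm (Eventually.of_forall fun _ => norm_nonneg _)
    _ ≤ C := (hC z).2

theorem exists_norm_beurling_le (f : 𝓢(ℂ, ℂ)) : ∃ C : ℝ, 0 ≤ C ∧ ∀ z : ℂ, ‖beurling f z‖ ≤ C := by
  obtain ⟨C, hC0, hC⟩ := exists_norm_truncatedBeurling_le f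
  refine ⟨C, hC0, fun z => le_of_tendsto (tendsto_truncatedBeurling f z).norm ?_⟩
  filter_upwards [self_mem_nhdsWithin] with δ hδ using hC z δ hδ

theorem measurable_beurling (f : 𝓢(ℂ, ℂ)) : Measurable (beurling f) := by
  have h : beurling f = fun z => -(1 / (2 * Real.pi : ℂ)) * ∫ u, quarterTurnKernel f z u :=
    funext fun z => beurling_eq f z
  rw [h]
  have h1 : StronglyMeasurable fun z => ∫ u, quarterTurnKernel f z u :=
    (measurable_quarterTurnKernel f).stronglyMeasurable.integral_prod_right'
  exact h1.measurable.const_mul _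

theorem beurling_add (f g : 𝓢(ℂ, ℂ)) (z : ℂ) :
    beurling (f + g) z = beurling f z + beurling g z := by
  rw [beurling_eq, beurling_eq, beurling_eq, ← mul_add,
    ← integral_add (integrable_quarterTurnKernel f z) (integrable_quarterTurnKernel g z)]
  congr 1
  refine integral_congr_ae (Eventually.of_forall fun u => ?_)
  simp only [quarterTurnKernel, add_apply]
  ring

theorem beurling_smul (c : ℂ) (f : 𝓢(ℂ, ℂ)) (z : ℂ) :
    beurling (c • f) z = c * beurling f z := by
  have h : quarterTurnKernel (⇑(c • f)) z = fun u => c * quarterTurnKernel f z u := by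
    ext1 u
    simp only [quarterTurnKernel, smul_apply, smul_eq_mul]
    ring
  rw [beurling_eq, beurling_eq, h, integral_const_mul, mul_left_comm]

/-! ### Squares, their quadrants and Haar coefficients -/

/-- The half-open square with centre `0` and side length `2`. -/
def baseSquare : Set ℂ := {s | (-1 ≤ s.re ∧ s.re < 1) ∧ (-1 ≤ s.im ∧ s.im < 1)}

/-- The mean of `φ` over the square `a + v * baseSquare`. -/
noncomputable def squareMean {E : Type*} [NormedAddCommGroup E] [NormedSpace ℝ E] (φ : ℂ → E)
    (a v : ℂ) : E :=
  (4 : ℝ)⁻¹ • ∫ s in baseSquare, φ (a + v * s)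

/-- The centres of the four quadrants of `baseSquare`. -/
noncomputable def quadrantCentre : Fin 4 → ℂ :=
  ![⟨1 / 2, 1 / 2⟩, ⟨-1 / 2, 1 / 2⟩, ⟨1 / 2, -1 / 2⟩, ⟨-1 / 2, -1 / 2⟩]

/-- The four half-open quadrants of `baseSquare`. -/
def quadrant (i : Fin 4) : Set ℂ := {u | 2 * (u - quadrantCentre i) ∈ baseSquare}

theorem measurableSet_baseSquare : MeasurableSet baseSquare := by
  have h1 := Complex.measurable_re
  have h2 := Complex.measurable_im
  exact ((measurableSet_le measurable_const h1).inter (measurableSet_lt h1 measurable_const)).inter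
    ((measurableSet_le measurable_const h2).inter (measurableSet_lt h2 measurable_const))

theorem measurableSet_quadrant (i : Fin 4) : MeasurableSet (quadrant i) :=
  measurableSet_baseSquare.preimage (by fun_prop : Measurable fun u : ℂ => 2 * (u - quadrantCentre i))

theorem norm_le_two_of_mem_baseSquare {s : ℂ} (hs : s ∈ baseSquare) : ‖s‖ ≤ 2 := by
  obtain ⟨⟨h1, h2⟩, h3, h4⟩ := hs
  have h5 : |s.re| ≤ 1 := abs_le.2 ⟨h1, h2.le⟩
  have h6 : |s.im| ≤ 1 := abs_le.2 ⟨h3, h4.le⟩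
  linarith [Complex.norm_le_abs_re_add_abs_im s]

theorem mem_quadrant {i : Fin 4} {x y : ℝ} (h : quadrantCentre i = ⟨x, y⟩) {u : ℂ} :
    u ∈ quadrant i ↔ (x - 1 / 2 ≤ u.re ∧ u.re < x + 1 / 2) ∧
      (y - 1 / 2 ≤ u.im ∧ u.im < y + 1 / 2) := by
  simp only [quadrant, baseSquare, h, Set.mem_ofPred_eq, Complex.mul_re, Complex.mul_im,
    Complex.sub_re, Complex.sub_im, Complex.re_ofNat, Complex.im_ofNat, zero_mul, sub_zero, add_zero]
  constructor <;> rintro ⟨⟨h1, h2⟩, h3, h4⟩ <;> refine ⟨⟨?_, ?_⟩, ?_, ?_⟩ <;> linarith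

theorem mem_quadrant_zero {u : ℂ} :
    u ∈ quadrant 0 ↔ (0 ≤ u.re ∧ u.re < 1) ∧ (0 ≤ u.im ∧ u.im < 1) := by
  rw [mem_quadrant (x := (1 / 2)) (y := (1 / 2)) rfl]
  norm_num

theorem mem_quadrant_one {u : ℂ} :
    u ∈ quadrant 1 ↔ (-1 ≤ u.re ∧ u.re < 0) ∧ (0 ≤ u.im ∧ u.im < 1) := by
  rw [mem_quadrant (x := (-1 / 2)) (y := (1 / 2)) rfl]
  norm_num

theorem mem_quadrant_two {u : ℂ} :
    u ∈ quadrant 2 ↔ (0 ≤ u.re ∧ u.re < 1) ∧ (-1 ≤ u.im ∧ u.im < 0) := by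
  rw [mem_quadrant (x := (1 / 2)) (y := (-1 / 2)) rfl]
  norm_num

theorem mem_quadrant_three {u : ℂ} :
    u ∈ quadrant 3 ↔ (-1 ≤ u.re ∧ u.re < 0) ∧ (-1 ≤ u.im ∧ u.im < 0) := by
  rw [mem_quadrant (x := (-1 / 2)) (y := (-1 / 2)) rfl]
  norm_num

theorem indicator_baseSquare {E : Type*} [AddCommGroup E] (F : ℂ → E) (u : ℂ) :
    baseSquare.indicator F u = ∑ i, (quadrant i).indicator F u := by
  simp only [Fin.sum_univ_four, Set.indicator, mem_quadrant_zero, mem_quadrant_one,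
    mem_quadrant_two, mem_quadrant_three]
  simp only [baseSquare, Set.mem_ofPred_eq]
  rcases lt_or_ge u.re 0 with h1 | h1 <;> rcases lt_or_ge u.im 0 with h2 | h2 <;>
    by_cases h3 : -1 ≤ u.re <;> by_cases h4 : -1 ≤ u.im <;> by_cases h5 : u.re < 1 <;>
    by_cases h6 : u.im < 1 <;>
    first
      | (exfalso; linarith)
      | simp [h1, h2, h3, h4, h5, h6, not_le.2, not_lt.2]

theorem quadrant_subset (i : Fin 4) : quadrant i ⊆ baseSquare := by
  intro u hu
  by_contra hn
  -- Counting: outside the base square the four quadrant indicators would sum to zero, although one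
  -- of them is one.
  have h := indicator_baseSquare (fun _ => (1 : ℤ)) u
  have h2 := Finset.single_le_sum (f := fun i => (quadrant i).indicator (fun _ => (1 : ℤ)) u)
    (fun j _ => Set.indicator_nonneg (fun _ _ => zero_le_one) _) (Finset.mem_univ i)
  rw [← h, Set.indicator_of_mem hu, Set.indicator_of_notMem hn] at h2
  omega

theorem volume_baseSquare : volume baseSquare = 4 := by
  have h := Complex.volume_preserving_equiv_real_prod.symm.measure_preimage
    measurableSet_baseSquare.nullMeasurableSet
  have e : Complex.measurableEquivRealProd.symm ⁻¹' baseSquare =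
      Set.Ico (-1 : ℝ) 1 ×ˢ Set.Ico (-1 : ℝ) 1 := by
    ext ⟨x, y⟩
    simp [baseSquare, Complex.measurableEquivRealProd]
  rw [e] at h
  rw [← h, Measure.volume_eq_prod, Measure.prod_prod, Real.volume_Ico, ← ENNReal.ofReal_mul (by norm_num)]
  norm_num

theorem integrableOn_baseSquare_comp {E : Type*} [NormedAddCommGroup E]
    {φ : ℂ → E} (hφ : LocallyIntegrable φ) (a : ℂ) {v : ℂ}
    (hv : v ≠ 0) : IntegrableOn (fun s => φ (a + v * s)) baseSquare := by
  have h1 : IntegrableOn φ (Metric.closedBall a (‖v‖ * 2)) :=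
    hφ.integrableOn_isCompact (isCompact_closedBall _ _)
  rw [← integrable_indicator_iff measurableSet_closedBall] at h1
  have h2 := (integrable_complex_mul_left hv).2 (h1.comp_add_left a)
  refine IntegrableOn.congr_fun h2.integrableOn (fun s hs => ?_) measurableSet_baseSquare
  rw [Set.indicator_of_mem]
  rw [Metric.mem_closedBall, dist_eq_norm, add_sub_cancel_left, norm_mul]
  gcongr
  exact norm_le_two_of_mem_baseSquare hs

section Mean

variable {E : Type*} [NormedAddCommGroup E] [NormedSpace ℝ E]

theorem squareMean_quadrant (φ : ℂ → E) (a v : ℂ) (i : Fin 4) :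
    squareMean φ (a + v * quadrantCentre i) (v / 2) = ∫ s in quadrant i, φ (a + v * s) := by
  have h := integral_complex_mul_left (two_ne_zero) (baseSquare.indicator fun s =>
    φ (a + v * quadrantCentre i + v / 2 * s))
  have h4 : (‖(2 : ℂ)‖ ^ 2)⁻¹ = (4 : ℝ)⁻¹ := by norm_num
  rw [h4] at h
  rw [squareMean, ← integral_indicator measurableSet_baseSquare,
    ← integral_indicator (measurableSet_quadrant i), ← h, ← integral_sub_right_eq_self
      (fun u => baseSquare.indicator (fun s => φ (a + v * quadrantCentre i + v / 2 * s)) (2 * u))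
      (quadrantCentre i)]
  congr 1
  ext s
  have e : a + v * quadrantCentre i + v / 2 * (2 * (s - quadrantCentre i)) = a + v * s := by ring
  by_cases hs : s ∈ quadrant i
  · rw [Set.indicator_of_mem hs, Set.indicator_of_mem (show 2 * (s - quadrantCentre i) ∈ baseSquare from hs),
      e]
  · rw [Set.indicator_of_notMem hs,
      Set.indicator_of_notMem (show 2 * (s - quadrantCentre i) ∉ baseSquare from hs)]

theorem squareMean_eq {φ : ℂ → E} (hφ : LocallyIntegrable φ) (a : ℂ) {v : ℂ} (hv : v ≠ 0) :
    squareMean φ a v =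
      (4 : ℝ)⁻¹ • ∑ i, squareMean φ (a + v * quadrantCentre i) (v / 2) := by
  simp only [squareMean_quadrant]
  rw [squareMean, ← integral_indicator measurableSet_baseSquare]
  have hi := integrableOn_baseSquare_comp hφ a hv
  simp only [indicator_baseSquare]
  rw [integral_finsetSum]
  · simp only [integral_indicator (measurableSet_quadrant _)]
  · intro i _
    exact (integrable_indicator_iff (measurableSet_quadrant i)).2 (hi.mono_set (quadrant_subset i))

end Mean

/-- The difference of the indicators of the two upper quadrants of `baseSquare`. -/
noncomputable def haarFunction (s : ℂ) : ℝ :=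
  (quadrant 0).indicator 1 s - (quadrant 1).indicator 1 s

theorem measurable_haarFunction : Measurable haarFunction :=
  (measurable_one.indicator (measurableSet_quadrant 0)).sub
    (measurable_one.indicator (measurableSet_quadrant 1))

theorem abs_haarFunction_le (s : ℂ) : |haarFunction s| ≤ baseSquare.indicator 1 s := by
  rw [haarFunction]
  by_cases h0 : s ∈ quadrant 0 <;> by_cases h1 : s ∈ quadrant 1
  · simp [h0, h1, Set.indicator_nonneg]
  · simp [h0, h1, quadrant_subset 0 h0]
  · simp [h0, h1, quadrant_subset 1 h1]
  · simp [h0, h1, Set.indicator_nonneg]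

theorem integrable_indicator_baseSquare : Integrable (baseSquare.indicator (1 : ℂ → ℝ)) := by
  rw [integrable_indicator_iff measurableSet_baseSquare]
  exact integrableOn_const (by rw [volume_baseSquare]; norm_num)

theorem integrable_haarFunction : Integrable haarFunction :=
  integrable_indicator_baseSquare.mono' measurable_haarFunction.aestronglyMeasurable
    (Eventually.of_forall abs_haarFunction_le)

/-- The pairing of `φ` on the square `a + v * baseSquare` with the Haar function. -/
noncomputable def haarCoeff (φ : ℂ → ℂ) (a v : ℂ) : ℂ :=
  ∫ s, (haarFunction s : ℂ) * φ (a + v * s)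

theorem haarCoeff_eq {φ : ℂ → ℂ} (hφ : LocallyIntegrable φ) (a : ℂ) {v : ℂ} (hv : v ≠ 0) :
    haarCoeff φ a v = squareMean φ (a + v * quadrantCentre 0) (v / 2) -
      squareMean φ (a + v * quadrantCentre 1) (v / 2) := by
  have hi := integrableOn_baseSquare_comp hφ a hv
  rw [squareMean_quadrant, squareMean_quadrant, ← integral_indicator (measurableSet_quadrant _),
    ← integral_indicator (measurableSet_quadrant _), ← integral_sub
    ((integrable_indicator_iff (measurableSet_quadrant _)).2 (hi.mono_set (quadrant_subset 0)))
    ((integrable_indicator_iff (measurableSet_quadrant _)).2 (hi.mono_set (quadrant_subset 1))), haarCoeff]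
  congr 1
  ext s
  simp only [haarFunction, Set.indicator, Pi.one_apply]
  split_ifs <;> simp

/-! ### The averaging constant does not vanish -/

/-- The square of the direction of a complex number. -/
noncomputable def sqDirection (d : ℂ) : ℂ := d ^ 2 / (‖d‖ : ℂ) ^ 2

theorem norm_sqDirection_le (d : ℂ) : ‖sqDirection d‖ ≤ 1 := by
  rw [sqDirection, norm_div, norm_pow, norm_pow, Complex.norm_real, norm_norm]
  exact div_self_le_one _

theorem measurable_sqDirection : Measurable sqDirection := by
  unfold sqDirection
  fun_prop

theorem sqDirection_neg (d : ℂ) : sqDirection (-d) = sqDirection d := by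
  simp [sqDirection]

theorem sqDirection_I_mul (d : ℂ) : sqDirection (Complex.I * d) = -sqDirection d := by
  simp [sqDirection, mul_pow, neg_div]

theorem sqDirection_conj (d : ℂ) :
    sqDirection ((starRingEnd ℂ) d) = (starRingEnd ℂ) (sqDirection d) := by
  simp [sqDirection]

theorem sqDirection_re (d : ℂ) :
    (sqDirection d).re = (d.re ^ 2 - d.im ^ 2) / (d.re ^ 2 + d.im ^ 2) := by
  have h : (‖d‖ : ℂ) ^ 2 = ((d.re ^ 2 + d.im ^ 2 : ℝ) : ℂ) := by
    rw [← Complex.ofReal_pow, Complex.sq_norm, Complex.normSq_apply]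
    congr 1
    ring
  rw [sqDirection, h, Complex.div_ofReal_re]
  congr 1
  rw [sq, Complex.mul_re]
  ring

/-- The mean squared direction between two points chosen with the weight of the Haar function. -/
noncomputable def haarConstant : ℂ :=
  ∫ x : ℂ × ℂ, (haarFunction x.1 * haarFunction x.2 : ℝ) * sqDirection (x.1 - x.2)

/-- The open unit square. -/
def openUnitSquare : Set ℂ := {s | (0 < s.re ∧ s.re < 1) ∧ (0 < s.im ∧ s.im < 1)}

theorem measurableSet_openUnitSquare : MeasurableSet openUnitSquare := by
  have h1 := Complex.measurable_re
  have h2 := Complex.measurable_im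
  exact ((measurableSet_lt measurable_const h1).inter (measurableSet_lt h1 measurable_const)).inter
    ((measurableSet_lt measurable_const h2).inter (measurableSet_lt h2 measurable_const))

theorem volume_re_eq_zero : volume {s : ℂ | s.re = 0} = 0 := by
  have h := Measure.addHaar_submodule (volume : Measure ℂ) (LinearMap.ker Complex.reLm) (fun h => by
    have : (1 : ℂ) ∈ LinearMap.ker Complex.reLm := h ▸ Submodule.mem_top
    simp at this)
  exact h

theorem volume_im_eq_zero : volume {s : ℂ | s.im = 0} = 0 := by
  have h := Measure.addHaar_submodule (volume : Measure ℂ) (LinearMap.ker Complex.imLm) (fun h => by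
    have : Complex.I ∈ LinearMap.ker Complex.imLm := h ▸ Submodule.mem_top
    simp at this)
  exact h

theorem openUnitSquare_ae_eq : openUnitSquare =ᵐ[volume] quadrant 0 := by
  have h1 : ∀ᵐ s : ℂ, s.re ≠ 0 := measure_eq_zero_iff_ae_notMem.1 volume_re_eq_zero
  have h2 : ∀ᵐ s : ℂ, s.im ≠ 0 := measure_eq_zero_iff_ae_notMem.1 volume_im_eq_zero
  filter_upwards [h1, h2] with s h1 h2
  refine propext (Iff.trans ?_ mem_quadrant_zero.symm)
  exact ⟨fun h => ⟨⟨h.1.1.le, h.1.2⟩, h.2.1.le, h.2.2⟩,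
    fun h => ⟨⟨h.1.1.lt_of_ne' h1, h.1.2⟩, h.2.1.lt_of_ne' h2, h.2.2⟩⟩

theorem haarFunction_ae_eq : haarFunction =ᵐ[volume]
    fun s => openUnitSquare.indicator 1 s - openUnitSquare.indicator 1 (s + 1) := by
  have h := openUnitSquare_ae_eq
  have h' := (measurePreserving_add_right (volume : Measure ℂ) 1).quasiMeasurePreserving.ae_eq_comp
    (indicator_ae_eq_of_ae_eq_set h (f := (1 : ℂ → ℝ)))
  have h0 := indicator_ae_eq_of_ae_eq_set h (f := (1 : ℂ → ℝ))
  filter_upwards [h0, h'] with s h0 h'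
  rw [haarFunction, h0]
  simp only [Function.comp] at h'
  rw [h']
  congr 1
  have : s ∈ quadrant 1 ↔ s + 1 ∈ quadrant 0 := by
    rw [mem_quadrant_one, mem_quadrant_zero]
    simp only [Complex.add_re, Complex.add_im, Complex.one_re, Complex.one_im, add_zero]
    constructor <;> rintro ⟨⟨h1, h2⟩, h3⟩ <;> exact ⟨⟨by linarith, by linarith⟩, h3⟩
  by_cases hs : s + 1 ∈ quadrant 0
  · rw [Set.indicator_of_mem hs, Set.indicator_of_mem (this.2 hs), Pi.one_apply, Pi.one_apply]
  · rw [Set.indicator_of_notMem hs, Set.indicator_of_notMem (mt this.1 hs)]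

theorem measurePreserving_I_mul_conj :
    MeasurePreserving (fun s : ℂ => Complex.I * (starRingEnd ℂ) s) :=
  measurePreserving_I_mul.comp (Complex.conjLIE.measurePreserving)

theorem measurePreserving_one_sub_conj :
    MeasurePreserving (fun s : ℂ => 1 - (starRingEnd ℂ) s) :=
  (Measure.measurePreserving_sub_left volume (1 : ℂ)).comp (Complex.conjLIE.measurePreserving)

theorem volume_openUnitSquare_ne_top : volume openUnitSquare ≠ ∞ := by
  rw [measure_congr openUnitSquare_ae_eq]
  refine ne_top_of_le_ne_top ?_ (measure_mono (quadrant_subset 0))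
  rw [volume_baseSquare]
  norm_num

theorem volume_openUnitSquare_ne_zero : volume openUnitSquare ≠ 0 := by
  have ho : IsOpen openUnitSquare :=
    ((isOpen_lt continuous_const Complex.continuous_re).inter
      (isOpen_lt Complex.continuous_re continuous_const)).inter
      ((isOpen_lt continuous_const Complex.continuous_im).inter
      (isOpen_lt Complex.continuous_im continuous_const))
  refine (ho.measure_pos volume ⟨⟨1 / 2, 1 / 2⟩, ?_⟩).ne'
  simp only [openUnitSquare, Set.mem_ofPred_eq]
  norm_num

instance : IsFiniteMeasure (volume.restrict openUnitSquare) :=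
  ⟨by rw [Measure.restrict_apply_univ]; exact volume_openUnitSquare_ne_top.lt_top⟩

theorem integrable_sqDirection_comp {u : ℂ × ℂ → ℂ} (hu : Measurable u) :
    Integrable (fun x => sqDirection (u x))
      ((volume.restrict openUnitSquare).prod (volume.restrict openUnitSquare)) :=
  Integrable.of_bound (measurable_sqDirection.comp hu).aestronglyMeasurable 1
    (Eventually.of_forall fun _ => norm_sqDirection_le _)

theorem integrable_indicator_mul_sqDirection (a b : ℂ) {u : ℂ × ℂ → ℂ} (hu : Measurable u) :
    Integrable fun x : ℂ × ℂ => (openUnitSquare.indicator (1 : ℂ → ℂ) (x.1 + a) *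
      openUnitSquare.indicator 1 (x.2 + b)) * sqDirection (u x) := by
  have h1 : Integrable (openUnitSquare.indicator (1 : ℂ → ℂ)) := by
    rw [integrable_indicator_iff measurableSet_openUnitSquare]
    exact integrableOn_const volume_openUnitSquare_ne_top
  exact ((h1.comp_add_right a).mul_prod (h1.comp_add_right b)).mul_bdd
    (c := 1) (measurable_sqDirection.comp hu).aestronglyMeasurable
    (Eventually.of_forall fun _ => norm_sqDirection_le _)

theorem integral_indicator_mul_sqDirection (a b : ℂ) :
    ∫ x : ℂ × ℂ, (openUnitSquare.indicator (1 : ℂ → ℂ) (x.1 + a) *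
      openUnitSquare.indicator 1 (x.2 + b)) * sqDirection (x.1 - x.2) =
    ∫ x, sqDirection (x.1 - x.2 + (b - a))
      ∂((volume.restrict openUnitSquare).prod (volume.restrict openUnitSquare)) := by
  have h := integral_add_left_eq_self (μ := (volume : Measure ℂ).prod volume)
    ((openUnitSquare ×ˢ openUnitSquare).indicator fun x => sqDirection (x.1 - x.2 + (b - a))) (a, b)
  rw [Measure.prod_restrict, ← integral_indicator
    (measurableSet_openUnitSquare.prod measurableSet_openUnitSquare), Measure.volume_eq_prod, ← h]
  congr 1
  ext x
  have e : a + x.1 - (b + x.2) + (b - a) = x.1 - x.2 := by ring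
  simp only [add_comm x.1, add_comm x.2]
  by_cases h1 : a + x.1 ∈ openUnitSquare <;> by_cases h2 : b + x.2 ∈ openUnitSquare <;>
    simp [Set.indicator, h1, h2, e]

theorem measurePreserving_restrict_openUnitSquare {σ : ℂ → ℂ} (h : MeasurePreserving σ)
    (hσ : σ ⁻¹' openUnitSquare = openUnitSquare) :
    MeasurePreserving σ (volume.restrict openUnitSquare) (volume.restrict openUnitSquare) := by
  have := h.restrict_preimage measurableSet_openUnitSquare
  rwa [hσ] at this

/-- Expanding the Haar function as a difference of two adjacent unit squares leaves pairs in the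
same square minus pairs in adjacent squares. The first contribute nothing to the real part, by
reflection in the diagonal. For the second, horizontal directions prevail on average over vertical
ones, so the difference is negative. -/
theorem haarConstant_re_neg : haarConstant.re < 0 := by
  set ν : Measure ℂ := volume.restrict openUnitSquare with hν
  set D : ℂ → ℂ := openUnitSquare.indicator 1 with hD
  -- symmetries of the open unit square
  have hτ : MeasurePreserving (fun s : ℂ => Complex.I * (starRingEnd ℂ) s) ν ν := by
    refine measurePreserving_restrict_openUnitSquare measurePreserving_I_mul_conj ?_
    ext s
    simp [openUnitSquare, and_comm]
  have hρ : MeasurePreserving (fun s : ℂ => 1 - (starRingEnd ℂ) s) ν ν := by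
    refine measurePreserving_restrict_openUnitSquare measurePreserving_one_sub_conj ?_
    ext s
    simp [openUnitSquare, and_comm]
  have hsplit : haarConstant =
      2 * (∫ x, sqDirection (x.1 - x.2) ∂(ν.prod ν)) -
        2 * ∫ x, sqDirection (x.1 - x.2 + 1) ∂(ν.prod ν) := by
    have hae : (fun x : ℂ × ℂ => (haarFunction x.1 * haarFunction x.2 : ℝ) *
        sqDirection (x.1 - x.2)) =ᵐ[volume] fun x =>
        (D (x.1 + 0) * D (x.2 + 0)) * sqDirection (x.1 - x.2) -
        (D (x.1 + 0) * D (x.2 + 1)) * sqDirection (x.1 - x.2) -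
        ((D (x.1 + 1) * D (x.2 + 0)) * sqDirection (x.1 - x.2) -
        (D (x.1 + 1) * D (x.2 + 1)) * sqDirection (x.1 - x.2)) := by
      have h1 := (Measure.quasiMeasurePreserving_fst (μ := (volume : Measure ℂ))
        (ν := (volume : Measure ℂ))).ae_eq_comp haarFunction_ae_eq
      have h2 := (Measure.quasiMeasurePreserving_snd (μ := (volume : Measure ℂ))
        (ν := (volume : Measure ℂ))).ae_eq_comp haarFunction_ae_eq
      have hDc : ∀ s, ((openUnitSquare.indicator (1 : ℂ → ℝ) s : ℝ) : ℂ) = D s := fun s => by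
        by_cases hs : s ∈ openUnitSquare <;> simp [hD, hs]
      filter_upwards [h1, h2] with x h1 h2
      simp only [Function.comp] at h1 h2
      rw [h1, h2]
      push_cast
      simp only [hDc, add_zero]
      ring
    have m : Measurable fun x : ℂ × ℂ => x.1 - x.2 := by fun_prop
    have i := fun a b => integrable_indicator_mul_sqDirection a b m
    rw [haarConstant, integral_congr_ae hae, integral_sub, integral_sub (i 0 0) (i 0 1),
      integral_sub (i 1 0) (i 1 1)]
    rotate_left
    · exact (i 0 0).sub (i 0 1)
    · exact (i 1 0).sub (i 1 1)
    simp only [integral_indicator_mul_sqDirection]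
    -- Exchanging the two points reverses the shift, and the squared direction is even.
    have hswap : ∫ x, sqDirection (x.1 - x.2 + (0 - 1)) ∂(ν.prod ν) =
        ∫ x, sqDirection (x.1 - x.2 + 1) ∂(ν.prod ν) := by
      rw [← integral_prod_swap]
      congr 1
      ext1 x
      rw [← sqDirection_neg]
      congr 1
      simp only [Prod.fst_swap, Prod.snd_swap]
      ring
    rw [hswap]
    simp only [sub_self, add_zero, sub_zero]
    ring
  have hint : ∀ {u : ℂ × ℂ → ℂ}, Measurable u → Integrable (fun x => (sqDirection (u x)).re)
      (ν.prod ν) := fun hu => (integrable_sqDirection_comp hu).re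
  have hre : ∀ {u : ℂ × ℂ → ℂ}, Measurable u → (∫ x, sqDirection (u x) ∂(ν.prod ν)).re =
      ∫ x, (sqDirection (u x)).re ∂(ν.prod ν) := fun hu =>
    (integral_re (integrable_sqDirection_comp hu)).symm
  have m1 : Measurable fun x : ℂ × ℂ => x.1 - x.2 := by fun_prop
  have m2 : Measurable fun x : ℂ × ℂ => x.1 - x.2 + 1 := by fun_prop
  have m3 : Measurable fun x : ℂ × ℂ => x.1 + (starRingEnd ℂ) x.2 := by
    have := Complex.continuous_conj.measurable
    fun_prop
  have m4 : Measurable fun x : ℂ × ℂ => (starRingEnd ℂ) x.1 - x.2 := by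
    have := Complex.continuous_conj.measurable
    fun_prop
  have hττ := hτ.prod hτ
  -- The map `s ↦ i * conj s` reflects the unit square in its diagonal and changes the sign of the
  -- real part of the squared direction.
  have same : ∫ x, (sqDirection (x.1 - x.2)).re ∂(ν.prod ν) = 0 := by
    have h : ∫ x, (sqDirection (x.1 - x.2)).re ∂(ν.prod ν) =
        ∫ x, -(sqDirection (x.1 - x.2)).re ∂(ν.prod ν) := by
      conv_lhs => rw [← hττ.map_eq]
      rw [integral_map hττ.measurable.aemeasurable
        (by rw [hττ.map_eq]; exact (hint m1).aestronglyMeasurable)]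
      congr 1
      ext1 x
      simp only [Prod.map_fst, Prod.map_snd]
      rw [← mul_sub, ← map_sub, sqDirection_I_mul, sqDirection_conj, Complex.neg_re, Complex.conj_re]
    rw [integral_neg] at h
    linarith
  have adj1 : ∫ x, (sqDirection (x.1 - x.2 + 1)).re ∂(ν.prod ν) =
      ∫ x, (sqDirection (x.1 + (starRingEnd ℂ) x.2)).re ∂(ν.prod ν) := by
    have hid := (MeasurePreserving.id ν).prod hρ
    conv_lhs => rw [← hid.map_eq]
    rw [integral_map hid.measurable.aemeasurable
      (by rw [hid.map_eq]; exact (hint m2).aestronglyMeasurable)]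
    congr 1
    ext1 x
    simp only [Prod.map_fst, Prod.map_snd, id]
    congr 2
    ring
  have adj2 : ∫ x, (sqDirection (x.1 + (starRingEnd ℂ) x.2)).re ∂(ν.prod ν) =
      ∫ x, -(sqDirection ((starRingEnd ℂ) x.1 - x.2)).re ∂(ν.prod ν) := by
    conv_lhs => rw [← hττ.map_eq]
    rw [integral_map hττ.measurable.aemeasurable
      (by rw [hττ.map_eq]; exact (hint m3).aestronglyMeasurable)]
    congr 1
    ext1 x
    simp only [Prod.map_fst, Prod.map_snd, map_mul, Complex.conj_I, Complex.conj_conj]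
    rw [neg_mul, ← sub_eq_add_neg, ← mul_sub, sqDirection_I_mul, Complex.neg_re]
  -- The integral over adjacent squares is written in two ways, by `adj1` and `adj2`; neither
  -- integrand has a sign, but their sum is pointwise positive. After clearing denominators this is
  -- `((a + c) * (b + d)) ^ 2 > ((a - c) * (b - d)) ^ 2` for positive coordinates.
  have hpos : 0 < ∫ x, ((sqDirection (x.1 + (starRingEnd ℂ) x.2)).re +
      -(sqDirection ((starRingEnd ℂ) x.1 - x.2)).re) ∂(ν.prod ν) := by
    have hpt : ∀ x ∈ openUnitSquare ×ˢ openUnitSquare,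
        0 < (sqDirection (x.1 + (starRingEnd ℂ) x.2)).re +
          -(sqDirection ((starRingEnd ℂ) x.1 - x.2)).re := by
      rintro ⟨⟨a, b⟩, ⟨c, d⟩⟩ ⟨⟨⟨ha, _⟩, hb, _⟩, ⟨hc, _⟩, hd, _⟩
      simp only [sqDirection_re, Complex.add_re, Complex.add_im, Complex.sub_re, Complex.sub_im,
        Complex.conj_re, Complex.conj_im] at *
      have h1 : 0 < (a + c) ^ 2 + (b + -d) ^ 2 := by positivity
      have h2 : 0 < (a - c) ^ 2 + (-b - d) ^ 2 := by
        have : 0 < (b + d) ^ 2 := by positivity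
        nlinarith [sq_nonneg (a - c)]
      rw [← sub_eq_add_neg, div_sub_div _ _ h1.ne' h2.ne']
      refine div_pos ?_ (mul_pos h1 h2)
      have : ((a + c) ^ 2 - (b + -d) ^ 2) * ((a - c) ^ 2 + (-b - d) ^ 2) -
          ((a + c) ^ 2 + (b + -d) ^ 2) * ((a - c) ^ 2 - (-b - d) ^ 2) =
          2 * (((a + c) * (b + d)) ^ 2 - ((a - c) * (b - d)) ^ 2) := by ring
      rw [this]
      have e : ((a + c) * (b + d)) ^ 2 - ((a - c) * (b - d)) ^ 2 =
        4 * (a * b + c * d) * (a * d + c * b) := by ring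
      rw [e]
      positivity
    have hae : ∀ᵐ x ∂(ν.prod ν), x ∈ openUnitSquare ×ˢ openUnitSquare := by
      rw [hν, Measure.prod_restrict]
      exact ae_restrict_mem (measurableSet_openUnitSquare.prod measurableSet_openUnitSquare)
    have hne : ν.prod ν ≠ 0 := by
      rw [hν, Measure.prod_restrict, Ne, Measure.restrict_eq_zero, Measure.prod_prod, mul_eq_zero,
        or_self]
      exact volume_openUnitSquare_ne_zero
    rw [integral_pos_iff_support_of_nonneg_ae (hae.mono fun x hx => (hpt x hx).le)
      ((hint m3).add (hint m4).neg)]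
    rw [pos_iff_ne_zero]
    intro h0
    have h1 : ∀ᵐ x ∂(ν.prod ν), False := by
      filter_upwards [hae, measure_eq_zero_iff_ae_notMem.1 h0] with x hx hx'
      exact hx' (hpt x hx).ne'
    exact hne (ae_eq_bot.1 (eventually_false_iff_eq_bot.1 h1))
  rw [integral_add (hint m3) (by exact (hint m4).neg), ← adj2, ← adj1] at hpos
  have two_mul_re : ∀ z : ℂ, (2 * z).re = 2 * z.re := fun z => by simp
  rw [hsplit, Complex.sub_re, two_mul_re, two_mul_re, hre m1, hre m2, same]
  linarith

theorem haarConstant_ne_zero : haarConstant ≠ 0 := fun h => by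
  have := haarConstant_re_neg
  rw [h] at this
  exact lt_irrefl _ this

/-! ### Averaging Haar forms over all squares -/

/-- The annulus `ε < ‖v‖ ≤ R`. -/
def annulus (ε R : ℝ) : Set ℂ := {v | ε < ‖v‖ ∧ ‖v‖ ≤ R}

theorem measurableSet_annulus (ε R : ℝ) : MeasurableSet (annulus ε R) :=
  (measurableSet_lt measurable_const measurable_norm).inter
    (measurableSet_le measurable_norm measurable_const)

theorem volume_annulus_lt_top (ε R : ℝ) : volume (annulus ε R) < ∞ := by
  refine (measure_mono fun v hv => ?_).trans_lt
    (measure_closedBall_lt_top (x := (0 : ℂ)) (r := R))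
  simpa using hv.2

/-- A quarter turn preserves the annulus and changes the sign of `v⁻²`. This settles the degenerate
case of coinciding points in the next lemma. -/
theorem setIntegral_annulus_inv_sq (ε R : ℝ) : ∫ v in annulus ε R, (v ^ 2)⁻¹ = 0 := by
  have h := measurePreserving_I_mul.integral_comp
    (measurableEmbedding_complex_mul_left Complex.I_ne_zero)
    ((annulus ε R).indicator fun v => (v ^ 2)⁻¹)
  have e : ∀ v : ℂ, (annulus ε R).indicator (fun v => (v ^ 2)⁻¹) (Complex.I * v) =
      -(annulus ε R).indicator (fun v => (v ^ 2)⁻¹) v := by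
    intro v
    by_cases hv : v ∈ annulus ε R
    · have hv' : Complex.I * v ∈ annulus ε R := by simpa [annulus] using hv
      rw [Set.indicator_of_mem hv, Set.indicator_of_mem hv', mul_pow, Complex.I_sq, neg_one_mul,
        inv_neg]
    · have hv' : Complex.I * v ∉ annulus ε R := by simpa [annulus] using hv
      rw [Set.indicator_of_notMem hv, Set.indicator_of_notMem hv', neg_zero]
  simp only [e, integral_neg] at h
  rw [integral_indicator (measurableSet_annulus ε R)] at h
  exact self_eq_neg.1 h.symm

/-- Substituting `u = d * v` turns `v⁻² dv` into `u⁻² du` times `d ^ 2 / ‖d‖ ^ 2`, and an annulus is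
a difference of two truncation regions. For `d = 0` both sides vanish, since `sqDirection 0 = 0`. -/
theorem setIntegral_annulus_inv_sq_mul (f : 𝓢(ℂ, ℂ)) (a d : ℂ) {ε R : ℝ} (hε : 0 < ε)
    (hR : ε ≤ R) :
    ∫ v in annulus ε R, (v ^ 2)⁻¹ * f (a + v * d) = -(Real.pi : ℂ) * (sqDirection d *
      (truncatedBeurling f a (ε * ‖d‖) - truncatedBeurling f a (R * ‖d‖))) := by
  rcases eq_or_ne d 0 with rfl | hd
  · simp [sqDirection, integral_mul_const, setIntegral_annulus_inv_sq]
  have hd0 := norm_pos_iff.2 hd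
  have hRpos := hε.trans_le hR
  have hπ : (Real.pi : ℂ) ≠ 0 := by exact_mod_cast Real.pi_ne_zero
  have hset : annulus (ε * ‖d‖) (R * ‖d‖) = {u : ℂ | ε * ‖d‖ < ‖u‖} \ {u : ℂ | R * ‖d‖ < ‖u‖} := by
    ext u; simp [annulus]
  have hdiff : ∫ u in annulus (ε * ‖d‖) (R * ‖d‖), f (a + u) / u ^ 2 =
      (∫ u in {u : ℂ | ε * ‖d‖ < ‖u‖}, f (a + u) / u ^ 2) -
        ∫ u in {u : ℂ | R * ‖d‖ < ‖u‖}, f (a + u) / u ^ 2 := by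
    rw [hset, setIntegral_sdiff (measurableSet_lt_norm _)
      (integrableOn_div_sq (f.integrable.comp_add_left a) (mul_pos hε hd0))]
    intro u hu
    exact (mul_le_mul_of_nonneg_right hR hd0.le).trans_lt hu
  have hsub := integral_complex_mul_left hd ((annulus (ε * ‖d‖) (R * ‖d‖)).indicator
    fun u => d ^ 2 * (f (a + u) / u ^ 2))
  have e : ∀ v, (annulus (ε * ‖d‖) (R * ‖d‖)).indicator
      (fun u => d ^ 2 * (f (a + u) / u ^ 2)) (d * v) =
      (annulus ε R).indicator (fun v => (v ^ 2)⁻¹ * f (a + v * d)) v := by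
    intro v
    have hiff : d * v ∈ annulus (ε * ‖d‖) (R * ‖d‖) ↔ v ∈ annulus ε R := by
      simp only [annulus, Set.mem_ofPred_eq, norm_mul, mul_comm ‖d‖]
      rw [mul_lt_mul_iff_left₀ hd0, mul_le_mul_iff_left₀ hd0]
    by_cases hv : v ∈ annulus ε R
    · rw [Set.indicator_of_mem hv, Set.indicator_of_mem (hiff.2 hv), mul_comm d v, mul_pow]
      have hv0 : v ≠ 0 := norm_pos_iff.1 (hε.trans hv.1)
      field_simp
    · rw [Set.indicator_of_notMem hv, Set.indicator_of_notMem (mt hiff.1 hv)]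
  simp only [e] at hsub
  rw [integral_indicator (measurableSet_annulus _ _), integral_indicator (measurableSet_annulus _ _),
    integral_const_mul, hdiff] at hsub
  rw [hsub, truncatedBeurling_eq_setIntegral_add, truncatedBeurling_eq_setIntegral_add,
    Complex.real_smul, sqDirection]
  push_cast
  field_simp
  ring

/-- A bounded measurable function with bounded support. -/
structure IsTestFunction (g : ℂ → ℂ) : Prop where
  measurable : Measurable g
  exists_bound : ∃ C : ℝ, 0 ≤ C ∧ ∀ z, ‖g z‖ ≤ C
  exists_radius : ∃ ρ : ℝ, ∀ z, ρ < ‖z‖ → g z = 0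

theorem IsTestFunction.integrable {g : ℂ → ℂ} (hg : IsTestFunction g) : Integrable g := by
  obtain ⟨C, hC0, hC⟩ := hg.exists_bound
  obtain ⟨ρ, hρ⟩ := hg.exists_radius
  have h1 : Integrable ((Metric.closedBall (0 : ℂ) ρ).indicator fun _ => C) := by
    rw [integrable_indicator_iff measurableSet_closedBall]
    exact integrableOn_const measure_closedBall_lt_top.ne
  refine h1.mono' hg.measurable.aestronglyMeasurable (Eventually.of_forall fun z => ?_)
  by_cases hz : z ∈ Metric.closedBall (0 : ℂ) ρ
  · rw [Set.indicator_of_mem hz]; exact hC z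
  · rw [Set.indicator_of_notMem hz, hρ z (by simpa using hz), norm_zero]

theorem exists_norm_schwartz_le (f : 𝓢(ℂ, ℂ)) : ∃ C : ℝ, 0 ≤ C ∧ ∀ z, ‖f z‖ ≤ C := by
  obtain ⟨C, hC0, hC⟩ := f.decay 0 0
  exact ⟨C, hC0.le, fun z => by simpa using hC z⟩

theorem haarFunction_eq_zero {s : ℂ} (hs : 2 < ‖s‖) : haarFunction s = 0 := by
  have h := abs_haarFunction_le s
  rw [Set.indicator_of_notMem fun h => hs.not_ge (norm_le_two_of_mem_baseSquare h)] at h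
  exact abs_nonpos_iff.1 h

theorem integrable_haarFunction_mul : Integrable fun x : ℂ × ℂ =>
    (haarFunction x.1 : ℂ) * (haarFunction x.2 : ℂ) :=
  integrable_haarFunction.ofReal.mul_prod integrable_haarFunction.ofReal

theorem integrable_haar_product (f : 𝓢(ℂ, ℂ)) {g : ℂ → ℂ} (hg : IsTestFunction g) (v : ℂ) :
    Integrable fun y : ℂ × (ℂ × ℂ) => ((haarFunction y.2.1 : ℂ) * f (y.1 + v * y.2.1)) *
      ((haarFunction y.2.2 : ℂ) * g (y.1 + v * y.2.2)) := by
  obtain ⟨Cf, hCf0, hCf⟩ := exists_norm_schwartz_le f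
  obtain ⟨Cg, hCg0, hCg⟩ := hg.exists_bound
  obtain ⟨ρ, hρ⟩ := hg.exists_radius
  -- The Haar function vanishes beyond radius two, so `g (a + v * t)` contributes only for `‖a‖ ≤ ρ
  -- + 2 * ‖v‖`.
  have h1 : Integrable ((Metric.closedBall (0 : ℂ) (ρ + 2 * ‖v‖)).indicator
      fun _ => ((Cf * Cg : ℝ) : ℂ)) := by
    rw [integrable_indicator_iff measurableSet_closedBall]
    exact integrableOn_const measure_closedBall_lt_top.ne
  have hm := hg.measurable
  have hh := measurable_haarFunction
  have hf := f.continuous.measurable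
  refine (h1.mul_prod integrable_haarFunction_mul).mono (by fun_prop)
    (Eventually.of_forall fun y => ?_)
  by_cases hs : 2 < ‖y.2.2‖
  · simp [haarFunction_eq_zero hs]
  by_cases hy : y.1 ∈ Metric.closedBall (0 : ℂ) (ρ + 2 * ‖v‖)
  · rw [Set.indicator_of_mem hy]
    simp only [norm_mul, Complex.norm_real, Real.norm_of_nonneg hCf0, Real.norm_of_nonneg hCg0]
    calc _ ≤ ‖haarFunction y.2.1‖ * Cf * (‖haarFunction y.2.2‖ * Cg) := by
          gcongr
          · exact hCf _
          · exact hCg _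
      _ = _ := by ring
  · have hz : g (y.1 + v * y.2.2) = 0 := by
      apply hρ
      have h2 : ρ + 2 * ‖v‖ < ‖y.1‖ := by simpa using hy
      have h3 : ‖y.1‖ ≤ ‖y.1 + v * y.2.2‖ + ‖v‖ * ‖y.2.2‖ := by
        rw [← norm_mul]
        calc ‖y.1‖ = ‖(y.1 + v * y.2.2) - v * y.2.2‖ := by ring_nf
          _ ≤ _ := norm_sub_le _ _
      push Not at hs
      nlinarith [norm_nonneg v]
    rw [hz, mul_zero, mul_zero, norm_zero]
    exact norm_nonneg _

/-- The product of the weights of the Haar function with the values of two functions. -/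
noncomputable def haarIntegrand (f g : ℂ → ℂ) (v : ℂ) (x : (ℂ × ℂ) × ℂ) : ℂ :=
  ((haarFunction x.1.1 : ℂ) * (haarFunction x.1.2 : ℂ)) *
    (g x.2 * f (x.2 + v * (x.1.1 - x.1.2)))

theorem measurable_haarIntegrand (f : 𝓢(ℂ, ℂ)) {g : ℂ → ℂ} (hg : IsTestFunction g) :
    Measurable fun y : ℂ × ((ℂ × ℂ) × ℂ) => haarIntegrand f g y.1 y.2 := by
  have hm := hg.measurable
  have hh := measurable_haarFunction
  have hf := f.continuous.measurable
  unfold haarIntegrand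
  fun_prop

theorem integrable_haarIntegrand (f : 𝓢(ℂ, ℂ)) {g : ℂ → ℂ} (hg : IsTestFunction g) (v : ℂ) :
    Integrable (haarIntegrand f g v) := by
  obtain ⟨Cf, hCf0, hCf⟩ := exists_norm_schwartz_le f
  refine ((integrable_haarFunction_mul.mul_prod hg.integrable).norm.mul_const Cf).mono'
    ((measurable_haarIntegrand f hg).comp measurable_prodMk_left).aestronglyMeasurable
    (Eventually.of_forall fun x => ?_)
  rw [haarIntegrand, ← mul_assoc, norm_mul]
  gcongr
  exact hCf _

theorem integrable_haarCoeff_mul (f : 𝓢(ℂ, ℂ)) {g : ℂ → ℂ} (hg : IsTestFunction g) (v : ℂ) :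
    Integrable fun a => haarCoeff f a v * haarCoeff g a v := by
  have h := (integrable_haar_product f hg v).integral_prod_left
  refine h.congr (Eventually.of_forall fun a => ?_)
  exact integral_prod_mul (fun s => (haarFunction s : ℂ) * f (a + v * s))
    (fun s => (haarFunction s : ℂ) * g (a + v * s))

/-- Fubini, and then translation by `v * t` in the position variable: the form depends on the two
points `s`, `t` only through `v * (s - t)`. -/
theorem integral_haarCoeff_mul (f : 𝓢(ℂ, ℂ)) {g : ℂ → ℂ} (hg : IsTestFunction g) (v : ℂ) :
    ∫ a, haarCoeff f a v * haarCoeff g a v = ∫ x, haarIntegrand f g v x := by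
  have e1 : ∀ a, haarCoeff f a v * haarCoeff g a v =
      ∫ x : ℂ × ℂ, ((haarFunction x.1 : ℂ) * f (a + v * x.1)) *
        ((haarFunction x.2 : ℂ) * g (a + v * x.2)) := fun a =>
    (integral_prod_mul (fun s => (haarFunction s : ℂ) * f (a + v * s))
      (fun s => (haarFunction s : ℂ) * g (a + v * s))).symm
  simp only [e1]
  rw [integral_integral_swap (integrable_haar_product f hg v)]
  have e2 : ∫ x, haarIntegrand f g v x = ∫ y, ∫ a, haarIntegrand f g v (y, a) :=
    integral_prod (haarIntegrand f g v) (integrable_haarIntegrand f hg v)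
  rw [e2]
  congr 1
  ext1 x
  rw [← integral_add_right_eq_self (fun a => haarIntegrand f g v (x, a)) (v * x.2)]
  congr 1
  ext1 a
  have e3 : a + v * x.2 + v * (x.1 - x.2) = a + v * x.1 := by ring
  simp only [haarIntegrand, e3]
  ring

theorem integrable_annulus_haarIntegrand (f : 𝓢(ℂ, ℂ)) {g : ℂ → ℂ} (hg : IsTestFunction g)
    {ε R : ℝ} (hε : 0 < ε) :
    Integrable (fun y : ℂ × ((ℂ × ℂ) × ℂ) => (y.1 ^ 2)⁻¹ * haarIntegrand f g y.1 y.2)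
      ((volume.restrict (annulus ε R)).prod volume) := by
  obtain ⟨Cf, hCf0, hCf⟩ := exists_norm_schwartz_le f
  have h1 : Integrable (fun _ : ℂ => (((ε ^ 2)⁻¹ * Cf : ℝ) : ℂ)) (volume.restrict (annulus ε R)) :=
    integrableOn_const (volume_annulus_lt_top ε R).ne
  have hm := measurable_haarIntegrand f hg
  refine (h1.mul_prod (integrable_haarFunction_mul.mul_prod hg.integrable)).mono
    (Measurable.aestronglyMeasurable (by fun_prop)) ?_
  have hae : ∀ᵐ y ∂((volume.restrict (annulus ε R)).prod (volume : Measure ((ℂ × ℂ) × ℂ))),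
      y.1 ∈ annulus ε R :=
    Measure.quasiMeasurePreserving_fst.ae (ae_restrict_mem (measurableSet_annulus ε R))
  filter_upwards [hae] with y hy
  have hy1 : ‖(y.1 ^ 2)⁻¹‖ ≤ (ε ^ 2)⁻¹ := by
    rw [norm_inv, norm_pow]
    have := hy.1
    gcongr
  have hc : 0 ≤ (ε ^ 2)⁻¹ * Cf := by positivity
  rw [norm_mul, norm_mul, Complex.norm_real, Real.norm_of_nonneg hc, haarIntegrand, norm_mul,
    norm_mul (g _), norm_mul _ (g _)]
  calc _ ≤ (ε ^ 2)⁻¹ * (‖(haarFunction y.2.1.1 : ℂ) * (haarFunction y.2.1.2 : ℂ)‖ *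
        (‖g y.2.2‖ * Cf)) := by
        gcongr
        exact hCf _
    _ = _ := by ring

theorem integrableOn_annulus_integral_haarCoeff_mul (f : 𝓢(ℂ, ℂ)) {g : ℂ → ℂ}
    (hg : IsTestFunction g) {ε R : ℝ} (hε : 0 < ε) :
    IntegrableOn (fun v => (v ^ 2)⁻¹ * ∫ a, haarCoeff f a v * haarCoeff g a v) (annulus ε R) := by
  have h := (integrable_annulus_haarIntegrand f hg hε (R := R)).integral_prod_left
  simp only [integral_const_mul] at h
  simp only [integral_haarCoeff_mul f hg]
  exact h

theorem setIntegral_annulus_integral_haarCoeff_mul (f : 𝓢(ℂ, ℂ)) {g : ℂ → ℂ}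
    (hg : IsTestFunction g) {ε R : ℝ} (hε : 0 < ε) (hR : ε ≤ R) :
    ∫ v in annulus ε R, (v ^ 2)⁻¹ * ∫ a, haarCoeff f a v * haarCoeff g a v =
      ∫ x : (ℂ × ℂ) × ℂ, (((haarFunction x.1.1 : ℂ) * (haarFunction x.1.2 : ℂ)) * g x.2) *
        (-(Real.pi : ℂ) * (sqDirection (x.1.1 - x.1.2) *
          (truncatedBeurling f x.2 (ε * ‖x.1.1 - x.1.2‖) -
            truncatedBeurling f x.2 (R * ‖x.1.1 - x.1.2‖)))) := by
  simp only [integral_haarCoeff_mul f hg, ← integral_const_mul]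
  rw [integral_integral_swap (f := fun v x => (v ^ 2)⁻¹ * haarIntegrand f g v x)
    (integrable_annulus_haarIntegrand f hg hε)]
  congr 1
  ext1 x
  rw [← setIntegral_annulus_inv_sq_mul f _ _ hε hR, ← integral_const_mul]
  congr 1
  ext1 v
  rw [haarIntegrand]
  ring

/-- Dominated convergence: truncations are bounded uniformly in point and radius, the inner ones
tend to `beurling f` and the outer ones to zero. The limit separates into the integral over pairs of
points and the pairing of `g` with `beurling f`. -/
theorem tendsto_setIntegral_annulus (f : 𝓢(ℂ, ℂ)) {g : ℂ → ℂ} (hg : IsTestFunction g) :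
    Tendsto (fun n : ℕ => ∫ v in annulus ((2 ^ n)⁻¹) (2 ^ n),
        (v ^ 2)⁻¹ * ∫ a, haarCoeff f a v * haarCoeff g a v) atTop
      (𝓝 (-(Real.pi : ℂ) * (haarConstant * ∫ a, g a * beurling f a))) := by
  obtain ⟨C, hC0, hC⟩ := exists_norm_truncatedBeurling_le f
  have hε : ∀ n : ℕ, (0 : ℝ) < (2 ^ n)⁻¹ := fun n => by positivity
  have hR : ∀ n : ℕ, ((2 : ℝ) ^ n)⁻¹ ≤ 2 ^ n := fun n =>
    (inv_le_one_of_one_le₀ (one_le_pow₀ one_le_two)).trans (one_le_pow₀ one_le_two)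
  have hlim : Tendsto (fun n : ℕ => ∫ x : (ℂ × ℂ) × ℂ,
      (((haarFunction x.1.1 : ℂ) * (haarFunction x.1.2 : ℂ)) * g x.2) *
        (-(Real.pi : ℂ) * (sqDirection (x.1.1 - x.1.2) *
          (truncatedBeurling f x.2 ((2 ^ n)⁻¹ * ‖x.1.1 - x.1.2‖) -
            truncatedBeurling f x.2 (2 ^ n * ‖x.1.1 - x.1.2‖))))) atTop
      (𝓝 (∫ x : (ℂ × ℂ) × ℂ,
      (((haarFunction x.1.1 : ℂ) * (haarFunction x.1.2 : ℂ)) * g x.2) *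
        (-(Real.pi : ℂ) * (sqDirection (x.1.1 - x.1.2) * beurling f x.2)))) := by
    refine tendsto_integral_of_dominated_convergence
      (fun x => ‖((haarFunction x.1.1 : ℂ) * (haarFunction x.1.2 : ℂ)) * g x.2‖ *
        (Real.pi * (2 * C))) (fun n => ?_)
      ((integrable_haarFunction_mul.mul_prod hg.integrable).norm.mul_const _) (fun n => ?_) ?_
    · have h := (integrable_annulus_haarIntegrand f hg (hε n) (R := 2 ^ n)).integral_prod_right
      refine h.aestronglyMeasurable.congr (Eventually.of_forall fun x => ?_)
      simp only
      rw [← setIntegral_annulus_inv_sq_mul f _ _ (hε n) (hR n), ← integral_const_mul]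
      congr 1
      ext1 v
      rw [haarIntegrand]
      ring
    · refine Eventually.of_forall fun x => ?_
      rw [norm_mul]
      gcongr
      rw [norm_mul, norm_neg, Complex.norm_real, Real.norm_of_nonneg Real.pi_pos.le]
      gcongr
      -- For coinciding points the radii are zero and the uniform bound is not available, but the
      -- factor `sqDirection 0` vanishes.
      rcases eq_or_ne (x.1.1 - x.1.2) 0 with h | h
      · rw [h]; simp [sqDirection, hC0]
      · have h0 := norm_pos_iff.2 h
        rw [norm_mul, two_mul]
        calc _ ≤ 1 * ‖truncatedBeurling f x.2 ((2 ^ n)⁻¹ * ‖x.1.1 - x.1.2‖) -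
            truncatedBeurling f x.2 (2 ^ n * ‖x.1.1 - x.1.2‖)‖ := by
              gcongr
              exact norm_sqDirection_le _
          _ ≤ _ := by
              rw [one_mul]
              exact (norm_sub_le _ _).trans (add_le_add (hC _ _ (by positivity))
                (hC _ _ (by positivity)))
    · refine Eventually.of_forall fun x => ?_
      refine Tendsto.const_mul _ (Tendsto.const_mul _ ?_)
      rcases eq_or_ne (x.1.1 - x.1.2) 0 with h | h
      · rw [h]; simp [sqDirection]
      · have h0 := norm_pos_iff.2 h
        refine Tendsto.const_mul _ ?_
        rw [← sub_zero (beurling f x.2)]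
        have hpow : Tendsto (fun n : ℕ => (2 : ℝ) ^ n) atTop atTop :=
          tendsto_pow_atTop_atTop_of_one_lt one_lt_two
        refine Tendsto.sub ?_ ?_
        · refine (tendsto_truncatedBeurling f x.2).comp (tendsto_nhdsWithin_iff.2 ⟨?_, ?_⟩)
          · simpa using hpow.inv_tendsto_atTop.mul_const ‖x.1.1 - x.1.2‖
          · exact Eventually.of_forall fun n => mul_pos (hε n) h0
        · exact (tendsto_truncatedBeurling_atTop f x.2).comp (hpow.atTop_mul_const h0)
  have hval : ∫ x : (ℂ × ℂ) × ℂ, (((haarFunction x.1.1 : ℂ) * (haarFunction x.1.2 : ℂ)) * g x.2) *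
        (-(Real.pi : ℂ) * (sqDirection (x.1.1 - x.1.2) * beurling f x.2)) =
      -(Real.pi : ℂ) * (haarConstant * ∫ a, g a * beurling f a) := by
    have h := integral_prod_mul (μ := (volume : Measure (ℂ × ℂ))) (ν := (volume : Measure ℂ))
      (fun x : ℂ × ℂ => (haarFunction x.1 * haarFunction x.2 : ℝ) * sqDirection (x.1 - x.2))
      (fun a => g a * beurling f a)
    rw [haarConstant, ← h, ← integral_const_mul]
    congr 1
    ext1 x
    push_cast
    ring
  rw [← hval]
  refine hlim.congr fun n => ?_
  rw [setIntegral_annulus_integral_haarCoeff_mul f hg (hε n) (hR n)]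

/-! ### Dyadic scales as generations of a tree -/

open FourTree

/-- The children of the node `(a, n)`, which stands for the square `a + (v / 2 ^ n) * baseSquare`. -/
noncomputable def childSquare (v : ℂ) (i : Fin 4) (y : ℂ × ℕ) : ℂ × ℕ :=
  (y.1 + v / 2 ^ y.2 * quadrantCentre i, y.2 + 1)

/-- The means of a function over the squares represented by the nodes. -/
noncomputable def nodeMean {E : Type*} [NormedAddCommGroup E] [NormedSpace ℝ E] (v : ℂ) (φ : ℂ → E)
    (y : ℂ × ℕ) : E :=
  squareMean φ y.1 (v / 2 ^ y.2)

theorem div_two_pow_ne_zero {v : ℂ} (hv : v ≠ 0) (n : ℕ) : v / 2 ^ n ≠ 0 :=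
  div_ne_zero hv (pow_ne_zero _ two_ne_zero)

theorem nodeMean_childSquare {E : Type*} [NormedAddCommGroup E] [NormedSpace ℝ E] (v : ℂ)
    (φ : ℂ → E) (i : Fin 4) (y : ℂ × ℕ) : nodeMean v φ (childSquare v i y) =
      squareMean φ (y.1 + v / 2 ^ y.2 * quadrantCentre i) (v / 2 ^ y.2 / 2) := by
  rw [nodeMean, childSquare, pow_succ, ← div_div]

theorem isMean_nodeMean {E : Type*} [NormedAddCommGroup E] [NormedSpace ℝ E] {v : ℂ} (hv : v ≠ 0)
    {φ : ℂ → E} (hφ : LocallyIntegrable φ) : IsMean (childSquare v) (nodeMean v φ) := by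
  intro y
  simp only [nodeMean_childSquare]
  exact squareMean_eq hφ y.1 (div_two_pow_ne_zero hv _)

/-- The product of the Haar coefficients of two functions at a node. -/
noncomputable def nodeHaarProd (v : ℂ) (f g : ℂ → ℂ) (y : ℂ × ℕ) : ℂ :=
  haarCoeff f y.1 (v / 2 ^ y.2) * haarCoeff g y.1 (v / 2 ^ y.2)

theorem norm_nodeHaarProd {v : ℂ} (hv : v ≠ 0) {f g : ℂ → ℂ} (hf : LocallyIntegrable f)
    (hg : LocallyIntegrable g) (y : ℂ × ℕ) : ‖nodeHaarProd v f g y‖ =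
      coeffProd (childSquare v) (nodeMean v f) (nodeMean v g) y := by
  rw [coeffProd, nodeHaarProd, norm_mul, haarCoeff_eq hf _ (div_two_pow_ne_zero hv _),
    haarCoeff_eq hg _ (div_two_pow_ne_zero hv _)]
  simp only [nodeMean_childSquare]

theorem norm_treeSum_le {N : Type*} {ch : Fin 4 → N → N} (b : N → ℂ) (n : ℕ) (y : N) :
    ‖treeSum ch b n y‖ ≤ treeSum ch (fun y => ‖b y‖) n y := by
  induction n generalizing y with
  | zero => simp [treeSum]
  | succ n ih =>
    simp only [treeSum]
    refine (norm_add_le _ _).trans ?_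
    gcongr
    rw [norm_smul, Real.norm_of_nonneg (by norm_num : (0 : ℝ) ≤ 4⁻¹), smul_eq_mul]
    gcongr
    exact (norm_sum_le _ _).trans (Finset.sum_le_sum fun i _ => ih _)

/-- Children are translates of a square of half the size. Integrating over all positions removes the
translations, so the mean over four children becomes the plain integral at the next scale. -/
theorem integral_treeSum (f : 𝓢(ℂ, ℂ)) {g : ℂ → ℂ} (hg : IsTestFunction g) (v : ℂ) (m n : ℕ) :
    Integrable (fun a => treeSum (childSquare v) (nodeHaarProd v f g) m (a, n)) ∧
      ∫ a, treeSum (childSquare v) (nodeHaarProd v f g) m (a, n) =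
        ∑ j ∈ Finset.range m, ∫ a, nodeHaarProd v f g (a, n + j) := by
  induction m generalizing n with
  | zero => simp [treeSum]
  | succ m ih =>
    have h0 : Integrable fun a => nodeHaarProd v f g (a, n) :=
      integrable_haarCoeff_mul f hg (v / 2 ^ n)
    have hc : ∀ (i : Fin 4) (a : ℂ), childSquare v i (a, n) =
        (a + v / 2 ^ n * quadrantCentre i, n + 1) := fun _ _ => rfl
    have hi : ∀ i : Fin 4, Integrable fun a => treeSum (childSquare v) (nodeHaarProd v f g) m
        (childSquare v i (a, n)) := fun i => by
      simp only [hc]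
      exact (ih (n + 1)).1.comp_add_right (v / 2 ^ n * quadrantCentre i)
    have hs : Integrable fun a => (4 : ℝ)⁻¹ • ∑ i : Fin 4, treeSum (childSquare v)
        (nodeHaarProd v f g) m (childSquare v i (a, n)) :=
      Integrable.smul (4 : ℝ)⁻¹ (integrable_finsetSum Finset.univ fun i _ => hi i)
    refine ⟨h0.add hs, ?_⟩
    simp only [treeSum]
    rw [integral_add h0 hs, integral_smul, integral_finsetSum _ fun i _ => hi i]
    have ht : ∀ i : Fin 4, ∫ a, treeSum (childSquare v) (nodeHaarProd v f g) m
        (childSquare v i (a, n)) = ∑ j ∈ Finset.range m, ∫ a, nodeHaarProd v f g (a, n + 1 + j) :=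
      fun i => by
        simp only [hc]
        rw [← (ih (n + 1)).2]
        exact integral_add_right_eq_self (fun a => treeSum (childSquare v) (nodeHaarProd v f g) m
          (a, n + 1)) (v / 2 ^ n * quadrantCentre i)
    simp only [ht, Finset.sum_const, Finset.card_univ, Fintype.card_fin]
    rw [Finset.sum_range_succ', add_comm]
    congr 1
    rw [← Nat.cast_smul_eq_nsmul ℝ, smul_smul]
    norm_num
    exact Finset.sum_congr rfl fun j _ => by rw [add_right_comm, add_assoc]

/-- The measure `v⁻² dv` is invariant under dilations by `2 ^ m`. -/
theorem setIntegral_annulus_scale (β : ℂ → ℂ) (R : ℝ) (m : ℕ) :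
    ∫ v in annulus (R / 2 ^ (m + 1)) (R / 2 ^ m), (v ^ 2)⁻¹ * β v =
      ∫ v in annulus (R / 2) R, (v ^ 2)⁻¹ * β (v / 2 ^ m) := by
  have h2 : ((2 : ℂ) ^ m)⁻¹ ≠ 0 := inv_ne_zero (pow_ne_zero _ two_ne_zero)
  have h := integral_complex_mul_left h2
    ((annulus (R / 2 ^ (m + 1)) (R / 2 ^ m)).indicator fun v => (v ^ 2)⁻¹ * β v)
  have hpow : (0 : ℝ) < 2 ^ m := by positivity
  have e : ∀ v, (annulus (R / 2 ^ (m + 1)) (R / 2 ^ m)).indicator (fun v => (v ^ 2)⁻¹ * β v)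
      (((2 : ℂ) ^ m)⁻¹ * v) = (annulus (R / 2) R).indicator
        (fun v => ((2 : ℂ) ^ m) ^ 2 * ((v ^ 2)⁻¹ * β (v / 2 ^ m))) v := by
    intro v
    have hiff : ((2 : ℂ) ^ m)⁻¹ * v ∈ annulus (R / 2 ^ (m + 1)) (R / 2 ^ m) ↔
        v ∈ annulus (R / 2) R := by
      simp only [annulus, Set.mem_ofPred_eq, norm_mul, norm_inv, norm_pow, Complex.norm_ofNat]
      rw [inv_mul_eq_div, div_le_div_iff_of_pos_right hpow, pow_succ', ← div_div,
        div_lt_div_iff_of_pos_right hpow]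
    by_cases hv : v ∈ annulus (R / 2) R
    · rw [Set.indicator_of_mem hv, Set.indicator_of_mem (hiff.2 hv), inv_mul_eq_div ((2 : ℂ) ^ m) v,
        div_pow, inv_div, div_eq_mul_inv, mul_assoc]
    · rw [Set.indicator_of_notMem hv, Set.indicator_of_notMem (mt hiff.1 hv)]
  simp only [e] at h
  rw [integral_indicator (measurableSet_annulus _ _), integral_indicator (measurableSet_annulus _ _),
    integral_const_mul] at h
  have hn : (‖((2 : ℂ) ^ m)⁻¹‖ ^ 2)⁻¹ = ((2 : ℝ) ^ m) ^ 2 := by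
    rw [norm_inv, norm_pow, Complex.norm_ofNat, inv_pow, inv_inv]
  rw [hn, Complex.real_smul] at h
  push_cast at h
  exact (mul_left_cancel₀ (pow_ne_zero 2 (pow_ne_zero m two_ne_zero)) h).symm

theorem integrableOn_annulus_scale {β : ℂ → ℂ} {R : ℝ} (hR : 0 < R)
    (hβ : ∀ ε R : ℝ, 0 < ε → IntegrableOn (fun v => (v ^ 2)⁻¹ * β v) (annulus ε R)) (m : ℕ) :
    IntegrableOn (fun v => (v ^ 2)⁻¹ * β (v / 2 ^ m)) (annulus (R / 2) R) := by
  have h2 : ((2 : ℂ) ^ m)⁻¹ ≠ 0 := inv_ne_zero (pow_ne_zero _ two_ne_zero)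
  have h := hβ (R / 2 ^ (m + 1)) (R / 2 ^ m) (by positivity)
  rw [← integrable_indicator_iff (measurableSet_annulus _ _), ← integrable_complex_mul_left h2] at h
  rw [← integrable_indicator_iff (measurableSet_annulus _ _)]
  refine (h.const_mul ((((2 : ℂ) ^ m) ^ 2)⁻¹)).congr (Eventually.of_forall fun v => ?_)
  have hpow : (0 : ℝ) < 2 ^ m := by positivity
  have hiff : ((2 : ℂ) ^ m)⁻¹ * v ∈ annulus (R / 2 ^ (m + 1)) (R / 2 ^ m) ↔
      v ∈ annulus (R / 2) R := by
    simp only [annulus, Set.mem_ofPred_eq, norm_mul, norm_inv, norm_pow, Complex.norm_ofNat]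
    rw [inv_mul_eq_div, div_le_div_iff_of_pos_right hpow, pow_succ', ← div_div,
      div_lt_div_iff_of_pos_right hpow]
  simp only
  by_cases hv : v ∈ annulus (R / 2) R
  · rw [Set.indicator_of_mem hv, Set.indicator_of_mem (hiff.2 hv), inv_mul_eq_div ((2 : ℂ) ^ m) v,
      div_pow, inv_div, div_eq_mul_inv _ (v ^ 2), mul_assoc,
      inv_mul_cancel_left₀ (pow_ne_zero 2 (pow_ne_zero m two_ne_zero))]
  · rw [Set.indicator_of_notMem hv, Set.indicator_of_notMem (mt hiff.1 hv), mul_zero]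

theorem setIntegral_annulus_eq_sum {β : ℂ → ℂ} {R : ℝ} (hR : 0 < R)
    (hβ : ∀ ε R : ℝ, 0 < ε → IntegrableOn (fun v => (v ^ 2)⁻¹ * β v) (annulus ε R)) (m : ℕ) :
    ∫ v in annulus (R / 2 ^ m) R, (v ^ 2)⁻¹ * β v =
      ∫ v in annulus (R / 2) R, (v ^ 2)⁻¹ * ∑ j ∈ Finset.range m, β (v / 2 ^ j) := by
  induction m with
  | zero =>
    have : annulus (R / 2 ^ 0) R = ∅ := by
      ext v
      simp only [annulus, Set.mem_ofPred_eq, pow_zero, div_one, Set.mem_empty_iff_false, iff_false,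
        not_and, not_le]
      exact fun h => h
    rw [this]
    simp
  | succ m ih =>
    have hle : R / 2 ^ (m + 1) ≤ R / 2 ^ m := by
      gcongr
      · exact one_le_two
      · exact m.le_succ
    have hle' : R / 2 ^ m ≤ R := div_le_self hR.le (one_le_pow₀ one_le_two)
    have hun : annulus (R / 2 ^ (m + 1)) R =
        annulus (R / 2 ^ m) R ∪ annulus (R / 2 ^ (m + 1)) (R / 2 ^ m) := by
      ext v
      simp only [annulus, Set.mem_union, Set.mem_ofPred_eq]
      constructor
      · rintro ⟨h1, h2⟩
        rcases lt_or_ge (R / 2 ^ m) ‖v‖ with h | h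
        · exact Or.inl ⟨h, h2⟩
        · exact Or.inr ⟨h1, h⟩
      · rintro (⟨h1, h2⟩ | ⟨h1, h2⟩)
        · exact ⟨hle.trans_lt h1, h2⟩
        · exact ⟨h1, h2.trans hle'⟩
    have hdisj : Disjoint (annulus (R / 2 ^ m) R) (annulus (R / 2 ^ (m + 1)) (R / 2 ^ m)) :=
      Set.disjoint_left.2 fun v h1 h2 => h1.1.not_ge h2.2
    rw [hun, setIntegral_union hdisj (measurableSet_annulus _ _) (hβ _ _ (by positivity))
      (hβ _ _ (by positivity)), ih, setIntegral_annulus_scale, ← integral_add]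
    · simp only [Finset.sum_range_succ, mul_add]
    · simp only [Finset.mul_sum]
      exact integrable_finsetSum _ fun j _ => integrableOn_annulus_scale hR hβ j
    · exact integrableOn_annulus_scale hR hβ m

/-- All scales are folded onto the octave `R / 2 < ‖v‖ ≤ R`. There `‖v⁻²‖` is at most `4 / R ^ 2`,
and the area is at most `π * R ^ 2`. -/
theorem norm_setIntegral_annulus_le (f : 𝓢(ℂ, ℂ)) {g : ℂ → ℂ} (hg : IsTestFunction g) {K : ℝ}
    (hK : ∀ v : ℂ, v ≠ 0 → ∀ m : ℕ,
      ∫ a, ‖treeSum (childSquare v) (nodeHaarProd v f g) m (a, 0)‖ ≤ K)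
    {R : ℝ} (hR : 0 < R) (m : ℕ) :
    ‖∫ v in annulus (R / 2 ^ m) R, (v ^ 2)⁻¹ * ∫ a, haarCoeff f a v * haarCoeff g a v‖ ≤
      4 * Real.pi * K := by
  rw [setIntegral_annulus_eq_sum hR fun ε R hε =>
    integrableOn_annulus_integral_haarCoeff_mul f hg hε]
  have hK0 : 0 ≤ K := (integral_nonneg fun _ => norm_nonneg _).trans (hK 1 one_ne_zero 0)
  have hbound : ∀ v ∈ annulus (R / 2) R, ‖(v ^ 2)⁻¹ * ∑ j ∈ Finset.range m,
      ∫ a, haarCoeff f a (v / 2 ^ j) * haarCoeff g a (v / 2 ^ j)‖ ≤ ((R / 2) ^ 2)⁻¹ * K := by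
    intro v hv
    have hv0 : v ≠ 0 := norm_pos_iff.1 ((half_pos hR).trans hv.1)
    have e : ∑ j ∈ Finset.range m, ∫ a, haarCoeff f a (v / 2 ^ j) * haarCoeff g a (v / 2 ^ j) =
        ∫ a, treeSum (childSquare v) (nodeHaarProd v f g) m (a, 0) := by
      rw [(integral_treeSum f hg v m 0).2]
      simp only [nodeHaarProd, zero_add]
    rw [e, norm_mul, norm_inv, norm_pow]
    have h1 := hv.1.le
    gcongr
    exact (norm_integral_le_integral_norm _).trans (hK v hv0 m)
  refine (norm_setIntegral_le_of_norm_le_const (volume_annulus_lt_top _ _) hbound).trans ?_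
  have hvol : volume.real (annulus (R / 2) R) ≤ Real.pi * R ^ 2 := by
    have hsub : annulus (R / 2) R ⊆ Metric.closedBall (0 : ℂ) R := fun v hv => by
      simpa using hv.2
    refine (measureReal_mono hsub measure_closedBall_lt_top.ne).trans ?_
    rw [measureReal_def, Complex.volume_closedBall, ENNReal.toReal_mul, ENNReal.toReal_pow,
      ENNReal.toReal_ofReal hR.le, ENNReal.coe_toReal, NNReal.coe_real_pi, mul_comm]
  calc _ ≤ ((R / 2) ^ 2)⁻¹ * K * (Real.pi * R ^ 2) := by gcongr
    _ = _ := by field_simp; ring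

/-- A bound for the tree sums bounds the bilinear form of the Beurling transform. -/
theorem norm_integral_mul_beurling_le (f : 𝓢(ℂ, ℂ)) {g : ℂ → ℂ} (hg : IsTestFunction g) {K : ℝ}
    (hK : ∀ v : ℂ, v ≠ 0 → ∀ m : ℕ,
      ∫ a, ‖treeSum (childSquare v) (nodeHaarProd v f g) m (a, 0)‖ ≤ K) :
    ‖∫ a, g a * beurling f a‖ ≤ 4 * ‖haarConstant‖⁻¹ * K := by
  have h := (tendsto_setIntegral_annulus f hg).norm
  have hb : ∀ n : ℕ, ‖∫ v in annulus ((2 ^ n)⁻¹) (2 ^ n),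
      (v ^ 2)⁻¹ * ∫ a, haarCoeff f a v * haarCoeff g a v‖ ≤ 4 * Real.pi * K := by
    intro n
    -- Descending `2 * n` octaves from the outer radius `2 ^ n` reaches the inner radius `2 ^ (-n)`.
    have h1 := norm_setIntegral_annulus_le f hg hK (R := 2 ^ n) (by positivity) (n + n)
    have e : (2 : ℝ) ^ n / 2 ^ (n + n) = (2 ^ n)⁻¹ := by
      rw [pow_add]
      field_simp
    rwa [e] at h1
  have hle := le_of_tendsto h (Eventually.of_forall hb)
  rw [norm_mul, norm_neg, Complex.norm_real, Real.norm_of_nonneg Real.pi_pos.le, norm_mul] at hle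
  have hc := norm_pos_iff.2 haarConstant_ne_zero
  have h2 : Real.pi * (‖haarConstant‖ * ‖∫ a, g a * beurling f a‖) ≤ Real.pi * (4 * K) := by
    linarith
  have h3 := le_of_mul_le_mul_left h2 Real.pi_pos
  calc ‖∫ a, g a * beurling f a‖ = ‖haarConstant‖⁻¹ * (‖haarConstant‖ *
        ‖∫ a, g a * beurling f a‖) := by field_simp
    _ ≤ ‖haarConstant‖⁻¹ * (4 * K) := by gcongr
    _ = _ := by ring

/-! ### Means over squares and the characteristic -/

theorem integrable_rpow_mul_rpow_and_integral_le {α : Type*} [MeasurableSpace α] {μ : Measure α}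
    {p q : ℝ} (hpq : p.HolderConjugate q) {φ ψ : α → ℝ} (hφ0 : ∀ x, 0 ≤ φ x) (hψ0 : ∀ x, 0 ≤ ψ x)
    (hφ : Integrable φ μ) (hψ : Integrable ψ μ) :
    Integrable (fun x => φ x ^ (1 / p) * ψ x ^ (1 / q)) μ ∧
      ∫ x, φ x ^ (1 / p) * ψ x ^ (1 / q) ∂μ ≤ (∫ x, φ x ∂μ) ^ (1 / p) * (∫ x, ψ x ∂μ) ^ (1 / q) := by
  have hp := one_div_nonneg.2 hpq.nonneg
  have hq := one_div_nonneg.2 hpq.symm.nonneg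
  have hm : AEStronglyMeasurable (fun x => φ x ^ (1 / p) * ψ x ^ (1 / q)) μ :=
    ((hφ.aestronglyMeasurable.aemeasurable.pow_const _).mul
      (hψ.aestronglyMeasurable.aemeasurable.pow_const _)).aestronglyMeasurable
  have hnn : ∀ x, 0 ≤ φ x ^ (1 / p) * ψ x ^ (1 / q) := fun x =>
    mul_nonneg (Real.rpow_nonneg (hφ0 x) _) (Real.rpow_nonneg (hψ0 x) _)
  have hpt : ∀ x, ENNReal.ofReal (φ x ^ (1 / p) * ψ x ^ (1 / q)) =
      ENNReal.ofReal (φ x) ^ (1 / p) * ENNReal.ofReal (ψ x) ^ (1 / q) := fun x => by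
    rw [ENNReal.ofReal_mul (Real.rpow_nonneg (hφ0 x) _), ENNReal.ofReal_rpow_of_nonneg (hφ0 x) hp,
      ENNReal.ofReal_rpow_of_nonneg (hψ0 x) hq]
  have hsum : 1 / p + 1 / q = 1 := by
    rw [one_div, one_div]; exact hpq.inv_add_inv_eq_one
  have hle : ∫⁻ x, ENNReal.ofReal (φ x ^ (1 / p) * ψ x ^ (1 / q)) ∂μ ≤
      ENNReal.ofReal ((∫ x, φ x ∂μ) ^ (1 / p) * (∫ x, ψ x ∂μ) ^ (1 / q)) := by
    simp only [hpt]
    rw [ENNReal.ofReal_mul (Real.rpow_nonneg (integral_nonneg hφ0) _),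
      ← ENNReal.ofReal_rpow_of_nonneg (integral_nonneg hφ0) hp,
      ← ENNReal.ofReal_rpow_of_nonneg (integral_nonneg hψ0) hq,
      ofReal_integral_eq_lintegral_ofReal hφ (Eventually.of_forall hφ0),
      ofReal_integral_eq_lintegral_ofReal hψ (Eventually.of_forall hψ0)]
    exact ENNReal.lintegral_mul_norm_pow_le hφ.aestronglyMeasurable.aemeasurable.ennreal_ofReal
      hψ.aestronglyMeasurable.aemeasurable.ennreal_ofReal hp hq hsum
  refine ⟨⟨hm, ?_⟩, ?_⟩
  · rw [hasFiniteIntegral_iff_ofReal (Eventually.of_forall hnn)]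
    exact hle.trans_lt ENNReal.ofReal_lt_top
  · rw [integral_eq_lintegral_of_nonneg_ae (Eventually.of_forall hnn) hm]
    exact ENNReal.toReal_le_of_le_ofReal (mul_nonneg (Real.rpow_nonneg (integral_nonneg hφ0) _)
      (Real.rpow_nonneg (integral_nonneg hψ0) _)) hle

theorem squareMean_nonneg {φ : ℂ → ℝ} (h : ∀ z, 0 ≤ φ z) (a v : ℂ) : 0 ≤ squareMean φ a v :=
  smul_nonneg (by norm_num) (integral_nonneg fun _ => h _)

theorem squareMean_pos {φ : ℂ → ℝ} (h : ∀ z, 0 < φ z) (hφ : LocallyIntegrable φ) (a : ℂ) {v : ℂ}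
    (hv : v ≠ 0) : 0 < squareMean φ a v := by
  refine smul_pos (by norm_num) ?_
  rw [setIntegral_pos_iff_support_of_nonneg_ae (Eventually.of_forall fun _ => (h _).le)
    (integrableOn_baseSquare_comp hφ a hv)]
  have : Function.support (fun s => φ (a + v * s)) = Set.univ :=
    Set.eq_univ_of_forall fun s => (h _).ne'
  rw [this, Set.univ_inter, volume_baseSquare]
  norm_num

theorem norm_squareMean_le {f : ℂ → ℂ} (a v : ℂ) :
    ‖squareMean f a v‖ ≤ squareMean (fun z => ‖f z‖) a v := by
  rw [squareMean, squareMean, norm_smul, Real.norm_of_nonneg (by norm_num : (0 : ℝ) ≤ 4⁻¹),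
    smul_eq_mul]
  gcongr
  exact norm_integral_le_integral_norm _

theorem squareMean_rpow_mul_rpow_le {p q : ℝ} (hpq : p.HolderConjugate q) {φ ψ : ℂ → ℝ}
    (hφ0 : ∀ x, 0 ≤ φ x) (hψ0 : ∀ x, 0 ≤ ψ x) (hφ : LocallyIntegrable φ)
    (hψ : LocallyIntegrable ψ) (a : ℂ) {v : ℂ} (hv : v ≠ 0) :
    squareMean (fun z => φ z ^ (1 / p) * ψ z ^ (1 / q)) a v ≤
      squareMean φ a v ^ (1 / p) * squareMean ψ a v ^ (1 / q) := by
  have h := (integrable_rpow_mul_rpow_and_integral_le hpq (fun s => hφ0 (a + v * s))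
    (fun s => hψ0 (a + v * s)) (integrableOn_baseSquare_comp hφ a hv)
    (integrableOn_baseSquare_comp hψ a hv)).2
  have e3 : (4 : ℝ)⁻¹ = (4 : ℝ)⁻¹ ^ (1 / p) * (4 : ℝ)⁻¹ ^ (1 / q) := by
    rw [← Real.rpow_add (by norm_num), one_div, one_div, hpq.inv_add_inv_eq_one, Real.rpow_one]
  simp only [squareMean, smul_eq_mul]
  rw [Real.mul_rpow (by norm_num) (integral_nonneg fun _ => hφ0 _),
    Real.mul_rpow (by norm_num) (integral_nonneg fun _ => hψ0 _)]
  calc _ ≤ (4 : ℝ)⁻¹ * _ := mul_le_mul_of_nonneg_left h (by norm_num)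
    _ = _ := by
      conv_lhs => rw [e3]
      ring

/-- A mean over a moving square is an average of translates of `φ`, each with the same integral. -/
theorem integrable_squareMean_and_integral_eq {φ : ℂ → ℝ} (hφm : Measurable φ) (hφ : Integrable φ)
    (v : ℂ) : Integrable (fun a => squareMean φ a v) ∧ ∫ a, squareMean φ a v = ∫ a, φ a := by
  have hm : Measurable fun y : ℂ × ℂ => φ (y.1 + v * y.2) := by fun_prop
  have hfin : IsFiniteMeasure (volume.restrict baseSquare) :=
    ⟨by rw [Measure.restrict_apply_univ, volume_baseSquare]; norm_num⟩
  have hi : Integrable (fun y : ℂ × ℂ => φ (y.1 + v * y.2))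
      ((volume : Measure ℂ).prod (volume.restrict baseSquare)) := by
    rw [integrable_prod_iff' hm.aestronglyMeasurable]
    refine ⟨Eventually.of_forall fun s => hφ.comp_add_right (v * s), ?_⟩
    have : ∀ s, ∫ a, ‖φ (a + v * s)‖ = ∫ a, ‖φ a‖ := fun s =>
      integral_add_right_eq_self (fun a => ‖φ a‖) (v * s)
    simp only [this]
    exact integrable_const _
  refine ⟨hi.integral_prod_left.const_mul _, ?_⟩
  simp only [squareMean, smul_eq_mul]
  rw [integral_const_mul, integral_integral_swap (f := fun a s => φ (a + v * s)) hi]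
  have : ∀ s, ∫ a, φ (a + v * s) = ∫ a, φ a := fun s => integral_add_right_eq_self φ (v * s)
  simp only [this]
  rw [integral_const, measureReal_def, Measure.restrict_apply_univ, volume_baseSquare]
  norm_num [smul_eq_mul]
  ring

/-- The polar form of `v` identifies the squares of the representation with those of the
characteristic. As `v` has arbitrary argument, squares of every orientation occur. -/
theorem rotatedSquare_eq (a v : ℂ) :
    rotatedSquare a v.arg ‖v‖ = (fun s => a + v * s) '' rotatedSquare 0 0 1 := by
  have h0 : rotatedSquare 0 0 1 = {s : ℂ | |s.re| ≤ 1 ∧ |s.im| ≤ 1} := by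
    simp [rotatedSquare]
  rw [h0, rotatedSquare]
  rcases eq_or_ne v 0 with rfl | hv
  · simp only [Complex.arg_zero, norm_zero, zero_mul, add_zero]
    ext z
    simp only [Set.mem_image, Set.mem_ofPred_eq, abs_nonpos_iff]
    constructor
    · rintro ⟨s, ⟨h1, h2⟩, rfl⟩
      refine ⟨0, by simp, ?_⟩
      rw [show s = 0 from Complex.ext h1 h2]
      simp
    · rintro ⟨s, -, rfl⟩
      exact ⟨0, by simp, by simp⟩
  have hn := norm_pos_iff.2 hv
  have hpol : v = Complex.exp (v.arg * Complex.I) * ‖v‖ := by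
    rw [mul_comm]; exact (Complex.norm_mul_exp_arg_mul_I v).symm
  ext z
  simp only [Set.mem_image, Set.mem_ofPred_eq]
  constructor
  · rintro ⟨s, ⟨h1, h2⟩, rfl⟩
    refine ⟨s / ‖v‖, ⟨?_, ?_⟩, ?_⟩
    · rw [Complex.div_ofReal_re, abs_div, abs_of_pos hn]; exact (div_le_one hn).2 h1
    · rw [Complex.div_ofReal_im, abs_div, abs_of_pos hn]; exact (div_le_one hn).2 h2
    · have : (‖v‖ : ℂ) ≠ 0 := by exact_mod_cast hn.ne'
      conv_lhs => rw [hpol]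
      simp only [norm_mul, Complex.norm_exp_ofReal_mul_I, Complex.norm_real, norm_norm, one_mul]
      field_simp
  · rintro ⟨s, ⟨h1, h2⟩, rfl⟩
    refine ⟨‖v‖ * s, ⟨?_, ?_⟩, ?_⟩
    · rw [Complex.re_ofReal_mul, abs_mul, abs_of_pos hn]
      exact mul_le_of_le_one_right hn.le h1
    · rw [Complex.im_ofReal_mul, abs_mul, abs_of_pos hn]
      exact mul_le_of_le_one_right hn.le h2
    · rw [← mul_assoc, ← hpol]

theorem mem_rotatedSquare_zero {s : ℂ} : s ∈ rotatedSquare 0 0 1 ↔ |s.re| ≤ 1 ∧ |s.im| ≤ 1 := by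
  simp [rotatedSquare]

theorem measurableSet_rotatedSquare_zero : MeasurableSet (rotatedSquare 0 0 1) := by
  have h : rotatedSquare 0 0 1 = {s : ℂ | |s.re| ≤ 1 ∧ |s.im| ≤ 1} :=
    Set.ext fun _ => mem_rotatedSquare_zero
  rw [h]
  exact (measurableSet_le (Complex.measurable_re.abs) measurable_const).inter
    (measurableSet_le (Complex.measurable_im.abs) measurable_const)

theorem volume_rotatedSquare_zero : volume (rotatedSquare 0 0 1) = 4 := by
  have h := Complex.volume_preserving_equiv_real_prod.symm.measure_preimage
    measurableSet_rotatedSquare_zero.nullMeasurableSet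
  have e : Complex.measurableEquivRealProd.symm ⁻¹' (rotatedSquare 0 0 1) =
      Set.Icc (-1 : ℝ) 1 ×ˢ Set.Icc (-1 : ℝ) 1 := by
    ext ⟨x, y⟩
    simp [mem_rotatedSquare_zero, Complex.measurableEquivRealProd, abs_le]
    tauto
  rw [e] at h
  rw [← h, Measure.volume_eq_prod, Measure.prod_prod, Real.volume_Icc, ← ENNReal.ofReal_mul (by norm_num)]
  norm_num

theorem setLIntegral_rotatedSquare (φ : ℂ → ℝ≥0∞) (a : ℂ) {v : ℂ} (hv : v ≠ 0) :
    ∫⁻ z in rotatedSquare a v.arg ‖v‖, φ z =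
      ENNReal.ofReal (‖v‖ ^ 2) * ∫⁻ s in rotatedSquare 0 0 1, φ (a + v * s) := by
  have hemb : MeasurableEmbedding fun s => a + v * s :=
    (measurableEmbedding_addLeft a).comp (measurableEmbedding_complex_mul_left hv)
  have hS : MeasurableSet ((fun s => a + v * s) '' rotatedSquare 0 0 1) :=
    hemb.measurableSet_image.2 measurableSet_rotatedSquare_zero
  have hn : 0 < ‖v‖ ^ 2 := by have := norm_pos_iff.2 hv; positivity
  have h := lintegral_complex_mul_left hv fun u =>
    ((fun s => a + v * s) '' rotatedSquare 0 0 1).indicator φ (a + u)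
  rw [lintegral_add_left_eq_self (μ := volume)
    (((fun s => a + v * s) '' rotatedSquare 0 0 1).indicator φ) a, lintegral_indicator hS,
    ← rotatedSquare_eq] at h
  have e : ∀ s, (rotatedSquare a v.arg ‖v‖).indicator φ (a + v * s) =
      (rotatedSquare 0 0 1).indicator (fun s => φ (a + v * s)) s := by
    intro s
    have hiff : a + v * s ∈ rotatedSquare a v.arg ‖v‖ ↔ s ∈ rotatedSquare 0 0 1 := by
      rw [rotatedSquare_eq]
      exact hemb.injective.mem_set_image
    by_cases hs : s ∈ rotatedSquare 0 0 1
    · rw [Set.indicator_of_mem hs, Set.indicator_of_mem (hiff.2 hs)]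
    · rw [Set.indicator_of_notMem hs, Set.indicator_of_notMem (mt hiff.1 hs)]
  simp only [e] at h
  rw [lintegral_indicator measurableSet_rotatedSquare_zero] at h
  rw [h, ← mul_assoc, ← ENNReal.ofReal_mul hn.le, mul_inv_cancel₀ hn.ne', ENNReal.ofReal_one, one_mul]

theorem laverage_rotatedSquare (φ : ℂ → ℝ≥0∞) (a : ℂ) {v : ℂ} (hv : v ≠ 0) :
    laverage (volume.restrict (rotatedSquare a v.arg ‖v‖)) φ =
      4⁻¹ * ∫⁻ s in rotatedSquare 0 0 1, φ (a + v * s) := by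
  have hn : 0 < ‖v‖ ^ 2 := by have := norm_pos_iff.2 hv; positivity
  have hvol : volume (rotatedSquare a v.arg ‖v‖) = ENNReal.ofReal (‖v‖ ^ 2) * 4 := by
    rw [← setLIntegral_one, setLIntegral_rotatedSquare _ a hv, setLIntegral_one,
      volume_rotatedSquare_zero]
  rw [setLAverage_eq, hvol, setLIntegral_rotatedSquare _ a hv,
    ENNReal.mul_div_mul_left _ _ (ENNReal.ofReal_pos.2 hn).ne' ENNReal.ofReal_ne_top,
    ENNReal.div_eq_inv_mul]

theorem baseSquare_subset : baseSquare ⊆ rotatedSquare 0 0 1 := fun _ hs =>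
  mem_rotatedSquare_zero.2 ⟨abs_le.2 ⟨hs.1.1, hs.1.2.le⟩, abs_le.2 ⟨hs.2.1, hs.2.2.le⟩⟩

theorem laverage_mul_le_apCharacteristic (p : ℝ) (w : ℂ → ℝ) (a : ℂ) {v : ℂ} (hv : v ≠ 0) :
    (4⁻¹ * ∫⁻ s in rotatedSquare 0 0 1, ENNReal.ofReal (w (a + v * s))) *
      (4⁻¹ * ∫⁻ s in rotatedSquare 0 0 1, ENNReal.ofReal (w (a + v * s) ^ (-1 / (p - 1)))) ^ (p - 1)
      ≤ apCharacteristic p w := by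
  rw [← laverage_rotatedSquare (fun z => ENNReal.ofReal (w z)) a hv,
    ← laverage_rotatedSquare (fun z => ENNReal.ofReal (w z ^ (-1 / (p - 1)))) a hv]
  exact le_iSup_of_le a (le_iSup_of_le v.arg (le_iSup_of_le ‖v‖
    (le_iSup_of_le (norm_pos_iff.2 hv) le_rfl)))

/-! ### Regular weights and their duals -/

/-- A measurable everywhere positive representative of a weight in `A_p`. -/
structure IsRegularWeight (p : ℝ) (w : ℂ → ℝ) : Prop where
  one_lt : 1 < p
  measurable : Measurable w
  pos : ∀ z, 0 < w z
  locallyIntegrable : LocallyIntegrable w volume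
  characteristic_lt_top : apCharacteristic p w < ∞

/-- The dual weight `w ^ (-1 / (p - 1))`. -/
noncomputable def dualWeight (p : ℝ) (w : ℂ → ℝ) (z : ℂ) : ℝ := w z ^ (-1 / (p - 1))

namespace IsRegularWeight

variable {p : ℝ} {w : ℂ → ℝ}

theorem dualWeight_pos (h : IsRegularWeight p w) (z : ℂ) : 0 < dualWeight p w z :=
  Real.rpow_pos_of_pos (h.pos z) _

theorem measurable_dualWeight (h : IsRegularWeight p w) : Measurable (dualWeight p w) :=
  h.measurable.pow_const _

theorem lintegral_weight_ne_zero (h : IsRegularWeight p w) (a v : ℂ) :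
    4⁻¹ * ∫⁻ s in rotatedSquare 0 0 1, ENNReal.ofReal (w (a + v * s)) ≠ 0 := by
  refine mul_ne_zero (ENNReal.inv_ne_zero.2 (by norm_num)) ?_
  have hm := h.measurable
  rw [← pos_iff_ne_zero, lintegral_pos_iff_support (by fun_prop)]
  have : Function.support (fun s => ENNReal.ofReal (w (a + v * s))) = Set.univ :=
    Set.eq_univ_of_forall fun s => (ENNReal.ofReal_pos.2 (h.pos _)).ne'
  rw [this, Measure.restrict_apply_univ, volume_rotatedSquare_zero]
  norm_num

/-- The product in the characteristic is finite and its first factor is not zero, so the second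
factor is finite. -/
theorem lintegral_dualWeight_lt_top (h : IsRegularWeight p w) (a : ℂ) {v : ℂ} (hv : v ≠ 0) :
    ∫⁻ s in rotatedSquare 0 0 1, ENNReal.ofReal (dualWeight p w (a + v * s)) < ∞ := by
  have h1 := (laverage_mul_le_apCharacteristic p w a hv).trans_lt h.characteristic_lt_top
  have h2 := ENNReal.lt_top_of_mul_ne_top_right h1.ne (h.lintegral_weight_ne_zero a v)
  have h3 := (ENNReal.rpow_lt_top_iff_of_pos (sub_pos.2 h.one_lt)).1 h2
  exact ENNReal.lt_top_of_mul_ne_top_right h3.ne (ENNReal.inv_ne_zero.2 (by norm_num))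

theorem locallyIntegrable_dualWeight (h : IsRegularWeight p w) :
    LocallyIntegrable (dualWeight p w) := by
  intro x
  refine ⟨rotatedSquare x (1 : ℂ).arg ‖(1 : ℂ)‖, ?_, ?_⟩
  · refine Filter.mem_of_superset (Metric.ball_mem_nhds x one_pos) fun z hz => ?_
    rw [rotatedSquare_eq]
    have hz' : ‖z - x‖ < 1 := by simpa [dist_eq_norm] using hz
    refine ⟨z - x, mem_rotatedSquare_zero.2 ⟨?_, ?_⟩, by ring⟩
    · exact (Complex.abs_re_le_norm _).trans hz'.le
    · exact (Complex.abs_im_le_norm _).trans hz'.le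
  · refine ⟨h.measurable_dualWeight.aestronglyMeasurable, ?_⟩
    rw [hasFiniteIntegral_iff_ofReal (Eventually.of_forall fun z => (h.dualWeight_pos z).le),
      setLIntegral_rotatedSquare _ x one_ne_zero]
    exact ENNReal.mul_lt_top ENNReal.ofReal_lt_top (h.lintegral_dualWeight_lt_top x one_ne_zero)

theorem ofReal_squareMean_le {φ : ℂ → ℝ} (h0 : ∀ z, 0 ≤ φ z) (hφ : LocallyIntegrable φ) (a : ℂ)
    {v : ℂ} (hv : v ≠ 0) : ENNReal.ofReal (squareMean φ a v) ≤
      4⁻¹ * ∫⁻ s in rotatedSquare 0 0 1, ENNReal.ofReal (φ (a + v * s)) := by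
  rw [squareMean, smul_eq_mul, ENNReal.ofReal_mul (by norm_num),
    ofReal_integral_eq_lintegral_ofReal (integrableOn_baseSquare_comp hφ a hv)
      (Eventually.of_forall fun _ => h0 _), ENNReal.ofReal_inv_of_pos (by norm_num)]
  gcongr
  · norm_num
  · exact baseSquare_subset

theorem squareMean_mul_le (h : IsRegularWeight p w) (a : ℂ) {v : ℂ} (hv : v ≠ 0) :
    squareMean w a v * squareMean (dualWeight p w) a v ^ (p - 1) ≤ (apCharacteristic p w).toReal := by
  have hp := (sub_pos.2 h.one_lt).le
  have hw0 := squareMean_nonneg (fun z => (h.pos z).le) a v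
  have hs0 := squareMean_nonneg (fun z => (h.dualWeight_pos z).le) a v
  rw [← ENNReal.ofReal_le_iff_le_toReal h.characteristic_lt_top.ne, ENNReal.ofReal_mul hw0,
    ← ENNReal.ofReal_rpow_of_nonneg hs0 hp]
  refine le_trans ?_ (laverage_mul_le_apCharacteristic p w a hv)
  gcongr
  · exact ofReal_squareMean_le (fun z => (h.pos z).le) h.locallyIntegrable a hv
  · exact ofReal_squareMean_le (fun z => (h.dualWeight_pos z).le) h.locallyIntegrable_dualWeight a hv

theorem rpow_mul_dualWeight_rpow {q : ℝ} (hpq : p.HolderConjugate q) (h : IsRegularWeight p w)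
    (z : ℂ) : w z ^ (1 / p) * dualWeight p w z ^ (1 / q) = 1 := by
  rw [dualWeight, ← Real.rpow_mul (h.pos z).le, ← Real.rpow_add (h.pos z)]
  have : 1 / p + -1 / (p - 1) * (1 / q) = 0 := by
    rw [div_mul_div_comm, hpq.sub_one_mul_conj]
    ring
  rw [this, Real.rpow_zero]

/-- Hölder's inequality for the identity `w ^ (1 / p) * σ ^ (1 / q) = 1`, raised to the power `p`.
-/
theorem one_le_squareMean_mul (h : IsRegularWeight p w) (a : ℂ) {v : ℂ} (hv : v ≠ 0) :
    1 ≤ squareMean w a v * squareMean (dualWeight p w) a v ^ (p - 1) := by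
  have hpq := Real.HolderConjugate.conjExponent h.one_lt
  have hw0 := squareMean_nonneg (fun z => (h.pos z).le) a v
  have hs0 := squareMean_nonneg (fun z => (h.dualWeight_pos z).le) a v
  have h1 := squareMean_rpow_mul_rpow_le hpq (fun z => (h.pos z).le)
    (fun z => (h.dualWeight_pos z).le) h.locallyIntegrable h.locallyIntegrable_dualWeight a hv
  simp only [h.rpow_mul_dualWeight_rpow hpq] at h1
  have e1 : squareMean (fun _ : ℂ => (1 : ℝ)) a v = 1 := by
    rw [squareMean, integral_const, measureReal_def, Measure.restrict_apply_univ, volume_baseSquare]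
    norm_num
  rw [e1] at h1
  have h2 := Real.rpow_le_rpow zero_le_one h1 hpq.nonneg
  rw [Real.one_rpow, Real.mul_rpow (Real.rpow_nonneg hw0 _) (Real.rpow_nonneg hs0 _),
    ← Real.rpow_mul hw0, ← Real.rpow_mul hs0, one_div_mul_cancel hpq.ne_zero, Real.rpow_one] at h2
  have e2 : 1 / p.conjExponent * p = p - 1 := by
    rw [one_div_mul_eq_div, div_eq_iff hpq.symm.ne_zero, hpq.sub_one_mul_conj]
  rwa [e2] at h2

end IsRegularWeight

/-! ### The weighted bilinear bound -/

theorem locallyIntegrable_norm_rpow_mul {w : ℂ → ℝ} (hw : LocallyIntegrable w) {f : ℂ → ℂ}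
    (hf : Measurable f) {C : ℝ} (hC : ∀ z, ‖f z‖ ≤ C) {p : ℝ} (hp : 0 ≤ p) :
    LocallyIntegrable fun z => ‖f z‖ ^ p * w z := by
  intro x
  obtain ⟨u, hu, hi⟩ := hw x
  refine ⟨u, hu, hi.bdd_mul (c := C ^ p) ((hf.norm.pow_const p).aestronglyMeasurable) ?_⟩
  refine Eventually.of_forall fun z => ?_
  rw [Real.norm_of_nonneg (by positivity)]
  exact Real.rpow_le_rpow (norm_nonneg _) (hC z) hp

theorem integrable_test_norm_rpow_mul {w : ℂ → ℝ} (hw : LocallyIntegrable w) {g : ℂ → ℂ}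
    (hg : IsTestFunction g) {q : ℝ} (hq : 0 < q) : Integrable fun z => ‖g z‖ ^ q * w z := by
  obtain ⟨C, -, hC⟩ := hg.exists_bound
  obtain ⟨ρ, hρ⟩ := hg.exists_radius
  have h := (locallyIntegrable_norm_rpow_mul hw hg.measurable hC hq.le).integrableOn_isCompact
    (isCompact_closedBall (0 : ℂ) ρ)
  rw [← integrable_indicator_iff measurableSet_closedBall] at h
  refine h.congr (Eventually.of_forall fun z => ?_)
  by_cases hz : z ∈ Metric.closedBall (0 : ℂ) ρ
  · rw [Set.indicator_of_mem hz]
  · rw [Set.indicator_of_notMem hz]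
    beta_reduce
    rw [hρ z (by simpa using hz), norm_zero, Real.zero_rpow hq.ne',
      zero_mul]

/-- The weighted bound for the bilinear form of the Beurling transform. -/
theorem exists_norm_integral_mul_beurling_le {p q : ℝ} (hpq : p.HolderConjugate q) :
    ∃ C : ℝ, 0 < C ∧ ∀ w : ℂ → ℝ, IsRegularWeight p w → ∀ f : 𝓢(ℂ, ℂ),
      Integrable (fun z => ‖f z‖ ^ p * w z) → ∀ g : ℂ → ℂ, IsTestFunction g →
      ‖∫ z, g z * beurling f z‖ ≤ C * (apCharacteristic p w).toReal ^ (max p q / p) *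
        ((∫ z, ‖f z‖ ^ p * w z) ^ (1 / p) * (∫ z, ‖g z‖ ^ q * dualWeight p w z) ^ (1 / q)) := by
  obtain ⟨C, hC, hT⟩ := exists_treeSum_le hpq
  have hc := norm_pos_iff.2 haarConstant_ne_zero
  refine ⟨4 * ‖haarConstant‖⁻¹ * C, by positivity, fun w hw f hf g hg => ?_⟩
  set σ := dualWeight p w with hσ
  set A := (apCharacteristic p w).toReal with hA
  obtain ⟨Cf, -, hCf⟩ := exists_norm_schwartz_le f
  obtain ⟨Cg, -, hCg⟩ := hg.exists_bound
  have hfm := f.continuous.measurable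
  have hgm := hg.measurable
  have hσm := hw.measurable_dualWeight
  have hwm := hw.measurable
  have hfL : LocallyIntegrable f := f.integrable.locallyIntegrable
  have hgL : LocallyIntegrable g := hg.integrable.locallyIntegrable
  have hgi := integrable_test_norm_rpow_mul hw.locallyIntegrable_dualWeight hg hpq.symm.pos
  have hP0 : ∀ z, 0 ≤ ‖f z‖ ^ p * w z := fun z => mul_nonneg (by positivity) (hw.pos z).le
  have hQ0 : ∀ z, 0 ≤ ‖g z‖ ^ q * σ z := fun z => mul_nonneg (by positivity) (hw.dualWeight_pos z).le
  -- This factorisation and the next, averaged by Hölder's inequality, give the two hypotheses of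
  -- the tree bound that relate `X` to `P` and `Y` to `Q`.
  have hfeq : ∀ z, ‖f z‖ = (‖f z‖ ^ p * w z) ^ (1 / p) * σ z ^ (1 / q) := fun z => by
    rw [Real.mul_rpow (by positivity) (hw.pos z).le, ← Real.rpow_mul (norm_nonneg _),
      mul_one_div_cancel hpq.ne_zero, Real.rpow_one, mul_assoc, hw.rpow_mul_dualWeight_rpow hpq,
      mul_one]
  have hgeq : ∀ z, ‖g z‖ = (‖g z‖ ^ q * σ z) ^ (1 / q) * w z ^ (1 / p) := fun z => by
    rw [Real.mul_rpow (by positivity) (hw.dualWeight_pos z).le, ← Real.rpow_mul (norm_nonneg _),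
      mul_one_div_cancel hpq.symm.ne_zero, Real.rpow_one, mul_assoc, mul_comm (_ ^ (1 / q)),
      hw.rpow_mul_dualWeight_rpow hpq, mul_one]
  have key := norm_integral_mul_beurling_le f hg (K := C * A ^ (max p q / p) *
    ((∫ z, ‖f z‖ ^ p * w z) ^ (1 / p) * (∫ z, ‖g z‖ ^ q * σ z) ^ (1 / q))) ?_
  · exact key.trans (le_of_eq (by ring))
  intro v hv m
  have hpt : ∀ a : ℂ, ‖treeSum (childSquare v) (nodeHaarProd v f g) m (a, 0)‖ ≤
      C * A ^ (max p q / p) * (squareMean (fun z => ‖f z‖ ^ p * w z) a v ^ (1 / p) *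
        squareMean (fun z => ‖g z‖ ^ q * σ z) a v ^ (1 / q)) := by
    intro a
    refine (norm_treeSum_le _ _ _).trans ?_
    simp only [norm_nodeHaarProd hv hfL hgL]
    have hPL := locallyIntegrable_norm_rpow_mul hw.locallyIntegrable hfm hCf hpq.nonneg
    have hQL := locallyIntegrable_norm_rpow_mul hw.locallyIntegrable_dualWeight hgm hCg
      hpq.symm.nonneg
    have h := hT (ch := childSquare v) (A := A) (isMean_nodeMean hv hfL) (isMean_nodeMean hv hgL)
      (S := nodeMean v σ) (W := nodeMean v w) (X := nodeMean v fun z => ‖f z‖)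
      (Y := nodeMean v fun z => ‖g z‖) (P := nodeMean v fun z => ‖f z‖ ^ p * w z)
      (Q := nodeMean v fun z => ‖g z‖ ^ q * σ z)
      (fun y => squareMean_pos hw.dualWeight_pos hw.locallyIntegrable_dualWeight _
        (div_two_pow_ne_zero hv _))
      (fun y => squareMean_pos hw.pos hw.locallyIntegrable _ (div_two_pow_ne_zero hv _))
      (isMean_nodeMean hv hw.locallyIntegrable_dualWeight) (isMean_nodeMean hv hw.locallyIntegrable)
      (isMean_nodeMean hv f.integrable.norm.locallyIntegrable) (isMean_nodeMean hv hg.integrable.norm.locallyIntegrable)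
      (isMean_nodeMean hv hPL) (isMean_nodeMean hv hQL)
      (fun y => squareMean_nonneg hP0 _ _) (fun y => squareMean_nonneg hQ0 _ _)
      (fun y => norm_squareMean_le _ _) (fun y => norm_squareMean_le _ _)
      (fun y => ?_) (fun y => ?_)
      (fun y => hw.one_le_squareMean_mul _ (div_two_pow_ne_zero hv _))
      (fun y => hw.squareMean_mul_le _ (div_two_pow_ne_zero hv _)) m (a, 0)
    · simpa only [nodeMean, pow_zero, div_one] using h
    · have h1 := squareMean_rpow_mul_rpow_le hpq hP0 (fun z => (hw.dualWeight_pos z).le) hPL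
        hw.locallyIntegrable_dualWeight y.1 (div_two_pow_ne_zero hv y.2)
      simp only [← hσ, ← hfeq] at h1
      exact h1
    · have h1 := squareMean_rpow_mul_rpow_le hpq.symm hQ0 (fun z => (hw.pos z).le) hQL
        hw.locallyIntegrable y.1 (div_two_pow_ne_zero hv y.2)
      simp only [← hgeq] at h1
      exact h1
  have hPi := integrable_squareMean_and_integral_eq (by fun_prop) hf v
  have hQi := integrable_squareMean_and_integral_eq (by fun_prop) hgi v
  -- The pointwise tree bound is integrated over all top squares: Hölder's inequality in the
  -- position, and means that preserve integrals.
  have hol := integrable_rpow_mul_rpow_and_integral_le hpq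
    (fun a => squareMean_nonneg hP0 a v) (fun a => squareMean_nonneg hQ0 a v) hPi.1 hQi.1
  rw [hPi.2, hQi.2] at hol
  calc _ ≤ ∫ a, C * A ^ (max p q / p) * (squareMean (fun z => ‖f z‖ ^ p * w z) a v ^ (1 / p) *
        squareMean (fun z => ‖g z‖ ^ q * σ z) a v ^ (1 / q)) :=
        integral_mono_of_nonneg (Eventually.of_forall fun _ => norm_nonneg _)
          (hol.1.const_mul _) (Eventually.of_forall hpt)
    _ ≤ _ := by
        rw [integral_const_mul]
        exact mul_le_mul_of_nonneg_left hol.2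
          (mul_nonneg hC.le (Real.rpow_nonneg ENNReal.toReal_nonneg _))

/-! ### Regular representatives and polynomial growth -/

theorem IsApWeight.exists_isRegularWeight {p : ℝ} (hp : 1 < p) {w : ℂ → ℝ} (hw : IsApWeight p w) :
    ∃ v : ℂ → ℝ, IsRegularWeight p v ∧ apCharacteristic p v = apCharacteristic p w ∧
      weightMeasure v = weightMeasure w := by
  have hm := hw.locallyIntegrable.aestronglyMeasurable.aemeasurable
  have hmk := hm.measurable_mk
  -- A measurable representative, replaced by one on the null set where it is not positive. Neither
  -- the averages nor the weighted measure notice the change.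
  set v : ℂ → ℝ := fun z => if 0 < hm.mk w z then hm.mk w z else 1 with hv
  have hvw : v =ᵐ[volume] w := by
    filter_upwards [hm.ae_eq_mk, hw.pos] with z h1 h2
    rw [hv]
    beta_reduce
    rw [← h1, if_pos h2]
  have hchar : apCharacteristic p v = apCharacteristic p w := by
    simp only [apCharacteristic]
    refine iSup_congr fun c => iSup_congr fun θ => iSup_congr fun r => iSup_congr fun _ => ?_
    have h : v =ᵐ[volume.restrict (rotatedSquare c θ r)] w := ae_restrict_of_ae hvw
    congr 1
    · exact laverage_congr (h.fun_comp fun x => ENNReal.ofReal x)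
    · congr 1
      exact laverage_congr (h.fun_comp fun x => ENNReal.ofReal (x ^ (-1 / (p - 1))))
  refine ⟨v, ⟨hp, ?_, fun z => ?_, fun x => ?_, ?_⟩, hchar, ?_⟩
  · exact Measurable.ite (measurableSet_lt measurable_const hmk) hmk measurable_const
  · rw [hv]
    beta_reduce
    split_ifs with h
    exacts [h, one_pos]
  · obtain ⟨u, hu, hi⟩ := hw.locallyIntegrable x
    exact ⟨u, hu, hi.congr (ae_restrict_of_ae hvw.symm)⟩
  · rw [hchar]
    exact hw.characteristic_lt_top
  · exact withDensity_congr_ae (hvw.fun_comp fun x => ENNReal.ofReal x)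

namespace IsRegularWeight

variable {p : ℝ} {w : ℂ → ℝ}

theorem integrable_weightMeasure_iff (h : IsRegularWeight p w) {φ : ℂ → ℝ} :
    Integrable φ (weightMeasure w) ↔ Integrable fun z => φ z * w z := by
  rw [weightMeasure, integrable_withDensity_iff_integrable_smul' h.measurable.ennreal_ofReal
    (Eventually.of_forall fun _ => ENNReal.ofReal_lt_top)]
  simp only [ENNReal.toReal_ofReal (h.pos _).le, smul_eq_mul, mul_comm]

theorem integral_weightMeasure (h : IsRegularWeight p w) (φ : ℂ → ℝ) :
    ∫ z, φ z ∂weightMeasure w = ∫ z, φ z * w z := by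
  rw [weightMeasure, integral_withDensity_eq_integral_toReal_smul h.measurable.ennreal_ofReal
    (Eventually.of_forall fun _ => ENNReal.ofReal_lt_top)]
  simp only [ENNReal.toReal_ofReal (h.pos _).le, smul_eq_mul, mul_comm]

theorem memLp_weightMeasure_iff (h : IsRegularWeight p w) {g : ℂ → ℂ} (hg : Measurable g) :
    MemLp g (ENNReal.ofReal p) (weightMeasure w) ↔ Integrable fun z => ‖g z‖ ^ p * w z := by
  have hp : 0 < p := one_pos.trans h.one_lt
  rw [← integrable_norm_rpow_iff hg.aestronglyMeasurable (ENNReal.ofReal_pos.2 hp).ne'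
    ENNReal.ofReal_ne_top, ENNReal.toReal_ofReal hp.le, h.integrable_weightMeasure_iff]

theorem toReal_eLpNorm_weightMeasure (h : IsRegularWeight p w) {g : ℂ → ℂ}
    (hg : MemLp g (ENNReal.ofReal p) (weightMeasure w)) :
    (eLpNorm g (ENNReal.ofReal p) (weightMeasure w)).toReal =
      (∫ z, ‖g z‖ ^ p * w z) ^ (1 / p) := by
  have hp : 0 < p := one_pos.trans h.one_lt
  rw [hg.eLpNorm_eq_integral_rpow_norm (ENNReal.ofReal_pos.2 hp).ne' ENNReal.ofReal_ne_top,
    ENNReal.toReal_ofReal hp.le, h.integral_weightMeasure, one_div, ENNReal.toReal_ofReal]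
  exact Real.rpow_nonneg (integral_nonneg fun z =>
    mul_nonneg (Real.rpow_nonneg (norm_nonneg _) _) (h.pos z).le) _

theorem isFiniteMeasureOnCompacts (h : IsRegularWeight p w) :
    IsFiniteMeasureOnCompacts (weightMeasure w) := by
  refine ⟨fun K hK => ?_⟩
  rw [weightMeasure, withDensity_apply _ hK.measurableSet,
    ← hasFiniteIntegral_iff_ofReal (Eventually.of_forall fun z => (h.pos z).le)]
  exact (h.locallyIntegrable.integrableOn_isCompact hK).2

theorem mem_rotatedSquare_natCast {z : ℂ} {k : ℕ} (hz : ‖z‖ ≤ (k + 1 : ℕ)) :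
    z ∈ rotatedSquare 0 ((k + 1 : ℕ) : ℂ).arg ‖((k + 1 : ℕ) : ℂ)‖ := by
  have hk : (0 : ℝ) < (k + 1 : ℕ) := by positivity
  have hn : ‖z / ((k + 1 : ℕ) : ℂ)‖ ≤ 1 := by
    rw [norm_div, Complex.norm_natCast, div_le_one hk]
    exact hz
  rw [rotatedSquare_eq]
  refine ⟨z / ((k + 1 : ℕ) : ℂ), mem_rotatedSquare_zero.2
    ⟨(Complex.abs_re_le_norm _).trans hn, (Complex.abs_im_le_norm _).trans hn⟩, ?_⟩
  have : ((k + 1 : ℕ) : ℂ) ≠ 0 := by exact_mod_cast hk.ne'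
  beta_reduce
  rw [zero_add, mul_div_cancel₀ _ this]

/-- A weight in `A_p` has at most the growth `R ^ (2 * p)` on squares of size `R`. -/
theorem exists_setLIntegral_le (h : IsRegularWeight p w) : ∃ B : ℝ≥0∞, B ≠ ∞ ∧ ∀ k : ℕ,
    ∫⁻ z in rotatedSquare 0 ((k + 1 : ℕ) : ℂ).arg ‖((k + 1 : ℕ) : ℂ)‖, ENNReal.ofReal (w z) ≤
      B * ENNReal.ofReal (((k + 1 : ℕ) : ℝ) ^ (2 * p)) := by
  have hp := sub_pos.2 h.one_lt
  -- The dual weight has at least its mass on the unit square in every larger one. The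
  -- characteristic then bounds the mass of `w` on a square of size `R` by a multiple of `R ^ 2 * R
  -- ^ (2 * (p - 1))`.
  set c : ℝ≥0∞ := 4⁻¹ * ∫⁻ s in rotatedSquare 0 0 1, ENNReal.ofReal (dualWeight p w s) with hc
  have hc0 : c ^ (p - 1) ≠ 0 := by
    rw [Ne, ENNReal.rpow_eq_zero_iff_of_pos hp]
    refine mul_ne_zero (ENNReal.inv_ne_zero.2 (by norm_num)) ?_
    have hm := h.measurable_dualWeight
    rw [← pos_iff_ne_zero, lintegral_pos_iff_support (by fun_prop)]
    have : Function.support (fun s => ENNReal.ofReal (dualWeight p w s)) = Set.univ :=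
      Set.eq_univ_of_forall fun s => (ENNReal.ofReal_pos.2 (h.dualWeight_pos _)).ne'
    rw [this, Measure.restrict_apply_univ, volume_rotatedSquare_zero]
    norm_num
  have hct : c ^ (p - 1) ≠ ∞ := by
    refine (ENNReal.rpow_lt_top_of_nonneg hp.le (ENNReal.mul_ne_top (by norm_num) ?_)).ne
    simpa using (h.lintegral_dualWeight_lt_top 0 one_ne_zero).ne
  refine ⟨4 * apCharacteristic p w / c ^ (p - 1),
    ENNReal.div_ne_top (ENNReal.mul_ne_top (by norm_num) h.characteristic_lt_top.ne) hc0,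
    fun k => ?_⟩
  have hk : (0 : ℝ) < (k + 1 : ℕ) := by positivity
  have hv : ((k + 1 : ℕ) : ℂ) ≠ 0 := by exact_mod_cast hk.ne'
  have hA := laverage_mul_le_apCharacteristic p w 0 hv
  have hw := setLIntegral_rotatedSquare (fun z => ENNReal.ofReal (w z)) 0 hv
  have hs := setLIntegral_rotatedSquare (fun z => ENNReal.ofReal (dualWeight p w z)) 0 hv
  have hsub : rotatedSquare 0 0 1 ⊆ rotatedSquare 0 ((k + 1 : ℕ) : ℂ).arg ‖((k + 1 : ℕ) : ℂ)‖ := by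
    rw [rotatedSquare_eq]
    intro s hs
    rw [mem_rotatedSquare_zero] at hs
    have h1 : (1 : ℝ) ≤ (k + 1 : ℕ) := by exact_mod_cast Nat.le_add_left 1 k
    refine ⟨s / (((k + 1 : ℕ) : ℝ) : ℂ), mem_rotatedSquare_zero.2 ⟨?_, ?_⟩, ?_⟩
    · rw [Complex.div_ofReal_re, abs_div, abs_of_pos hk]
      exact (div_le_one hk).2 (hs.1.trans h1)
    · rw [Complex.div_ofReal_im, abs_div, abs_of_pos hk]
      exact (div_le_one hk).2 (hs.2.trans h1)
    · beta_reduce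
      rw [zero_add, Complex.ofReal_natCast, mul_div_cancel₀ _ hv]
  have hcs : c ≤ 4⁻¹ * ∫⁻ z in rotatedSquare 0 ((k + 1 : ℕ) : ℂ).arg ‖((k + 1 : ℕ) : ℂ)‖,
      ENNReal.ofReal (dualWeight p w z) := by
    rw [hc]
    gcongr
  rw [hs, mul_left_comm] at hcs
  rw [hw]
  rw [Complex.norm_natCast] at hcs ⊢
  simp only [dualWeight] at hcs
  set W := ∫⁻ s in rotatedSquare 0 0 1, ENNReal.ofReal (w (0 + ((k + 1 : ℕ) : ℂ) * s))
  set S := 4⁻¹ * ∫⁻ s in rotatedSquare 0 0 1,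
    ENNReal.ofReal (w (0 + ((k + 1 : ℕ) : ℂ) * s) ^ (-1 / (p - 1)))
  set R := ENNReal.ofReal (((k + 1 : ℕ) : ℝ) ^ 2) with hR
  have hR0 : R ≠ 0 := (ENNReal.ofReal_pos.2 (by positivity)).ne'
  have hRp : ENNReal.ofReal (((k + 1 : ℕ) : ℝ) ^ (2 * p)) = R * R ^ (p - 1) := by
    rw [hR, ENNReal.ofReal_rpow_of_pos (by positivity), ← ENNReal.ofReal_mul (by positivity),
      ← Real.rpow_natCast, ← Real.rpow_mul hk.le, ← Real.rpow_add hk]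
    congr 2
    push_cast
    ring
  have hmain : W * c ^ (p - 1) ≤ 4 * apCharacteristic p w * R ^ (p - 1) := by
    calc W * c ^ (p - 1) ≤ W * (R * S) ^ (p - 1) := by gcongr
      _ = 4 * (4⁻¹ * W * S ^ (p - 1)) * R ^ (p - 1) := by
        rw [ENNReal.mul_rpow_of_nonneg _ _ hp.le, ← mul_assoc, ← mul_assoc, ← mul_assoc,
          ENNReal.mul_inv_cancel (by norm_num) (by norm_num), one_mul, mul_right_comm]
      _ ≤ _ := by gcongr
  rw [hRp, mul_left_comm]
  gcongr
  rw [← ENNReal.mul_div_right_comm, ENNReal.le_div_iff_mul_le (Or.inl hc0) (Or.inl hct)]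
  exact hmain

theorem hasTemperateGrowth (h : IsRegularWeight p w) : (weightMeasure w).HasTemperateGrowth := by
  obtain ⟨B, hB, hle⟩ := h.exists_setLIntegral_le
  -- Growth `2 * p` on squares, and two further powers to make the sum over `k` converge.
  obtain ⟨n, hn⟩ := exists_nat_ge (2 * p + 2)
  refine ⟨n, h.integrable_weightMeasure_iff.2 ⟨?_, ?_⟩⟩
  · have := h.measurable
    exact Measurable.aestronglyMeasurable (by fun_prop)
  have hnn : ∀ z : ℂ, 0 ≤ (1 + ‖z‖) ^ (-(n : ℝ)) * w z := fun z =>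
    mul_nonneg (by positivity) (h.pos z).le
  rw [hasFiniteIntegral_iff_ofReal (Eventually.of_forall hnn)]
  set Q : ℕ → Set ℂ := fun k => rotatedSquare 0 ((k + 1 : ℕ) : ℂ).arg ‖((k + 1 : ℕ) : ℂ)‖ with hQ
  have hQm : ∀ k, MeasurableSet (Q k) := fun k => by
    have hv : ((k + 1 : ℕ) : ℂ) ≠ 0 := by exact_mod_cast (Nat.succ_ne_zero k)
    simp only [hQ]
    rw [rotatedSquare_eq]
    exact ((measurableEmbedding_addLeft (0 : ℂ)).comp
      (measurableEmbedding_complex_mul_left hv)).measurableSet_image.2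
      measurableSet_rotatedSquare_zero
  have hpt : ∀ z : ℂ, ENNReal.ofReal ((1 + ‖z‖) ^ (-(n : ℝ)) * w z) ≤
      ∑' k : ℕ, (Q k).indicator (fun z =>
        ENNReal.ofReal (((k + 1 : ℕ) : ℝ) ^ (-(n : ℝ))) * ENNReal.ofReal (w z)) z := by
    intro z
    -- The point `z` lies in the square with index `⌊‖z‖⌋₊`; this single term of the sum already
    -- dominates.
    refine le_trans ?_ (ENNReal.le_tsum ⌊‖z‖⌋₊)
    have h1 : ‖z‖ ≤ ((⌊‖z‖⌋₊ + 1 : ℕ) : ℝ) := by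
      push_cast
      exact (Nat.lt_floor_add_one _).le
    rw [Set.indicator_of_mem (mem_rotatedSquare_natCast h1), ← ENNReal.ofReal_mul (by positivity)]
    refine ENNReal.ofReal_le_ofReal (mul_le_mul_of_nonneg_right ?_ (h.pos z).le)
    refine Real.rpow_le_rpow_of_nonpos (by positivity) ?_ (by simp)
    push_cast
    linarith [Nat.floor_le (norm_nonneg z)]
  have hwm := h.measurable
  refine lt_of_le_of_lt (lintegral_mono hpt) ?_
  rw [lintegral_tsum fun k => Measurable.aemeasurable (Measurable.indicator (by fun_prop) (hQm k))]
  have hk : ∀ k : ℕ, ∫⁻ z, (Q k).indicator (fun z =>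
      ENNReal.ofReal (((k + 1 : ℕ) : ℝ) ^ (-(n : ℝ))) * ENNReal.ofReal (w z)) z ≤
      B * ENNReal.ofReal (1 / ((k + 1 : ℕ) : ℝ) ^ 2) := by
    intro k
    rw [lintegral_indicator (hQm k), lintegral_const_mul _ (by fun_prop)]
    have hk0 : (0 : ℝ) < (k + 1 : ℕ) := by positivity
    have hk1 : (1 : ℝ) ≤ (k + 1 : ℕ) := by exact_mod_cast Nat.le_add_left 1 k
    calc _ ≤ ENNReal.ofReal (((k + 1 : ℕ) : ℝ) ^ (-(n : ℝ))) *
          (B * ENNReal.ofReal (((k + 1 : ℕ) : ℝ) ^ (2 * p))) := by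
          gcongr
          exact hle k
      _ = B * ENNReal.ofReal (((k + 1 : ℕ) : ℝ) ^ (-(n : ℝ) + 2 * p)) := by
          rw [mul_left_comm, ← ENNReal.ofReal_mul (by positivity), ← Real.rpow_add hk0]
      _ ≤ _ := by
          gcongr
          rw [one_div, ← Real.rpow_natCast, ← Real.rpow_neg hk0.le]
          refine Real.rpow_le_rpow_of_exponent_le hk1 ?_
          push_cast
          linarith
  refine lt_of_le_of_lt (ENNReal.tsum_le_tsum hk) ?_
  rw [ENNReal.tsum_mul_left]
  refine ENNReal.mul_lt_top hB.lt_top ?_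
  have hsum : Summable fun k : ℕ => 1 / ((k + 1 : ℕ) : ℝ) ^ 2 :=
    (summable_nat_add_iff 1).2 (Real.summable_one_div_nat_pow.2 one_lt_two)
  rw [← ENNReal.ofReal_tsum_of_nonneg (fun k => by positivity) hsum]
  exact ENNReal.ofReal_lt_top

end IsRegularWeight

/-! ### Duality between the weighted spaces -/

/-- A truncation of the function that is extremal in the duality between `L^p(w)` and `L^q(σ)`. -/
noncomputable def truncatedDual (p : ℝ) (w : ℂ → ℝ) (F : ℂ → ℂ) (k : ℕ) : ℂ → ℂ :=
  {z | ‖z‖ ≤ k ∧ w z ≤ k}.indicator fun z =>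
    (starRingEnd ℂ) (F z) * ((‖F z‖ ^ (p - 2) * w z : ℝ) : ℂ)

namespace IsRegularWeight

variable {p q : ℝ} {w : ℂ → ℝ} {F : ℂ → ℂ}

theorem measurableSet_truncation (h : IsRegularWeight p w) (k : ℕ) :
    MeasurableSet {z : ℂ | ‖z‖ ≤ k ∧ w z ≤ k} :=
  (measurableSet_le measurable_norm measurable_const).inter
    (measurableSet_le h.measurable measurable_const)

theorem norm_dual (h : IsRegularWeight p w) (F : ℂ → ℂ) (z : ℂ) :
    ‖(starRingEnd ℂ) (F z) * ((‖F z‖ ^ (p - 2) * w z : ℝ) : ℂ)‖ = ‖F z‖ ^ (p - 1) * w z := by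
  have hp := sub_pos.2 h.one_lt
  rw [norm_mul, RCLike.norm_conj, Complex.norm_real, Real.norm_of_nonneg
    (mul_nonneg (Real.rpow_nonneg (norm_nonneg _) _) (h.pos z).le), ← mul_assoc]
  rcases (norm_nonneg (F z)).eq_or_lt with h0 | h0
  · rw [← h0, Real.zero_rpow hp.ne', zero_mul]
  · rw [← Real.rpow_one_add' h0.le (by linarith)]
    congr 2
    ring

theorem isTestFunction_truncatedDual (h : IsRegularWeight p w) (hF : Measurable F) {M : ℝ}
    (hM : ∀ z, ‖F z‖ ≤ M) (k : ℕ) : IsTestFunction (truncatedDual p w F k) := by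
  have hp := sub_pos.2 h.one_lt
  have hM0 : 0 ≤ M := (norm_nonneg _).trans (hM 0)
  have hwm := h.measurable
  refine ⟨Measurable.indicator (by fun_prop) (h.measurableSet_truncation k),
    ⟨M ^ (p - 1) * k, by positivity, fun z => ?_⟩, ⟨k, fun z hz => ?_⟩⟩
  · by_cases hz : z ∈ {z : ℂ | ‖z‖ ≤ k ∧ w z ≤ k}
    · rw [truncatedDual, Set.indicator_of_mem hz, h.norm_dual]
      exact mul_le_mul (Real.rpow_le_rpow (norm_nonneg _) (hM z) hp.le) hz.2 (h.pos z).le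
        (by positivity)
    · rw [truncatedDual, Set.indicator_of_notMem hz, norm_zero]
      positivity
  · exact Set.indicator_of_notMem (fun hz' => hz.not_ge hz'.1) _

theorem truncatedDual_mul (h : IsRegularWeight p w) (F : ℂ → ℂ) (k : ℕ) (z : ℂ) :
    truncatedDual p w F k z * F z =
      (({z | ‖z‖ ≤ k ∧ w z ≤ k}.indicator (fun z => ‖F z‖ ^ p * w z) z : ℝ) : ℂ) := by
  have hp : p ≠ 0 := (one_pos.trans h.one_lt).ne'
  by_cases hz : z ∈ {z : ℂ | ‖z‖ ≤ k ∧ w z ≤ k}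
  · rw [truncatedDual, Set.indicator_of_mem hz, Set.indicator_of_mem hz, mul_right_comm,
      ← Complex.normSq_eq_conj_mul_self, ← Complex.ofReal_mul, ← mul_assoc,
      Complex.normSq_eq_norm_sq]
    congr 2
    rcases (norm_nonneg (F z)).eq_or_lt with h0 | h0
    · rw [← h0, Real.zero_rpow hp]
      simp
    · rw [← Real.rpow_natCast, ← Real.rpow_add h0]
      congr 1
      push_cast
      ring
  · rw [truncatedDual, Set.indicator_of_notMem hz, Set.indicator_of_notMem hz, zero_mul,
      Complex.ofReal_zero]

theorem norm_truncatedDual_rpow_mul (hpq : p.HolderConjugate q) (h : IsRegularWeight p w)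
    (F : ℂ → ℂ) (k : ℕ) (z : ℂ) :
    ‖truncatedDual p w F k z‖ ^ q * dualWeight p w z =
      {z | ‖z‖ ≤ k ∧ w z ≤ k}.indicator (fun z => ‖F z‖ ^ p * w z) z := by
  have hp := sub_pos.2 h.one_lt
  by_cases hz : z ∈ {z : ℂ | ‖z‖ ≤ k ∧ w z ≤ k}
  · rw [truncatedDual, Set.indicator_of_mem hz, Set.indicator_of_mem hz, h.norm_dual,
      Real.mul_rpow (Real.rpow_nonneg (norm_nonneg _) _) (h.pos z).le,
      ← Real.rpow_mul (norm_nonneg _), hpq.sub_one_mul_conj, mul_assoc, dualWeight,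
      ← Real.rpow_add (h.pos z)]
    have : q + -1 / (p - 1) = 1 := by
      have h1 := hpq.sub_one_mul_conj
      field_simp
      linarith
    rw [this, Real.rpow_one]
  · rw [truncatedDual, Set.indicator_of_notMem hz, Set.indicator_of_notMem hz, norm_zero,
      Real.zero_rpow hpq.symm.ne_zero, zero_mul]

/-- The converse of Hölder's inequality for the pairing of `L^p(w)` with `L^q(σ)`. -/
theorem integrable_and_integral_rpow_le (hpq : p.HolderConjugate q) (h : IsRegularWeight p w)
    (hF : Measurable F) {M : ℝ} (hM : ∀ z, ‖F z‖ ≤ M) {K : ℝ} (hK : 0 ≤ K)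
    (hb : ∀ g, IsTestFunction g →
      ‖∫ z, g z * F z‖ ≤ K * (∫ z, ‖g z‖ ^ q * dualWeight p w z) ^ (1 / q)) :
    Integrable (fun z => ‖F z‖ ^ p * w z) ∧ (∫ z, ‖F z‖ ^ p * w z) ^ (1 / p) ≤ K := by
  have hp : 0 < p := hpq.pos
  have hnn : ∀ z, 0 ≤ ‖F z‖ ^ p * w z := fun z =>
    mul_nonneg (Real.rpow_nonneg (norm_nonneg _) _) (h.pos z).le
  have hwm := h.measurable
  have hmeas : Measurable fun z => ‖F z‖ ^ p * w z := by fun_prop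
  have hE : ∀ k : ℕ, ∫⁻ z in {z : ℂ | ‖z‖ ≤ k ∧ w z ≤ k}, ENNReal.ofReal (‖F z‖ ^ p * w z) ≤
      ENNReal.ofReal (K ^ p) := by
    intro k
    have hS := h.measurableSet_truncation k
    have ht := h.isTestFunction_truncatedDual hF hM k
    have h1 := hb _ ht
    have hi := integrable_test_norm_rpow_mul h.locallyIntegrable_dualWeight ht hpq.symm.pos
    simp only [h.truncatedDual_mul, norm_truncatedDual_rpow_mul hpq h] at h1 hi
    rw [integrable_indicator_iff hS] at hi
    rw [integral_complex_ofReal, Complex.norm_real, integral_indicator hS,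
      Real.norm_of_nonneg (setIntegral_nonneg hS fun z _ => hnn z)] at h1
    rw [← ofReal_integral_eq_lintegral_ofReal hi (Eventually.of_forall hnn)]
    refine ENNReal.ofReal_le_ofReal ?_
    set I := ∫ z in {z : ℂ | ‖z‖ ≤ k ∧ w z ≤ k}, ‖F z‖ ^ p * w z with hI
    have hI0 : 0 ≤ I := setIntegral_nonneg hS fun z _ => hnn z
    rcases hI0.eq_or_lt with h0 | h0
    · rw [← h0]
      positivity
    -- The truncated extremal function has pairing `I` with `F` and dual norm `I ^ (1 / q)`.
    -- Truncation makes `I` finite, so one may divide by this power.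
    have h2 : I ^ (1 / p) ≤ K := by
      have e : I = I ^ (1 / p) * I ^ (1 / q) := by
        rw [← Real.rpow_add h0, one_div, one_div, hpq.inv_add_inv_eq_one, Real.rpow_one]
      exact le_of_mul_le_mul_right (e.symm.trans_le h1) (Real.rpow_pos_of_pos h0 _)
    calc I = (I ^ (1 / p)) ^ p := by rw [← Real.rpow_mul h0.le, one_div_mul_cancel hp.ne', Real.rpow_one]
      _ ≤ K ^ p := Real.rpow_le_rpow (Real.rpow_nonneg h0.le _) h2 hp.le
  have hU : ⋃ k : ℕ, {z : ℂ | ‖z‖ ≤ k ∧ w z ≤ k} = Set.univ := by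
    refine Set.eq_univ_of_forall fun z => ?_
    obtain ⟨k, hk⟩ := exists_nat_ge (max ‖z‖ (w z))
    exact Set.mem_iUnion.2 ⟨k, (le_max_left _ _).trans hk, (le_max_right _ _).trans hk⟩
  have hdir : Directed (· ⊆ ·) fun k : ℕ => {z : ℂ | ‖z‖ ≤ k ∧ w z ≤ k} :=
    directed_of_isDirected_le fun i j hij z hz => by
      have : (i : ℝ) ≤ j := by exact_mod_cast hij
      exact ⟨hz.1.trans this, hz.2.trans this⟩
  have htot : ∫⁻ z, ENNReal.ofReal (‖F z‖ ^ p * w z) ≤ ENNReal.ofReal (K ^ p) := by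
    rw [← setLIntegral_univ, ← hU, setLIntegral_iUnion_of_directed _ hdir]
    exact iSup_le hE
  refine ⟨⟨hmeas.aestronglyMeasurable, ?_⟩, ?_⟩
  · rw [hasFiniteIntegral_iff_ofReal (Eventually.of_forall hnn)]
    exact htot.trans_lt ENNReal.ofReal_lt_top
  · rw [integral_eq_lintegral_of_nonneg_ae (Eventually.of_forall hnn) hmeas.aestronglyMeasurable]
    have := ENNReal.toReal_le_of_le_ofReal (by positivity) htot
    calc _ ≤ (K ^ p) ^ (1 / p) := Real.rpow_le_rpow ENNReal.toReal_nonneg this (by positivity)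
      _ = K := by rw [← Real.rpow_mul hK, mul_one_div_cancel hp.ne', Real.rpow_one]

end IsRegularWeight

/-! ### Extension to the weighted space -/

/-- The weighted bound for the Beurling transform of Schwartz functions. -/
theorem exists_toReal_eLpNorm_beurling_le {p q : ℝ} (hpq : p.HolderConjugate q) :
    ∃ C : ℝ, 0 < C ∧ ∀ w : ℂ → ℝ, IsRegularWeight p w → ∀ f : 𝓢(ℂ, ℂ),
      MemLp (beurling f) (ENNReal.ofReal p) (weightMeasure w) ∧
      (eLpNorm (beurling f) (ENNReal.ofReal p) (weightMeasure w)).toReal ≤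
        C * (apCharacteristic p w).toReal ^ (max p q / p) *
          (eLpNorm f (ENNReal.ofReal p) (weightMeasure w)).toReal := by
  obtain ⟨C, hC, hb⟩ := exists_norm_integral_mul_beurling_le hpq
  refine ⟨C, hC, fun w hw f => ?_⟩
  have := hw.hasTemperateGrowth
  have hf : MemLp f (ENNReal.ofReal p) (weightMeasure w) := f.memLp _ _
  have hfi := (hw.memLp_weightMeasure_iff f.continuous.measurable).1 hf
  obtain ⟨M, -, hM⟩ := exists_norm_beurling_le f
  have hI : 0 ≤ ∫ z, ‖f z‖ ^ p * w z := integral_nonneg fun z =>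
    mul_nonneg (Real.rpow_nonneg (norm_nonneg _) _) (hw.pos z).le
  have key := hw.integrable_and_integral_rpow_le hpq (measurable_beurling f) hM
    (K := C * (apCharacteristic p w).toReal ^ (max p q / p) * (∫ z, ‖f z‖ ^ p * w z) ^ (1 / p))
    (mul_nonneg (mul_nonneg hC.le (Real.rpow_nonneg ENNReal.toReal_nonneg _))
      (Real.rpow_nonneg hI _))
    fun g hg => (hb w hw f hfi g hg).trans_eq (mul_assoc _ _ _).symm
  have hT := (hw.memLp_weightMeasure_iff (measurable_beurling f)).2 key.1
  refine ⟨hT, ?_⟩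
  rw [hw.toReal_eLpNorm_weightMeasure hT, hw.toReal_eLpNorm_weightMeasure hf]
  exact key.2

/-- Schwartz functions are dense in `L^p` of a measure of temperate growth that is finite on compact
sets. A linear map bounded on a dense subspace extends uniquely with the same bound. -/
theorem exists_isBeurlingExtension {p : ℝ} [Fact (1 < p)] {w : ℂ → ℝ}
    [(weightMeasure w).HasTemperateGrowth] [IsFiniteMeasureOnCompacts (weightMeasure w)]
    (hac : volume ≪ weightMeasure w) {K : ℝ} (hK : 0 ≤ K)
    (hT : ∀ f : 𝓢(ℂ, ℂ), MemLp (beurling f) (ENNReal.ofReal p) (weightMeasure w))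
    (hb : ∀ f : 𝓢(ℂ, ℂ), (eLpNorm (beurling f) (ENNReal.ofReal p) (weightMeasure w)).toReal ≤
      K * (eLpNorm f (ENNReal.ofReal p) (weightMeasure w)).toReal) :
    ∃ A : WeightedLp p w →L[ℂ] WeightedLp p w, IsBeurlingExtension p w A ∧
      (∀ B : WeightedLp p w →L[ℂ] WeightedLp p w, IsBeurlingExtension p w B → B = A) ∧
      ‖A‖ ≤ K := by
  have hac' : weightMeasure w ≪ volume := withDensity_absolutelyContinuous _ _
  let e : 𝓢(ℂ, ℂ) →ₗ[ℂ] WeightedLp p w :=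
    (SchwartzMap.toLpCLM ℂ ℂ (ENNReal.ofReal p) (weightMeasure w)).toLinearMap
  have hd : DenseRange e :=
    SchwartzMap.denseRange_toLpCLM (F := ℂ) (μ := weightMeasure w) (p := ENNReal.ofReal p)
      ENNReal.ofReal_ne_top
  let T : 𝓢(ℂ, ℂ) →ₗ[ℂ] WeightedLp p w :=
    { toFun := fun f => (hT f).toLp (beurling f)
      map_add' := fun f g => by
        rw [← MemLp.toLp_add]
        exact MemLp.toLp_congr _ _ (Eventually.of_forall fun z => beurling_add f g z)
      map_smul' := fun c f => by
        rw [RingHom.id_apply, ← MemLp.toLp_const_smul]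
        exact MemLp.toLp_congr _ _ (Eventually.of_forall fun z => beurling_smul c f z) }
  have hn : ∀ f, ‖T f‖ ≤ K * ‖e f‖ := fun f => by
    have h1 : ‖T f‖ = _ := Lp.norm_toLp _ (hT f)
    have h2 : ‖e f‖ = _ := Lp.norm_toLp _ (f.memLp (ENNReal.ofReal p) (weightMeasure w))
    rw [h1, h2]
    exact hb f
  have hA : IsBeurlingExtension p w (T.extendOfNorm e) := fun f => by
    -- An extension must agree with `T f` almost everywhere for Lebesgue measure, whereas elements
    -- of `L^p(w)` are determined almost everywhere for the weighted measure. Positivity of the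
    -- weight makes the null sets coincide.
    refine ⟨f.memLp _ _, hac.ae_le ?_⟩
    have h1 : T.extendOfNorm e (e f) = T f := LinearMap.extendOfNorm_eq hd ⟨K, hn⟩ f
    have h2 : (f.memLp (ENNReal.ofReal p) (weightMeasure w)).toLp f = e f := rfl
    rw [h2, h1]
    exact (hT f).coeFn_toLp
  refine ⟨T.extendOfNorm e, hA, fun B hB => ?_, LinearMap.opNorm_extendOfNorm_le hd hK hn⟩
  refine ContinuousLinearMap.coeFn_injective (hd.equalizer B.continuous
    (T.extendOfNorm e).continuous (funext fun f => ?_))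
  obtain ⟨h1, h2⟩ := hA f
  obtain ⟨h3, h4⟩ := hB f
  refine Lp.ext (hac'.ae_le ?_)
  filter_upwards [h2, h4] with z h2 h4
  exact h4.trans h2.symm

theorem IsRegularWeight.volume_absolutelyContinuous {p : ℝ} {w : ℂ → ℝ}
    (hw : IsRegularWeight p w) : volume ≪ weightMeasure w :=
  withDensity_absolutelyContinuous' hw.measurable.ennreal_ofReal.aemeasurable
    (Eventually.of_forall fun z => (ENNReal.ofReal_pos.2 (hw.pos z)).ne')

theorem theorem2p12 :
    -- the principal value defining `T f` exists everywhere for every Schwartz function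
    (∀ (f : 𝓢(ℂ, ℂ)) (z : ℂ),
      Tendsto (truncatedBeurling f z) (𝓝[>] 0) (𝓝 (beurling f z))) ∧
    -- `T` extends uniquely to a bounded operator on `L^p(w)`, with the stated norm bound
    ∀ (p : ℝ) [Fact (1 < p)], ∃ C : ℝ, 0 < C ∧ ∀ w : ℂ → ℝ, IsApWeight p w →
      ∃ A : WeightedLp p w →L[ℂ] WeightedLp p w,
        IsBeurlingExtension p w A ∧
        (∀ B : WeightedLp p w →L[ℂ] WeightedLp p w, IsBeurlingExtension p w B → B = A) ∧
        ‖A‖ ≤ C * (apCharacteristic p w).toReal ^ (max p (p / (p - 1)) / p) := by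
  refine ⟨tendsto_truncatedBeurling, fun p hp => ?_⟩
  obtain ⟨C, hC, hb⟩ := exists_toReal_eLpNorm_beurling_le
    (Real.HolderConjugate.conjExponent hp.out)
  refine ⟨C, hC, fun w hw => ?_⟩
  obtain ⟨v, hv, hchar, hmeas⟩ := hw.exists_isRegularWeight hp.out
  have h1 := hv.hasTemperateGrowth
  have h2 := hv.isFiniteMeasureOnCompacts
  have h3 := hv.volume_absolutelyContinuous
  have h4 := hb v hv
  rw [hmeas] at h1 h2 h3
  rw [hmeas, hchar] at h4
  exact exists_isBeurlingExtension h3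
    (mul_nonneg hC.le (Real.rpow_nonneg ENNReal.toReal_nonneg _))
    (fun f => (h4 f).1) fun f => (h4 f).2
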